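/- **Permutability for Bäcklund transformations of the flows of type $\hat B_n^{(1)}$.** *Setting.* Let $n,j\ge 1$, $N=2n+1$, $C=\sum_{i=1}^{N}(-1)^{n+i-1}e_{i,N+1-i}$, $A^\sharp=CA^tC$, $o(n+1,n)=\{A\in sl(N,\mathbb R): A^tC+CA=0\}$, and let $\mathcal B_n^+$ be its upper triangular matrices. Put $b=\sum_{i=1}^{2n}e_{i+1,i}$, $\beta=\frac12(e_{1,2n}+e_{2,2n+1})$, $J=b+\lambda\beta$. For smooth $q$ with values in $\mathcal B_n^+$ let $P(q,\lambda)=\beta\lambda+\sum_{i\le 0}P_i\lambda^i$ be the formal series with smooth coefficients in $o(n+1,n)$ that is conjugate to $J$ and satisfies $[\partial_x+J+q,P]=0$, and let $P_{2j-1,i}(q)$ be the coefficient of $\lambda^i$ in $P^{2j-1}$. The $(2j-1)$-th flow is $$q_t=[\partial_x+b+q,\;P_{2j-1,0}(q)].\qquad(\ast)$$ A frame of a solution $q$ is a smooth $F(x,t,\lambda)\in SL(N,\mathbb C)$, holomorphic in $\lambda\in\mathbb C$, with $F^tCF=C$, $\overline{F(x,t,\bar\lambda)}=F(x,t,\lambda)$,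 $F^{-1}F_x=J+q$, $F^{-1}F_t=(P^{2j-1})_+$, where $(\cdot)_+$ is the part with nonnegative powers of $\lambda$. For a projection $\pi$ of $\mathbb R^N$ and reals $a_1\ne a_2$ put $$g_{a_1,a_2,\pi}(\lambda)=\Bigl(I+\tfrac{a_2-a_1}{\lambda-a_2}(I-\pi^\sharp)\Bigr)\Bigl(I+\tfrac{a_1-a_2}{\lambda-a_1}(I-\pi)\Bigr).$$ For $q$, a map $F(x,t,\lambda)$ and a projection $\pi$ with $\pi\pi^\sharp=\pi^\sharp\pi=0$, let $\tilde\pi(x,t)$ be the projection onto $F(x,t,a_1)^{-1}\mathrm{Im}\,\pi$ along $F(x,t,a_2)^{-1}\mathrm{Ker}\,\pi$ (it exists where these subspaces are complementary). The transform of $(q,F)$ by $g_{a_1,a_2,\pi}$ is $$g_{a_1,a_2,\pi}\sharp q=q+(a_1-a_2)[\beta,\tilde\pi-\tilde\pi^\sharp],\qquad \tilde F=g_{a_1,a_2,\pi}\,F\,g_{a_1,a_2,\tilde\pi}^{-1}.$$ *Theorem.* Let $q$ be a solution of $(\ast)$ on an open set $\Omega\subseteq\mathbb R^2$ with frame $F$.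 Let $\alpha_1,\alpha_2,\beta_1,\beta_2$ be four distinct nonzero reals and $\pi_1,\pi_2,\tau_1,\tau_2$ projections of $\mathbb R^N$ with $\pi_i\pi_i^\sharp=\pi_i^\sharp\pi_i=\tau_i\tau_i^\sharp=\tau_i^\sharp\tau_i=0$ and $$g_{\beta_1,\beta_2,\tau_2}\,g_{\alpha_1,\alpha_2,\pi_1}=g_{\alpha_1,\alpha_2,\tau_1}\,g_{\beta_1,\beta_2,\pi_2}.$$ Let $(q_1,F_1)$ and $(q_2,F_2)$ be the transforms of $(q,F)$ by $g_{\alpha_1,\alpha_2,\pi_1}$ and $g_{\beta_1,\beta_2,\pi_2}$, with projections $\tilde\pi_1,\tilde\pi_2$; let $(q_{12},F_{12})$ be the transform of $(q_1,F_1)$ by $g_{\beta_1,\beta_2,\tau_2}$ and $(q_{21},F_{21})$ the transform of $(q_2,F_2)$ by $g_{\alpha_1,\alpha_2,\tau_1}$, where the four projection-valued maps that occur are assumed to exist at every point of $\Omega$. Then: (i) If $\pi_1,\pi_2$ have rank at most $1$, then for each $(x,t)\in\Omega$ the maps $F_1,F_2,F_{12},F_{21}$ extend holomorphically in $\lambda$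 to all of $\mathbb C$. (ii) Whenever $F_1,F_2,F_{12},F_{21}$ extend holomorphically in $\lambda$ to all of $\mathbb C$ for each $(x,t)\in\Omega$ (for ranks at most $1$ this always holds, by (i)), $q_1,q_2,q_{12},q_{21}$ are solutions of $(\ast)$ on $\Omega$, and there are projections $\tilde\tau_1(x,t),\tilde\tau_2(x,t)$ with $$\mathrm{Im}\,\tilde\tau_1=g_{\beta_1,\beta_2,\tilde\pi_2}(\alpha_1)\,\mathrm{Im}\,\tilde\pi_1,\quad \mathrm{Ker}\,\tilde\tau_1=g_{\beta_1,\beta_2,\tilde\pi_2}(\alpha_2)\,\mathrm{Ker}\,\tilde\pi_1,$$ $$\mathrm{Im}\,\tilde\tau_2=g_{\alpha_1,\alpha_2,\tilde\pi_1}(\beta_1)\,\mathrm{Im}\,\tilde\pi_2=g_{\alpha_1,\alpha_2,\tilde\tau_1}(\beta_2)\,\mathrm{Im}\,\tilde\pi_2,\quad \mathrm{Ker}\,\tilde\tau_2=g_{\alpha_1,\alpha_2,\tilde\pi_1}(\beta_2)\,\mathrm{Ker}\,\tilde\pi_2=g_{\alpha_1,\alpha_2,\tilde\tau_1}(\beta_1)\,\mathrm{Ker}\,\tilde\pi_2,$$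 and on $\Omega$ $$q_{12}=q_{21}=q_1+(\beta_1-\beta_2)[\beta,\tilde\tau_2-\tilde\tau_2^\sharp]=q_2+(\alpha_1-\alpha_2)[\beta,\tilde\tau_1-\tilde\tau_1^\sharp].$$ -/

import Mathlib

open scoped ContDiff

noncomputable section

namespace BKdV

/-- Square matrices of size `2n+1`. Rows and columns are numbered from `0` to `2n`. -/
abbrev Mat (n : ℕ) (K : Type) : Type := Matrix (Fin (2 * n + 1)) (Fin (2 * n + 1)) K

/-! ### The form `⟨X, Y⟩ = Xᵗ C Y` on `K^{2n+1}` and the algebras `o(n+1,n)`, `𝓑ₙ⁺` -/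

/-- `C = ∑ (-1)^{n+i-1} e_{i, 2n+2-i}`, with `i = 1, …, 2n+1` (here `i.val = i - 1`). -/
def formC (n : ℕ) (K : Type) [Field K] : Mat n K :=
  Matrix.of fun i j => if i.val + j.val = 2 * n then (-1) ^ (n + i.val) else 0

/-- The conjugate `A♯ = C Aᵗ C` with respect to the form. -/
def sharp {n : ℕ} {K : Type} [Field K] (A : Mat n K) : Mat n K :=
  formC n K * A.transpose * formC n K

/-- Membership in `o(n+1,n)`. (The trace of such a matrix is automatically zero.) -/
def IsSkew {n : ℕ} (A : Mat n ℝ) : Prop :=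
  A.transpose * formC n ℝ + formC n ℝ * A = 0

/-- Membership in `𝓑ₙ⁺`, the upper triangular matrices in `o(n+1,n)`. -/
def IsBorel {n : ℕ} (A : Mat n ℝ) : Prop :=
  IsSkew A ∧ ∀ i j, j < i → A i j = 0

/-- `b = ∑_{i=1}^{2n} e_{i+1, i}`. -/
def bMat (n : ℕ) : Mat n ℝ :=
  Matrix.of fun i j => if i.val = j.val + 1 then 1 else 0

/-- `β = (e_{1, 2n} + e_{2, 2n+1}) / 2`. -/
def betaMat (n : ℕ) : Mat n ℝ :=
  Matrix.of fun i j =>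
    if (i.val = 0 ∧ j.val + 1 = 2 * n) ∨ (i.val = 1 ∧ j.val = 2 * n) then 1 / 2 else 0

/-- A real matrix regarded as a complex one. -/
def toC {n : ℕ} (A : Mat n ℝ) : Mat n ℂ := A.map Complex.ofReal

/-! ### Matrix Laurent series in `λ⁻¹`, the series `P(q, λ)`, the flows, and frames

A formal series `∑_{i ≤ m} ξ_i λ^i` is a Laurent series in the variable `λ⁻¹`. -/

/-- The coefficient of `λ^i`. -/
def lamCoeff {n : ℕ} (M : Mat n (LaurentSeries ℝ)) (i : ℤ) : Mat n ℝ :=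
  M.map fun f => f.coeff (-i)

/-- `J_B = b + β λ` as a formal series. -/
def formalJ (n : ℕ) : Mat n (LaurentSeries ℝ) :=
  (bMat n).map (HahnSeries.single 0) + (betaMat n).map (HahnSeries.single (-1))

/-- `J_B(z) + q`, the value at the spectral parameter `z`. -/
def laxX {n : ℕ} (q : Mat n ℝ) (z : ℂ) : Mat n ℂ :=
  toC (bMat n + q) + z • toC (betaMat n)

/-- The value at `z` of the polynomial part `∑_{0 ≤ i ≤ d} M_i z^i` of a series `M` whose degree
in `λ` is at most `d`. -/
def plusPart {n : ℕ} (M : Mat n (LaurentSeries ℝ)) (d : ℕ) (z : ℂ) : Mat n ℂ :=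
  ∑ i ∈ Finset.range (d + 1), z ^ i • toC (lamCoeff M (i : ℤ))

/-- `P = P(q, λ)` on `Ω`: the series `P = β λ + P_0 + P_{-1} λ⁻¹ + ⋯` with smooth coefficients in
`o(n+1,n)` that is conjugate to `J_B` and satisfies `[∂_x + J_B + q, P] = 0`. The leading term
has to be prescribed because `-P` has the other properties, too (`J_B` and `-J_B` are
conjugate). -/
structure IsResolvent {n : ℕ} (Ω : Set (ℝ × ℝ)) (q : ℝ → ℝ → Mat n ℝ)
    (P : ℝ → ℝ → Mat n (LaurentSeries ℝ)) : Prop where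
  smooth : ∀ (i : ℤ) (a b : Fin (2 * n + 1)),
    ContDiffOn ℝ ∞ (fun p : ℝ × ℝ => lamCoeff (P p.1 p.2) i a b) Ω
  skew : ∀ x t, (x, t) ∈ Ω → ∀ i : ℤ, IsSkew (lamCoeff (P x t) i)
  degree_le : ∀ x t, (x, t) ∈ Ω → ∀ i : ℤ, 1 < i → lamCoeff (P x t) i = 0
  leading : ∀ x t, (x, t) ∈ Ω → lamCoeff (P x t) 1 = betaMat n
  conjugate : ∀ x t, (x, t) ∈ Ω → ∃ Φ : (Mat n (LaurentSeries ℝ))ˣ,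
    P x t = (Φ : Mat n (LaurentSeries ℝ)) * formalJ n * ((Φ⁻¹ : (Mat n (LaurentSeries ℝ))ˣ) :
      Mat n (LaurentSeries ℝ))
  commute : ∀ x t, (x, t) ∈ Ω → ∀ (i : ℤ) (a b : Fin (2 * n + 1)),
    deriv (fun y => lamCoeff (P y t) i a b) x
      + (⁅bMat n + q x t, lamCoeff (P x t) i⁆ + ⁅betaMat n, lamCoeff (P x t) (i - 1)⁆) a b = 0

/-- `q : Ω → 𝓑ₙ⁺` is a smooth solution of the `(2j-1)`-th flow
`q_t = [∂_x + b + q, P_{2j-1,0}(q)]`, where `P_{2j-1,i}(q)` is the coefficient of `λ^i` in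
`P(q, λ)^{2j-1}`. -/
structure IsSolution {n : ℕ} (Ω : Set (ℝ × ℝ)) (j : ℕ) (q : ℝ → ℝ → Mat n ℝ) : Prop where
  smooth : ∀ a b, ContDiffOn ℝ ∞ (fun p : ℝ × ℝ => q p.1 p.2 a b) Ω
  borel : ∀ x t, (x, t) ∈ Ω → IsBorel (q x t)
  flow : ∃ P : ℝ → ℝ → Mat n (LaurentSeries ℝ), IsResolvent Ω q P ∧
    ∀ x t, (x, t) ∈ Ω → ∀ a b,
      deriv (fun s => q x s a b) t
        = deriv (fun y => lamCoeff (P y t ^ (2 * j - 1)) 0 a b) x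
          + ⁅bMat n + q x t, lamCoeff (P x t ^ (2 * j - 1)) 0⁆ a b

/-- `F(x, t, λ) ∈ O_ℂ(n+1,n)` is a frame on `Ω` of the solution `q` of the `(2j-1)`-th flow:
it is holomorphic in `λ ∈ ℂ` and
`F⁻¹ F_x = J_B + q`, `F⁻¹ F_t = (P(q, λ)^{2j-1})_+`, `conj F(x, t, conj λ) = F(x, t, λ)`. -/
structure IsFrame {n : ℕ} (Ω : Set (ℝ × ℝ)) (j : ℕ) (q : ℝ → ℝ → Mat n ℝ)
    (F : ℝ → ℝ → ℂ → Mat n ℂ) : Prop where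
  smooth : ∀ a b, ContDiffOn ℝ ∞ (fun p : (ℝ × ℝ) × ℂ => F p.1.1 p.1.2 p.2 a b)
    (Ω ×ˢ Set.univ)
  holomorphic : ∀ x t, (x, t) ∈ Ω → ∀ a b, Differentiable ℂ (fun z => F x t z a b)
  det_eq_one : ∀ x t, (x, t) ∈ Ω → ∀ z, (F x t z).det = 1
  orthogonal : ∀ x t, (x, t) ∈ Ω → ∀ z,
    (F x t z).transpose * formC n ℂ * F x t z = formC n ℂ
  reality : ∀ x t, (x, t) ∈ Ω → ∀ z,
    (F x t ((starRingEnd ℂ) z)).map (starRingEnd ℂ) = F x t z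
  evolution : ∃ P : ℝ → ℝ → Mat n (LaurentSeries ℝ), IsResolvent Ω q P ∧
    ∀ x t, (x, t) ∈ Ω → ∀ z a b,
      deriv (fun y => F y t z a b) x = (F x t z * laxX (q x t) z) a b ∧
      deriv (fun s => F x s z a b) t
        = (F x t z * plusPart (P x t ^ (2 * j - 1)) (2 * j - 1) z) a b

/-! ### Projections, simple elements, and Bäcklund transformations -/

/-- `p` is a projection with `p p♯ = p♯ p = 0`. -/
def IsIsotropicProj {n : ℕ} (p : Mat n ℝ) : Prop :=
  p * p = p ∧ p * sharp p = 0 ∧ sharp p * p = 0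

/-- The image of a matrix. -/
def im {n : ℕ} (p : Mat n ℝ) : Submodule ℝ (Fin (2 * n + 1) → ℝ) := LinearMap.range p.mulVecLin

/-- The kernel of a matrix. -/
def ker {n : ℕ} (p : Mat n ℝ) : Submodule ℝ (Fin (2 * n + 1) → ℝ) := LinearMap.ker p.mulVecLin

/-- `p` is the projection of `ℝ^{2n+1}` onto `V` along `W`. -/
def IsProjOnto {n : ℕ} (p : Mat n ℝ) (V W : Submodule ℝ (Fin (2 * n + 1) → ℝ)) : Prop :=
  p * p = p ∧ im p = V ∧ ker p = W

/-- `h_{a₁,a₂,p}(z) = I + (a₁ - a₂)/(z - a₁) (I - p)`. -/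
def hElt {n : ℕ} {K : Type} [Field K] (a₁ a₂ : K) (p : Mat n K) (z : K) : Mat n K :=
  1 + ((a₁ - a₂) / (z - a₁)) • (1 - p)

/-- `g_{a₁,a₂,p} = h_{a₂,a₁,p♯} h_{a₁,a₂,p}`. It is used for `K = ℂ` as a function of the spectral
parameter and for `K = ℝ` where it acts on subspaces of `ℝ^{2n+1}`. -/
def gElt {n : ℕ} {K : Type} [Field K] (a₁ a₂ : K) (p : Mat n K) (z : K) : Mat n K :=
  hElt a₂ a₁ (sharp p) z * hElt a₁ a₂ p z

/-- `g_{a₁,a₂,p}` for real data as a function of the complex parameter `z`. -/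
def gC {n : ℕ} (a₁ a₂ : ℝ) (p : Mat n ℝ) (z : ℂ) : Mat n ℂ :=
  gElt (a₁ : ℂ) (a₂ : ℂ) (toC p) z

/-- The real matrix `F(x, t, a)` for real `a`; see `IsFrame.reality`. -/
def realAt {n : ℕ} (F : ℝ → ℝ → ℂ → Mat n ℂ) (x t a : ℝ) : Mat n ℝ :=
  (F x t (a : ℂ)).map Complex.re

/-- For every `(x, t) ∈ Ω`, `ptilde x t` is the projection onto `F(x, t, a₁)⁻¹ (Im p)` along
`F(x, t, a₂)⁻¹ (Ker p)`. -/
def IsTildeProj {n : ℕ} (Ω : Set (ℝ × ℝ)) (a₁ a₂ : ℝ) (p : Mat n ℝ)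
    (F : ℝ → ℝ → ℂ → Mat n ℂ) (ptilde : ℝ → ℝ → Mat n ℝ) : Prop :=
  ∀ x t, (x, t) ∈ Ω → IsProjOnto (ptilde x t)
    (Submodule.comap (realAt F x t a₁).mulVecLin (im p))
    (Submodule.comap (realAt F x t a₂).mulVecLin (ker p))

/-- The transformed frame `g_{a₁,a₂,p}(λ) F(x,t,λ) g_{a₁,a₂,ptilde(x,t)}(λ)⁻¹`. Its values at the
poles of the two factors carry no information. -/
def dress {n : ℕ} (a₁ a₂ : ℝ) (p : Mat n ℝ) (ptilde : ℝ → ℝ → Mat n ℝ)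
    (F : ℝ → ℝ → ℂ → Mat n ℂ) : ℝ → ℝ → ℂ → Mat n ℂ :=
  fun x t z => gC a₁ a₂ p z * F x t z * (gC a₁ a₂ (ptilde x t) z)⁻¹

/-- The transform `g_{a₁,a₂,p} ♯ q = q + (a₁ - a₂) [β, ptilde - ptilde♯]`. -/
def backlund {n : ℕ} (a₁ a₂ : ℝ) (ptilde : ℝ → ℝ → Mat n ℝ) (q : ℝ → ℝ → Mat n ℝ) :
    ℝ → ℝ → Mat n ℝ :=
  fun x t => q x t + (a₁ - a₂) • ⁅betaMat n, ptilde x t - sharp (ptilde x t)⁆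

/-- For every `(x, t) ∈ Ω`, `G(x, t, ·)` is, off the finite set `S`, the restriction of a
holomorphic map on `ℂ`; that is, its singularities in `S` are removable. -/
def IsEntireOff {n : ℕ} (Ω : Set (ℝ × ℝ)) (S : Set ℂ) (G : ℝ → ℝ → ℂ → Mat n ℂ) : Prop :=
  ∀ x t, (x, t) ∈ Ω → ∃ H : ℂ → Mat n ℂ,
    (∀ a b, Differentiable ℂ (fun z => H z a b)) ∧ ∀ z, z ∉ S → H z = G x t z

end BKdV

end

/-! The map `sharp` is the adjoint for the form, so orthogonality of `F` reads `sharp F * F = 1`.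
For an isotropic projection `p` the matrices `p`, `1 - p - sharp p`, `sharp p` are complementary
idempotents, and with `r = (λ - a₂)/(λ - a₁)` the simple element acts on their images by `r⁻¹`, `1`,
`r` (`gElt_eq`). Hence it is orthogonal, its inverse is the simple element of `sharp p`, and it
tends to `1` as `λ → ∞`.

Rank one. The dressed map `g_π F g_p⁻¹` has at most double poles, at `a₁` and `a₂`. At `a₁` the
choice of the image and the kernel of `p` removes everything except a simple pole whose residue is a
multiple of `sharp π * F_λ * p`. Up to the factor `sharp π * F`, this is the skew form of `F⁻¹ F_λ`
restricted to the image of `p`, which vanishes on a line (`EntireM.exists_cancel`). The pole at `a₂`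
is treated by passing to adjoints (`TildeRel.sharp`).

Solutions. Let a dressed frame `E` be entire in `λ`. Its logarithmic derivative is a gauge transform
`g Q g⁻¹ - g' g⁻¹` with `Q` polynomial, hence rational with poles at most at `a₁`, `a₂`. It is
bounded there: `E⁻¹ = sharp E` is entire, and the maximum principle, applied to increments of `E` in
the parameter, bounds the parameter derivative (`exists_bound_deriv_of_entire`). So it is a
polynomial (`exists_poly_gauge`), determined by its expansion at infinity. As `g = 1 + O(λ⁻¹)`, this
polynomial is `J` plus the transformed potential in the direction of `x`, and the polynomial part of
`(g P g⁻¹)^(2j-1)` in the direction of `t`. Equality of mixed derivatives at `λ = 0` is then the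
flow equation. The dressed frame is a frame with two more removable singularities, so the step can
be repeated (`IsFrameOff.backlund`).

Permutability. In `F₁₂⁻¹ F₂₁` the frame `F` and the constant simple elements cancel by the assumed
relation. What remains is a product of four simple elements of the transformed projections; it is
entire and tends to `1` at infinity, so it equals `1` by Liouville's theorem (`Permutes.of_dress`).
Thus the transformed projections satisfy the same relation. Its coefficient of `λ⁻¹` gives `q₁₂ =
q₂₁`, and its leading polar parts at the parameters give the images and kernels. -/

open scoped ContDiff

noncomputable section

namespace BKdV

/-! ### The involution `sharp` -/

section Sharp

variable {n : ℕ} {K L : Type} [Field K] [Field L]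

theorem formC_apply (i j : Fin (2 * n + 1)) :
    formC n K i j = if j = Fin.rev i then (-1) ^ (n + i.val) else 0 := by
  have : i.val + j.val = 2 * n ↔ j = Fin.rev i := by
    rw [Fin.ext_iff, Fin.val_rev]; omega
  simp [formC, this]

theorem formC_mul_self : formC n K * formC n K = 1 := by
  ext i j
  rw [Matrix.mul_apply]
  simp only [formC_apply, ite_mul, zero_mul, Finset.sum_ite_eq', Finset.mem_univ, if_true,
    Fin.rev_rev, Matrix.one_apply, eq_comm (a := i)]
  split_ifs with h
  · rw [← pow_add, Fin.val_rev]
    exact Even.neg_one_pow ⟨2 * n, by omega⟩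
  · simp

theorem formC_transpose : (formC n K).transpose = formC n K := by
  ext i j
  simp only [Matrix.transpose_apply, formC, Matrix.of_apply, add_comm j.val]
  split_ifs with h
  · have : n + j.val + (n + i.val) = 2 * (2 * n) := by omega
    have h1 : ((-1 : K)) ^ (n + j.val) * (-1) ^ (n + i.val) = 1 := by
      rw [← pow_add, this]; simp
    have h2 : ((-1 : K)) ^ (n + i.val) * (-1) ^ (n + i.val) = 1 := by
      rw [← pow_add, ← two_mul]; simp
    calc _ = ((-1 : K)) ^ (n + j.val) * ((-1) ^ (n + i.val) * (-1) ^ (n + i.val)) := by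
          rw [h2, mul_one]
      _ = _ := by rw [← mul_assoc, h1, one_mul]
  · rfl

theorem formC_mul_cancel (A : Mat n K) : formC n K * (formC n K * A) = A := by
  rw [← mul_assoc, formC_mul_self, one_mul]

theorem sharp_mul (A B : Mat n K) : sharp (A * B) = sharp B * sharp A := by
  simp only [sharp, Matrix.transpose_mul, mul_assoc, formC_mul_cancel]

theorem sharp_sharp (A : Mat n K) : sharp (sharp A) = A := by
  simp only [sharp, Matrix.transpose_mul, formC_transpose, Matrix.transpose_transpose, mul_assoc,
    formC_mul_cancel, formC_mul_self, mul_one]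

theorem sharp_add (A B : Mat n K) : sharp (A + B) = sharp A + sharp B := by
  simp only [sharp, Matrix.transpose_add, mul_add, add_mul]

theorem sharp_sub (A B : Mat n K) : sharp (A - B) = sharp A - sharp B := by
  simp only [sharp, Matrix.transpose_sub, mul_sub, sub_mul]

theorem sharp_smul (c : K) (A : Mat n K) : sharp (c • A) = c • sharp A := by
  simp only [sharp, Matrix.transpose_smul, Matrix.mul_smul, Matrix.smul_mul]

theorem sharp_one : sharp (1 : Mat n K) = 1 := by
  simp only [sharp, Matrix.transpose_one, mul_one, formC_mul_self]

theorem formC_map (f : K →+* L) : (formC n K).map f = formC n L := by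
  ext i j
  simp only [formC, Matrix.map_apply, Matrix.of_apply]
  split_ifs <;> simp

theorem sharp_map (f : K →+* L) (A : Mat n K) : sharp (A.map f) = (sharp A).map f := by
  simp only [sharp, Matrix.map_mul, formC_map, Matrix.transpose_map]

/-- Reflection in the antidiagonal with checkerboard signs. In this form `sharp` only permutes and
rescales entries, so derivatives, holomorphy and smoothness pass through it entry by entry. -/
theorem sharp_apply (A : Mat n K) (i j : Fin (2 * n + 1)) :
    sharp A i j = (-1) ^ (i.val + j.val) * A (Fin.rev j) (Fin.rev i) := by
  simp only [sharp, Matrix.mul_apply, formC_apply, Matrix.transpose_apply, ite_mul, zero_mul,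
    mul_ite, mul_zero]
  rw [Finset.sum_eq_single (Fin.rev j)]
  · rw [Finset.sum_eq_single (Fin.rev i)]
    · simp only [Fin.rev_rev, if_true]
      rw [mul_right_comm, ← pow_add, Fin.val_rev]
      congr 1
      -- Adding the even number `2 * j` to the exponent absorbs the truncated subtraction in
      -- `Fin.rev j` without changing the sign.
      have : n + i.val + (n + (2 * n + 1 - (j.val + 1))) + 2 * j.val
          = i.val + j.val + 2 * (2 * n) := by omega
      have h2 : ∀ a b : ℕ, ((-1 : K)) ^ (a + 2 * b) = (-1) ^ a := fun a b => by
        rw [pow_add, pow_mul]; simp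
      rw [← h2 _ j.val, this, h2]
    · intro b _ hb
      simp [hb]
    · simp
  · intro b _ hb
    have : j ≠ Fin.rev b := fun h => hb (by rw [h, Fin.rev_rev])
    simp [this]
  · simp

theorem formC_mul_sharp (A : Mat n K) : formC n K * sharp A = A.transpose * formC n K := by
  simp only [sharp, mul_assoc, formC_mul_cancel]

theorem sharp_mul_self_eq_one_iff (A : Mat n K) :
    sharp A * A = 1 ↔ A.transpose * formC n K * A = formC n K := by
  rw [← formC_mul_sharp, mul_assoc]
  constructor
  · intro h; rw [h, mul_one]
  · intro h
    have := congrArg (formC n K * ·) h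
    simpa only [formC_mul_cancel, formC_mul_self] using this

theorem isSkew_iff (A : Mat n ℝ) : IsSkew A ↔ sharp A = -A := by
  rw [IsSkew, ← formC_mul_sharp, ← mul_add]
  constructor
  · intro h
    have := congrArg (formC n ℝ * ·) h
    simp only [formC_mul_cancel, mul_zero] at this
    exact eq_neg_of_add_eq_zero_left this
  · intro h
    rw [h, neg_add_cancel, mul_zero]

end Sharp

/-! ### Simple elements -/

section Simple

variable {n : ℕ} {K L : Type} [Field K] [Field L]

/-- `p` is a projection with `p p♯ = p♯ p = 0`, over an arbitrary field. -/
structure IsoProj (p : Mat n K) : Prop where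
  idem : p * p = p
  mul_sharp : p * sharp p = 0
  sharp_mul : sharp p * p = 0

theorem IsIsotropicProj.isoProj {p : Mat n ℝ} (h : IsIsotropicProj p) : IsoProj p :=
  ⟨h.1, h.2.1, h.2.2⟩

theorem IsoProj.map {p : Mat n K} (h : IsoProj p) (f : K →+* L) : IsoProj (p.map f) where
  idem := by rw [← Matrix.map_mul, h.idem]
  mul_sharp := by rw [sharp_map, ← Matrix.map_mul, h.mul_sharp]; simp
  sharp_mul := by rw [sharp_map, ← Matrix.map_mul, h.sharp_mul]; simp

theorem IsoProj.sharp_idem {p : Mat n K} (h : IsoProj p) : sharp p * sharp p = sharp p := by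
  rw [← BKdV.sharp_mul, h.idem]

theorem IsoProj.sharp {p : Mat n K} (h : IsoProj p) : IsoProj (sharp p) where
  idem := h.sharp_idem
  mul_sharp := by rw [sharp_sharp, h.sharp_mul]
  sharp_mul := by rw [sharp_sharp, h.mul_sharp]

/-- The function `(z - a₂) / (z - a₁)`. -/
def rat (a₁ a₂ z : K) : K := (z - a₂) / (z - a₁)

theorem rat_ne_zero {a₁ a₂ z : K} (h₁ : z ≠ a₁) (h₂ : z ≠ a₂) : rat a₁ a₂ z ≠ 0 :=
  div_ne_zero (sub_ne_zero.2 h₂) (sub_ne_zero.2 h₁)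

/-- The two factors are `sharp p + r⁻¹ (1 - sharp p)` and `p + r (1 - p)`, and `sharp p * p = 0`
diagonalizes the product. Exchanging `p` and `sharp p` exchanges `r` and `r⁻¹`, which gives both the
inverse and the adjoint. -/
theorem gElt_eq {a₁ a₂ z : K} {p : Mat n K} (hp : IsoProj p) (h₁ : z ≠ a₁) (h₂ : z ≠ a₂) :
    gElt a₁ a₂ p z = (rat a₁ a₂ z)⁻¹ • p + (1 - p - sharp p) + rat a₁ a₂ z • sharp p := by
  have h₁' := sub_ne_zero.2 h₁
  have h₂' := sub_ne_zero.2 h₂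
  have e₁ : hElt a₁ a₂ p z = p + rat a₁ a₂ z • (1 - p) := by
    have : (a₁ - a₂) / (z - a₁) = rat a₁ a₂ z - 1 := by rw [rat]; field_simp; ring
    rw [hElt, this]; module
  have e₂ : hElt a₂ a₁ (sharp p) z = sharp p + (rat a₁ a₂ z)⁻¹ • (1 - sharp p) := by
    have : (a₂ - a₁) / (z - a₂) = (rat a₁ a₂ z)⁻¹ - 1 := by rw [rat]; field_simp; ring
    rw [hElt, this]; module
  have hr := rat_ne_zero h₁ h₂
  rw [gElt, e₁, e₂]
  simp only [mul_add, add_mul, mul_sub, sub_mul, Matrix.smul_mul, Matrix.mul_smul, mul_one, one_mul,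
    hp.sharp_mul, smul_sub, smul_zero, sub_zero, smul_smul, mul_inv_cancel₀ hr, one_smul]
  module

theorem gElt_sharp {a₁ a₂ z : K} {p : Mat n K} (hp : IsoProj p) (h₁ : z ≠ a₁) (h₂ : z ≠ a₂) :
    gElt a₁ a₂ (sharp p) z
      = (rat a₁ a₂ z)⁻¹ • sharp p + (1 - p - sharp p) + rat a₁ a₂ z • p := by
  rw [gElt_eq hp.sharp h₁ h₂, sharp_sharp]; module

theorem sharp_gElt {a₁ a₂ z : K} {p : Mat n K} (hp : IsoProj p) (h₁ : z ≠ a₁) (h₂ : z ≠ a₂) :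
    sharp (gElt a₁ a₂ p z) = gElt a₁ a₂ (sharp p) z := by
  rw [gElt_eq hp h₁ h₂, gElt_sharp hp h₁ h₂]
  simp only [sharp_add, sharp_smul, sharp_sub, sharp_one, sharp_sharp]
  module

theorem gElt_mul_sharp {a₁ a₂ z : K} {p : Mat n K} (hp : IsoProj p) (h₁ : z ≠ a₁) (h₂ : z ≠ a₂) :
    gElt a₁ a₂ p z * gElt a₁ a₂ (sharp p) z = 1 := by
  have hr := rat_ne_zero h₁ h₂
  rw [gElt_eq hp h₁ h₂, gElt_sharp hp h₁ h₂]
  simp only [mul_add, add_mul, mul_sub, sub_mul, Matrix.smul_mul, Matrix.mul_smul, mul_one, one_mul,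
    hp.sharp_mul, hp.mul_sharp, hp.idem, hp.sharp_idem, smul_zero, sub_zero, smul_smul,
    inv_mul_cancel₀ hr, mul_inv_cancel₀ hr, one_smul]
  module

theorem gElt_sharp_mul {a₁ a₂ z : K} {p : Mat n K} (hp : IsoProj p) (h₁ : z ≠ a₁) (h₂ : z ≠ a₂) :
    gElt a₁ a₂ (sharp p) z * gElt a₁ a₂ p z = 1 := by
  have := gElt_mul_sharp hp.sharp h₁ h₂
  rwa [sharp_sharp] at this

theorem gElt_map (f : K →+* L) (a₁ a₂ z : K) (p : Mat n K) :
    (gElt a₁ a₂ p z).map f = gElt (f a₁) (f a₂) (p.map f) (f z) := by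
  have h : ∀ (c : K) (A : Mat n K), (c • A).map f = f c • A.map f := fun c A => by
    ext; simp
  have h' : ∀ (A : Mat n K), (1 - A).map f = 1 - A.map f := fun A => by
    rw [Matrix.map_sub f (map_sub f), Matrix.map_one f (map_zero f) (map_one f)]
  have h'' : ∀ (A : Mat n K), (1 + A).map f = 1 + A.map f := fun A => by
    rw [Matrix.map_add f (map_add f), Matrix.map_one f (map_zero f) (map_one f)]
  simp only [gElt, hElt, Matrix.map_mul, h, h', h'', map_div₀, map_sub, sharp_map]

/-- The numerator `(z - a₁)(z - a₂) g_{a₁,a₂,p}(z)`, with `u = z - a₁`, `v = z - a₂`. -/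
def gNum {R : Type} [CommRing R] (u v : R) (p p' : Mat n R) : Mat n R :=
  (u * u) • p + (u * v) • (1 - p - p') + (v * v) • p'

theorem smul_gElt {a₁ a₂ z : K} {p : Mat n K} (hp : IsoProj p) (h₁ : z ≠ a₁) (h₂ : z ≠ a₂) :
    ((z - a₁) * (z - a₂)) • gElt a₁ a₂ p z = gNum (z - a₁) (z - a₂) p (sharp p) := by
  have h₁' := sub_ne_zero.2 h₁
  have h₂' := sub_ne_zero.2 h₂
  rw [gElt_eq hp h₁ h₂, gNum, smul_add, smul_add, smul_smul, smul_smul]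
  have e₁ : (z - a₁) * (z - a₂) * (rat a₁ a₂ z)⁻¹ = (z - a₁) * (z - a₁) := by
    rw [rat]; field_simp
  have e₂ : (z - a₁) * (z - a₂) * rat a₁ a₂ z = (z - a₂) * (z - a₂) := by
    rw [rat]; field_simp
  rw [e₁, e₂]

end Simple

/-! ### Transformed projections -/

section Tilde

variable {n : ℕ} {K : Type} [Field K]

/-- `p` is the projection onto `H₁⁻¹ Im π` along `H₂⁻¹ Ker π` for orthogonal `H₁` and `H₂`. -/
structure TildeRel (H₁ H₂ π p : Mat n K) : Prop where
  orth₁ : sharp H₁ * H₁ = 1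
  orth₂ : sharp H₂ * H₂ = 1
  iso : IsoProj π
  idem : p * p = p
  img : π * H₁ * p = H₁ * p
  img' : p * sharp H₁ * π = sharp H₁ * π
  kern : π * H₂ * p = π * H₂
  kern' : p * sharp H₂ * π = p * sharp H₂

variable {H₁ H₂ π p : Mat n K}

/-- Adjoints turn image conditions into kernel conditions and exchange the two evaluation points.
Each statement about the pole `a₁` therefore yields the one about `a₂`. -/
theorem TildeRel.sharp (h : TildeRel H₁ H₂ π p) : TildeRel H₂ H₁ (sharp π) (sharp p) where
  orth₁ := h.orth₂
  orth₂ := h.orth₁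
  iso := h.iso.sharp
  idem := by rw [← sharp_mul, h.idem]
  img := by
    have := congrArg BKdV.sharp h.kern'
    simpa only [sharp_mul, sharp_sharp, mul_assoc] using this
  img' := by
    have := congrArg BKdV.sharp h.kern
    simpa only [sharp_mul, sharp_sharp, mul_assoc] using this
  kern := by
    have := congrArg BKdV.sharp h.img'
    simpa only [sharp_mul, sharp_sharp, mul_assoc] using this
  kern' := by
    have := congrArg BKdV.sharp h.img
    simpa only [sharp_mul, sharp_sharp, mul_assoc] using this

/-- `H₁ p` has its image in that of `π`, which is isotropic because `sharp π * π = 0`, and `H₁`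
preserves the form. The other product is the dual argument: `p * sharp H₂` factors through `π` on
the right, and `π * sharp π = 0`. -/
theorem TildeRel.isoProj (h : TildeRel H₁ H₂ π p) : IsoProj p where
  idem := h.idem
  sharp_mul := by
    calc BKdV.sharp p * p = BKdV.sharp p * (BKdV.sharp H₁ * H₁) * p := by rw [h.orth₁, mul_one]
      _ = BKdV.sharp (H₁ * p) * (H₁ * p) := by rw [sharp_mul]; simp only [mul_assoc]
      _ = BKdV.sharp (H₁ * p) * (BKdV.sharp π * π) * (H₁ * p) := by
          conv_lhs => rw [← h.img, mul_assoc π, sharp_mul]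
          simp only [mul_assoc]
      _ = 0 := by rw [h.iso.sharp_mul]; simp
  mul_sharp := by
    have o₂ : H₂ * BKdV.sharp H₂ = 1 := mul_eq_one_comm.1 h.orth₂
    calc p * BKdV.sharp p = p * (BKdV.sharp H₂ * H₂) * BKdV.sharp p := by rw [h.orth₂, mul_one]
      _ = (p * BKdV.sharp H₂) * BKdV.sharp (p * BKdV.sharp H₂) := by
          rw [sharp_mul, sharp_sharp]; simp only [mul_assoc]
      _ = (p * BKdV.sharp H₂) * (π * BKdV.sharp π) * BKdV.sharp (p * BKdV.sharp H₂) := by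
          conv_lhs => rw [← h.kern', sharp_mul _ π]
          simp only [mul_assoc]
      _ = 0 := by rw [h.iso.mul_sharp]; simp

/-- The matrix `π H₂ + (1 - π) H₁` carries the splitting given by `p` to the one given by `π`.
Inverting it expresses `p` through `H₁` and `H₂` by an explicit formula, so `p` inherits smoothness
from the frame. -/
theorem TildeRel.isUnit (h : TildeRel H₁ H₂ π p) :
    (π * H₂ + (1 - π) * H₁) * (p * BKdV.sharp H₂ * π + (1 - p) * BKdV.sharp H₁ * (1 - π)) = 1 := by
  have o₁ : H₁ * BKdV.sharp H₁ = 1 := mul_eq_one_comm.1 h.orth₁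
  have o₂ : H₂ * BKdV.sharp H₂ = 1 := mul_eq_one_comm.1 h.orth₂
  have e₁ : π * H₂ * (1 - p) = 0 := by rw [mul_sub, mul_one, h.kern, sub_self]
  have e₂ : (1 - π) * H₁ * p = 0 := by rw [sub_mul, sub_mul, one_mul, h.img, sub_self]
  have e₃ : (1 - π) * H₁ * (1 - p) = (1 - π) * H₁ := by rw [mul_sub, mul_one, e₂, sub_zero]
  calc _ = π * H₂ * p * BKdV.sharp H₂ * π + (π * H₂ * (1 - p)) * BKdV.sharp H₁ * (1 - π)
        + ((1 - π) * H₁ * p) * BKdV.sharp H₂ * π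
        + ((1 - π) * H₁ * (1 - p)) * BKdV.sharp H₁ * (1 - π) := by
        simp only [add_mul, mul_add, mul_assoc]; abel
    _ = π * (H₂ * BKdV.sharp H₂) * π + (1 - π) * (H₁ * BKdV.sharp H₁) * (1 - π) := by
        rw [h.kern, e₁, e₂, e₃]; simp only [zero_mul, add_zero, mul_assoc]
    _ = 1 := by
        rw [o₁, o₂, mul_one, mul_one, h.iso.idem, mul_sub, sub_mul, sub_mul, h.iso.idem]
        simp

theorem TildeRel.mul_eq (h : TildeRel H₁ H₂ π p) : (π * H₂ + (1 - π) * H₁) * p = π * H₂ := by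
  rw [add_mul, h.kern, sub_mul, sub_mul, one_mul, h.img, sub_self, add_zero]

theorem TildeRel.det_ne_zero (h : TildeRel H₁ H₂ π p) : (π * H₂ + (1 - π) * H₁).det ≠ 0 := by
  have := congrArg Matrix.det h.isUnit
  rw [Matrix.det_mul, Matrix.det_one] at this
  exact left_ne_zero_of_mul_eq_one this

theorem TildeRel.eq_inv_mul (h : TildeRel H₁ H₂ π p) :
    p = (π * H₂ + (1 - π) * H₁)⁻¹ * (π * H₂) := by
  have hu : IsUnit (π * H₂ + (1 - π) * H₁).det := h.det_ne_zero.isUnit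
  have := congrArg ((π * H₂ + (1 - π) * H₁)⁻¹ * ·) h.mul_eq
  simpa only [Matrix.nonsing_inv_mul_cancel_left _ _ hu] using this

/-- A projection onto a subspace along another satisfies the relations of `TildeRel`. -/
theorem TildeRel.of_isProjOnto {H₁ H₂ π p : Mat n ℝ} (o₁ : BKdV.sharp H₁ * H₁ = 1)
    (o₂ : BKdV.sharp H₂ * H₂ = 1) (hπ : IsoProj π)
    (h : IsProjOnto p (Submodule.comap H₁.mulVecLin (im π))
      (Submodule.comap H₂.mulVecLin (ker π))) : TildeRel H₁ H₂ π p := by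
  have o₁' : H₁ * BKdV.sharp H₁ = 1 := mul_eq_one_comm.1 o₁
  have o₂' : H₂ * BKdV.sharp H₂ = 1 := mul_eq_one_comm.1 o₂
  obtain ⟨hp, hi, hk⟩ := h
  have fix : ∀ v, H₁.mulVec v ∈ im π → p.mulVec v = v := by
    intro v hv
    have : v ∈ im p := by rw [hi]; exact hv
    obtain ⟨w, rfl⟩ := this
    simp [Matrix.mulVec_mulVec, hp]
  have van : ∀ v, π.mulVec (H₂.mulVec v) = 0 ↔ p.mulVec v = 0 := by
    intro v
    have : v ∈ ker p ↔ v ∈ Submodule.comap H₂.mulVecLin (ker π) := by rw [hk]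
    simpa [ker] using this.symm
  have inI : ∀ v, ∃ w, π.mulVec w = H₁.mulVec (p.mulVec v) := by
    intro v
    have : p.mulVec v ∈ im p := ⟨v, rfl⟩
    rw [hi] at this
    exact this
  refine ⟨o₁, o₂, hπ, hp, ?_, ?_, ?_, ?_⟩
  · refine Matrix.mulVec_injective (funext fun v => ?_)
    simp only [← Matrix.mulVec_mulVec]
    obtain ⟨w, hw⟩ := inI v
    rw [← hw, Matrix.mulVec_mulVec, hπ.idem]
  · refine Matrix.mulVec_injective (funext fun v => ?_)
    simp only [← Matrix.mulVec_mulVec]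
    apply fix
    rw [Matrix.mulVec_mulVec, o₁', Matrix.one_mulVec]
    exact ⟨v, rfl⟩
  · refine Matrix.mulVec_injective (funext fun v => ?_)
    simp only [← Matrix.mulVec_mulVec]
    have := (van (v - p.mulVec v)).2 (by
      rw [Matrix.mulVec_sub, Matrix.mulVec_mulVec, hp, sub_self])
    rw [Matrix.mulVec_sub, Matrix.mulVec_sub, sub_eq_zero] at this
    exact this.symm
  · refine Matrix.mulVec_injective (funext fun v => ?_)
    simp only [← Matrix.mulVec_mulVec]
    have := (van ((BKdV.sharp H₂).mulVec (π.mulVec v - v))).1 (by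
      rw [Matrix.mulVec_mulVec _ H₂, o₂', Matrix.one_mulVec, Matrix.mulVec_sub, Matrix.mulVec_mulVec,
        hπ.idem, sub_self])
    rw [Matrix.mulVec_sub, Matrix.mulVec_sub, sub_eq_zero] at this
    exact this

theorem TildeRel.map {L : Type} [Field L] (h : TildeRel H₁ H₂ π p) (f : K →+* L) :
    TildeRel (H₁.map f) (H₂.map f) (π.map f) (p.map f) where
  orth₁ := by
    rw [sharp_map, ← Matrix.map_mul, h.orth₁, Matrix.map_one f (map_zero f) (map_one f)]
  orth₂ := by
    rw [sharp_map, ← Matrix.map_mul, h.orth₂, Matrix.map_one f (map_zero f) (map_one f)]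
  iso := h.iso.map f
  idem := by rw [← Matrix.map_mul, h.idem]
  img := by simp only [← Matrix.map_mul, h.img]
  img' := by simp only [sharp_map, ← Matrix.map_mul, h.img']
  kern := by simp only [← Matrix.map_mul, h.kern]
  kern' := by simp only [sharp_map, ← Matrix.map_mul, h.kern']

end Tilde

/-! ### Matrix Laurent series -/

section Laurent

open Polynomial

variable {n : ℕ}

theorem lamCoeff_apply (M : Mat n (LaurentSeries ℝ)) (i : ℤ) (a b : Fin (2 * n + 1)) :
    lamCoeff M i a b = (M a b).coeff (-i) := rfl

theorem lamCoeff_ext {M N : Mat n (LaurentSeries ℝ)} (h : ∀ i, lamCoeff M i = lamCoeff N i) :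
    M = N := by
  ext a b i
  have := congrFun (congrFun (h (-i)) a) b
  simpa [lamCoeff_apply] using this

theorem lamCoeff_add (M N : Mat n (LaurentSeries ℝ)) (i : ℤ) :
    lamCoeff (M + N) i = lamCoeff M i + lamCoeff N i := by
  ext; simp [lamCoeff_apply]

theorem lamCoeff_sub (M N : Mat n (LaurentSeries ℝ)) (i : ℤ) :
    lamCoeff (M - N) i = lamCoeff M i - lamCoeff N i := by
  ext; simp [lamCoeff_apply]

theorem lamCoeff_neg (M : Mat n (LaurentSeries ℝ)) (i : ℤ) :
    lamCoeff (-M) i = -lamCoeff M i := by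
  ext; simp [lamCoeff_apply]

theorem lamCoeff_zero (i : ℤ) : lamCoeff (0 : Mat n (LaurentSeries ℝ)) i = 0 := by
  ext; simp [lamCoeff_apply]

/-- The powers of `λ` in `M` are at most `d`. -/
def DegLE (d : ℤ) (M : Mat n (LaurentSeries ℝ)) : Prop := ∀ i, d < i → lamCoeff M i = 0

theorem DegLE.mono {d e : ℤ} {M : Mat n (LaurentSeries ℝ)} (h : DegLE d M) (hde : d ≤ e) :
    DegLE e M := fun i hi => h i (hde.trans_lt hi)

/-- The degree bounds replace the antidiagonal, which depends on the supports, by a fixed finite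
interval. Families of series with a common bound can then be multiplied and differentiated one
coefficient at a time. -/
theorem coeff_mul_of_bound {f g : LaurentSeries ℝ} {d e : ℤ} (hf : ∀ i, d < i → f.coeff (-i) = 0)
    (hg : ∀ i, e < i → g.coeff (-i) = 0) (k : ℤ) :
    (f * g).coeff (-k) = ∑ m ∈ Finset.Icc (k - e) d, f.coeff (-m) * g.coeff (-(k - m)) := by
  rw [HahnSeries.coeff_mul]
  refine Finset.sum_of_injOn (fun ij => -ij.1) ?_ ?_ ?_ ?_
  · rintro ⟨i, j⟩ hij ⟨i', j'⟩ hij' h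
    simp only [Finset.mem_coe, Finset.mem_antidiagonal] at hij hij' h
    ext <;> simp only <;> omega
  · rintro ⟨i, j⟩ hij
    simp only [Finset.mem_coe, Finset.mem_antidiagonal, HahnSeries.mem_support] at hij
    simp only [Finset.coe_Icc, Set.mem_Icc]
    constructor
    · by_contra hlt
      have := hg (-j) (by omega)
      rw [neg_neg] at this
      exact hij.2.1 this
    · by_contra hlt
      have := hf (-i) (by omega)
      rw [neg_neg] at this
      exact hij.1 this
  · intro m _ hm
    by_contra hne
    refine hm ⟨(-m, -(k - m)), ?_, by simp⟩
    simp only [Finset.mem_coe, Finset.mem_antidiagonal, HahnSeries.mem_support]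
    exact ⟨left_ne_zero_of_mul hne, right_ne_zero_of_mul hne, by ring⟩
  · rintro ⟨i, j⟩ hij
    simp only [Finset.mem_antidiagonal] at hij
    have : -(k - -i) = j := by omega
    simp only [neg_neg, this]

theorem lamCoeff_mul {d e : ℤ} {M N : Mat n (LaurentSeries ℝ)} (hM : DegLE d M) (hN : DegLE e N)
    (k : ℤ) :
    lamCoeff (M * N) k = ∑ m ∈ Finset.Icc (k - e) d, lamCoeff M m * lamCoeff N (k - m) := by
  ext a b
  simp only [lamCoeff_apply, Matrix.mul_apply, Matrix.sum_apply, HahnSeries.coeff_sum]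
  rw [Finset.sum_comm]
  refine Finset.sum_congr rfl fun c _ => ?_
  exact coeff_mul_of_bound (fun i hi => congrFun (congrFun (hM i hi) a) c)
    (fun i hi => congrFun (congrFun (hN i hi) c) b) k

theorem DegLE.mul {d e : ℤ} {M N : Mat n (LaurentSeries ℝ)} (hM : DegLE d M) (hN : DegLE e N) :
    DegLE (d + e) (M * N) := by
  intro k hk
  rw [lamCoeff_mul hM hN, Finset.Icc_eq_empty (by omega), Finset.sum_empty]

theorem DegLE.add {d : ℤ} {M N : Mat n (LaurentSeries ℝ)} (hM : DegLE d M) (hN : DegLE d N) :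
    DegLE d (M + N) := fun i hi => by rw [lamCoeff_add, hM i hi, hN i hi, add_zero]

theorem lamCoeff_mul_top {d e : ℤ} {M N : Mat n (LaurentSeries ℝ)} (hM : DegLE d M)
    (hN : DegLE e N) : lamCoeff (M * N) (d + e) = lamCoeff M d * lamCoeff N e := by
  rw [lamCoeff_mul hM hN]
  have : d + e - e = d := by ring
  rw [this, Finset.Icc_self, Finset.sum_singleton]
  congr 2; ring

theorem lamCoeff_mul_top_sub_one {d e : ℤ} {M N : Mat n (LaurentSeries ℝ)} (hM : DegLE d M)
    (hN : DegLE e N) : lamCoeff (M * N) (d + e - 1)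
      = lamCoeff M (d - 1) * lamCoeff N e + lamCoeff M d * lamCoeff N (e - 1) := by
  rw [lamCoeff_mul hM hN]
  have h : Finset.Icc (d + e - 1 - e) d = {d - 1, d} := by
    ext x; simp only [Finset.mem_Icc, Finset.mem_insert, Finset.mem_singleton]; omega
  rw [h, Finset.sum_pair (by omega)]
  congr 3 <;> ring

theorem algebraMap_laurent (a : ℝ) : algebraMap ℝ (LaurentSeries ℝ) a = HahnSeries.C a := by
  rw [HahnSeries.algebraMap_apply']
  exact HahnSeries.ofPowerSeries_C a

theorem coeff_algebraMap_mul (a : ℝ) (f : LaurentSeries ℝ) (i : ℤ) :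
    (algebraMap ℝ (LaurentSeries ℝ) a * f).coeff i = a * f.coeff i := by
  rw [algebraMap_laurent]; simp

/-- A constant matrix as a Laurent series. -/
def cst (A : Mat n ℝ) : Mat n (LaurentSeries ℝ) := A.map (algebraMap ℝ (LaurentSeries ℝ))

theorem lamCoeff_smul_cst (c : LaurentSeries ℝ) (A : Mat n ℝ) (i : ℤ) :
    lamCoeff (c • cst A) i = c.coeff (-i) • A := by
  ext a b
  simp only [lamCoeff_apply, cst, Matrix.smul_apply, Matrix.map_apply, smul_eq_mul]
  rw [mul_comm, coeff_algebraMap_mul, mul_comm]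

theorem coeff_one (i : ℤ) : (1 : LaurentSeries ℝ).coeff i = if i = 0 then 1 else 0 := by
  rw [← HahnSeries.single_zero_one, HahnSeries.coeff_single]
  split_ifs <;> simp_all

theorem lamCoeff_cst (A : Mat n ℝ) (i : ℤ) : lamCoeff (cst A) i = if i = 0 then A else 0 := by
  have := lamCoeff_smul_cst 1 A i
  rw [one_smul, coeff_one] at this
  rw [this]
  simp only [neg_eq_zero]
  split_ifs <;> simp

theorem degLE_cst (A : Mat n ℝ) : DegLE 0 (cst A) := fun i hi => by
  rw [lamCoeff_cst, if_neg (by omega)]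

theorem cst_one : cst (1 : Mat n ℝ) = 1 := by
  simp [cst, Matrix.map_one]

theorem lamCoeff_cst_mul (A : Mat n ℝ) {M : Mat n (LaurentSeries ℝ)} (i : ℤ) :
    lamCoeff (cst A * M) i = A * lamCoeff M i := by
  ext a b
  simp only [lamCoeff_apply, Matrix.mul_apply, HahnSeries.coeff_sum, cst, Matrix.map_apply]
  refine Finset.sum_congr rfl fun c _ => ?_
  rw [coeff_algebraMap_mul]

theorem lamCoeff_mul_cst (A : Mat n ℝ) {M : Mat n (LaurentSeries ℝ)} (i : ℤ) :
    lamCoeff (M * cst A) i = lamCoeff M i * A := by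
  ext a b
  simp only [lamCoeff_apply, Matrix.mul_apply, HahnSeries.coeff_sum, cst, Matrix.map_apply]
  refine Finset.sum_congr rfl fun c _ => ?_
  rw [mul_comm, coeff_algebraMap_mul, mul_comm]

theorem lamCoeff_sharp (M : Mat n (LaurentSeries ℝ)) (i : ℤ) :
    lamCoeff (sharp M) i = sharp (lamCoeff M i) := by
  have h : formC n (LaurentSeries ℝ) = cst (formC n ℝ) :=
    (formC_map (algebraMap ℝ (LaurentSeries ℝ))).symm
  rw [sharp, sharp, h, lamCoeff_mul_cst, lamCoeff_cst_mul]
  rfl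

/-- The spectral parameter as a Laurent series. -/
def lam : LaurentSeries ℝ := HahnSeries.single (-1) 1

theorem lamCoeff_lam_smul (M : Mat n (LaurentSeries ℝ)) (i : ℤ) :
    lamCoeff (lam • M) i = lamCoeff M (i - 1) := by
  ext a b
  simp only [lamCoeff_apply, Matrix.smul_apply, smul_eq_mul, lam]
  have := HahnSeries.coeff_single_mul_add (r := (1 : ℝ)) (x := M a b) (a := -(i - 1)) (b := -1)
  rw [one_mul] at this
  rw [← this]
  congr 1; ring

theorem formalJ_eq : formalJ n = cst (bMat n) + lam • cst (betaMat n) := by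
  refine lamCoeff_ext fun i => ?_
  rw [formalJ, lamCoeff_add, lamCoeff_add, lamCoeff_lam_smul, lamCoeff_cst, lamCoeff_cst]
  congr 1
  · ext a b
    simp only [lamCoeff_apply, Matrix.map_apply, HahnSeries.coeff_single]
    by_cases h : i = 0 <;> simp [h]
  · ext a b
    simp only [lamCoeff_apply, Matrix.map_apply, HahnSeries.coeff_single]
    by_cases h : i = 1
    · simp [h]
    · have h' : i - 1 ≠ 0 := by omega
      simp [h, h']

/-! #### Polynomials in the spectral parameter -/

theorem coeff_aeval_lam (f : ℝ[X]) (i : ℕ) : (aeval lam f).coeff (-(i : ℤ)) = f.coeff i := by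
  rw [aeval_eq_sum_range, HahnSeries.coeff_sum]
  simp only [Algebra.smul_def, coeff_algebraMap_mul, lam, HahnSeries.single_pow, one_pow, HahnSeries.coeff_single]
  rw [Finset.sum_eq_single i]
  · simp
  · intro b _ hb
    rw [if_neg (by simp; omega), mul_zero]
  · intro h
    rw [Finset.mem_range, not_lt] at h
    rw [coeff_eq_zero_of_natDegree_lt (by omega), zero_mul]

theorem coeff_aeval_lam_neg (f : ℝ[X]) {i : ℤ} (hi : i < 0) : (aeval lam f).coeff (-i) = 0 := by
  rw [aeval_eq_sum_range, HahnSeries.coeff_sum]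
  refine Finset.sum_eq_zero fun b _ => ?_
  simp only [Algebra.smul_def, coeff_algebraMap_mul, lam, HahnSeries.single_pow, one_pow, HahnSeries.coeff_single]
  rw [if_neg (by simp; omega), mul_zero]

/-- A polynomial matrix as a Laurent series. -/
def polyL (B : Mat n ℝ[X]) : Mat n (LaurentSeries ℝ) := B.map (aeval lam)

/-- The value of a polynomial matrix at a complex number. -/
def polyC (z : ℂ) (B : Mat n ℝ[X]) : Mat n ℂ := B.map (aeval z)

theorem lamCoeff_polyL (B : Mat n ℝ[X]) (i : ℕ) : lamCoeff (polyL B) i = B.map (coeff · i) := by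
  ext a b
  exact coeff_aeval_lam _ _

theorem lamCoeff_polyL_neg (B : Mat n ℝ[X]) {i : ℤ} (hi : i < 0) : lamCoeff (polyL B) i = 0 := by
  ext a b
  exact coeff_aeval_lam_neg _ hi

/-- If the nonnegative part of a series of degree at most `d` is a polynomial matrix, then the
values of that matrix are given by `plusPart`. -/
theorem plusPart_eq_polyC {M : Mat n (LaurentSeries ℝ)} {d : ℕ} (hM : DegLE d M) {B : Mat n ℝ[X]}
    (h : ∀ i : ℕ, lamCoeff M i = B.map (coeff · i)) (z : ℂ) : plusPart M d z = polyC z B := by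
  ext a b
  have hdeg : (B a b).natDegree < d + 1 := by
    rw [Nat.lt_succ_iff, natDegree_le_iff_coeff_eq_zero]
    intro i hi
    have := congrFun (congrFun ((h i).symm.trans (hM i (by exact_mod_cast hi))) a) b
    exact this
  simp only [plusPart, polyC, Matrix.map_apply, Matrix.sum_apply, Matrix.smul_apply, toC,
    aeval_eq_sum_range' hdeg]
  refine Finset.sum_congr rfl fun i _ => ?_
  rw [h i, Matrix.map_apply, smul_eq_mul, mul_comm, Complex.real_smul]

/-- The polynomial part, as a polynomial matrix. -/
def plusPoly (M : Mat n (LaurentSeries ℝ)) (d : ℕ) : Mat n ℝ[X] :=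
  Matrix.of fun a b => ∑ i ∈ Finset.range (d + 1), monomial i (lamCoeff M i a b)

theorem plusPoly_coeff {M : Mat n (LaurentSeries ℝ)} {d : ℕ} (hM : DegLE d M) (i : ℕ) :
    lamCoeff M i = (plusPoly M d).map (coeff · i) := by
  ext a b
  simp only [plusPoly, Matrix.map_apply, Matrix.of_apply, finsetSum_coeff, coeff_monomial,
    Finset.sum_ite_eq', Finset.mem_range]
  split_ifs with h
  · rfl
  · rw [hM i (by omega)]; rfl

/-! #### Expansions of simple elements -/

theorem lam_ne (a : ℝ) : lam ≠ algebraMap ℝ (LaurentSeries ℝ) a := by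
  intro h
  have h1 := congrArg (fun f => HahnSeries.coeff f (-1)) h
  rw [algebraMap_laurent] at h1
  simp [lam, HahnSeries.C_apply] at h1

/-- With `X = λ⁻¹` the function is `(1 - a₂ X) / (1 - a₁ X)`. Its coefficient `a₁ - a₂` is the
source of the factor in the Bäcklund transformation. -/
theorem exists_rat_eq (a₁ a₂ : ℝ) : ∃ U : PowerSeries ℝ,
    rat (algebraMap ℝ (LaurentSeries ℝ) a₁) (algebraMap ℝ _ a₂) lam = HahnSeries.ofPowerSeries ℤ ℝ U
      ∧ PowerSeries.coeff 0 U = 1 ∧ PowerSeries.coeff 1 U = a₁ - a₂ := by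
  have hinv : (1 - PowerSeries.C a₁ * PowerSeries.X : PowerSeries ℝ)⁻¹
      * (1 - PowerSeries.C a₁ * PowerSeries.X) = 1 :=
    PowerSeries.inv_mul_cancel _ (by simp)
  set V := (1 - PowerSeries.C a₁ * PowerSeries.X : PowerSeries ℝ)⁻¹ with hV
  have hU : (V * (1 - PowerSeries.C a₂ * PowerSeries.X)) * (1 - PowerSeries.C a₁ * PowerSeries.X)
      = 1 - PowerSeries.C a₂ * PowerSeries.X := by
    rw [mul_right_comm, hinv, one_mul]
  refine ⟨V * (1 - PowerSeries.C a₂ * PowerSeries.X), ?_, ?_, ?_⟩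
  · have hl : ∀ a : ℝ, lam - algebraMap ℝ (LaurentSeries ℝ) a
        = lam * HahnSeries.ofPowerSeries ℤ ℝ (1 - PowerSeries.C a * PowerSeries.X) := by
      intro a
      have : lam * HahnSeries.single (1 : ℤ) (1 : ℝ) = 1 := by
        rw [lam, HahnSeries.single_mul_single]; simp
      rw [map_sub, map_one, map_mul, HahnSeries.ofPowerSeries_C, HahnSeries.ofPowerSeries_X,
        algebraMap_laurent, mul_sub, mul_one, mul_left_comm, this, mul_one]
    rw [rat, div_eq_iff (sub_ne_zero.2 (lam_ne a₁)), hl, hl, mul_left_comm, ← map_mul, hU]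
  · have := congrArg (PowerSeries.coeff 0) hU
    simpa using this
  · have h0 := congrArg (PowerSeries.coeff 0) hU
    have h1 := congrArg (PowerSeries.coeff 1) hU
    set U := V * (1 - PowerSeries.C a₂ * PowerSeries.X)
    have e : ∀ (W : PowerSeries ℝ) (a : ℝ), PowerSeries.coeff 1 (W * (1 - PowerSeries.C a * PowerSeries.X))
        = PowerSeries.coeff 1 W - a * PowerSeries.coeff 0 W := by
      intro W a
      rw [mul_sub, mul_one, ← mul_assoc, map_sub,
        show (1 : ℕ) = 0 + 1 from rfl, PowerSeries.coeff_succ_mul_X, mul_comm W,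
        PowerSeries.coeff_C_mul]
    have e2 := e 1 a₂
    rw [one_mul] at e2
    rw [e, e2] at h1
    have h0' : PowerSeries.coeff 0 U = 1 := by simpa using h0
    rw [h0'] at h1
    simp [PowerSeries.coeff_one] at h1
    linarith

/-- The expansion of `(λ - a₂) / (λ - a₁)` at infinity. -/
def ratL (a₁ a₂ : ℝ) : LaurentSeries ℝ :=
  rat (algebraMap ℝ (LaurentSeries ℝ) a₁) (algebraMap ℝ _ a₂) lam

theorem ratL_inv (a₁ a₂ : ℝ) : (ratL a₁ a₂)⁻¹ = ratL a₂ a₁ := by simp [ratL, rat]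

theorem ratL_coeff (a₁ a₂ : ℝ) : (∀ i : ℤ, 0 < i → (ratL a₁ a₂).coeff (-i) = 0) ∧
    (ratL a₁ a₂).coeff 0 = 1 ∧ (ratL a₁ a₂).coeff 1 = a₁ - a₂ := by
  obtain ⟨U, hU, h0, h1⟩ := exists_rat_eq a₁ a₂
  rw [ratL, hU]
  refine ⟨fun i hi => ?_, ?_, ?_⟩
  · have := PowerSeries.coeff_coe U (-i)
    rw [if_pos (by omega)] at this
    exact this
  · have := PowerSeries.coeff_coe U 0
    simpa [h0] using this
  · have := PowerSeries.coeff_coe U 1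
    simpa [h1] using this

/-- The linear map `p ↦ r⁻¹ p - (p + p♯) + r p♯` which is the linear part of the simple element. -/
def gLin {K : Type} [Field K] (r : K) (p : Mat n K) : Mat n K :=
  r⁻¹ • p - (p + sharp p) + r • sharp p

/-- The expansion of the simple element `g_{a₁,a₂,p}` at infinity. -/
def gL (a₁ a₂ : ℝ) (p : Mat n ℝ) : Mat n (LaurentSeries ℝ) :=
  gElt (algebraMap ℝ _ a₁) (algebraMap ℝ _ a₂) (cst p) lam

/-- On isotropic projections the simple element is affine in `p`; its derivative along a family of
them is therefore `gLin` of the derivative of the projection. -/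
theorem gElt_eq_gLin {K : Type} [Field K] {a₁ a₂ z : K} {p : Mat n K} (hp : IsoProj p)
    (h₁ : z ≠ a₁) (h₂ : z ≠ a₂) : gElt a₁ a₂ p z = 1 + gLin (rat a₁ a₂ z) p := by
  rw [gElt_eq hp h₁ h₂, gLin]; module

theorem gL_eq {a₁ a₂ : ℝ} {p : Mat n ℝ} (hp : IsoProj p) :
    gL a₁ a₂ p = 1 + gLin (ratL a₁ a₂) (cst p) :=
  gElt_eq_gLin (hp.map _) (lam_ne a₁) (lam_ne a₂)

theorem lamCoeff_gLin (a₁ a₂ : ℝ) (p : Mat n ℝ) (i : ℤ) :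
    lamCoeff (gLin (ratL a₁ a₂) (cst p)) i = (ratL a₂ a₁).coeff (-i) • p
      - (if i = 0 then p + sharp p else 0) + (ratL a₁ a₂).coeff (-i) • sharp p := by
  rw [gLin, ratL_inv, lamCoeff_add, lamCoeff_sub, lamCoeff_add, lamCoeff_smul_cst,
    show sharp (cst p) = cst (sharp p) from sharp_map _ _, lamCoeff_smul_cst, lamCoeff_cst,
    lamCoeff_cst]
  split_ifs <;> simp

/-- Both `ratL` and its inverse begin with `1`, so the constant terms cancel. No property of a
projection enters, and the bound applies to the derivative of one. -/
theorem degLE_gLin (a₁ a₂ : ℝ) (p : Mat n ℝ) : DegLE (-1) (gLin (ratL a₁ a₂) (cst p)) := by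
  intro i hi
  rw [lamCoeff_gLin]
  split_ifs with h
  · subst h
    rw [neg_zero, (ratL_coeff _ _).2.1, (ratL_coeff _ _).2.1]; module
  · rw [(ratL_coeff _ _).1 i (by omega), (ratL_coeff _ _).1 i (by omega)]; module

theorem lamCoeff_gLin_neg_one (a₁ a₂ : ℝ) (p : Mat n ℝ) :
    lamCoeff (gLin (ratL a₁ a₂) (cst p)) (-1) = (a₁ - a₂) • (sharp p - p) := by
  rw [lamCoeff_gLin, if_neg (by omega), neg_neg, (ratL_coeff _ _).2.2, (ratL_coeff _ _).2.2]
  module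

theorem lamCoeff_one (i : ℤ) : lamCoeff (1 : Mat n (LaurentSeries ℝ)) i = if i = 0 then 1 else 0 := by
  rw [← cst_one, lamCoeff_cst]

theorem lamCoeff_gL_neg_one {a₁ a₂ : ℝ} {p : Mat n ℝ} (hp : IsoProj p) :
    lamCoeff (gL a₁ a₂ p) (-1) = (a₁ - a₂) • (sharp p - p) := by
  rw [gL_eq hp, lamCoeff_add, lamCoeff_one, lamCoeff_gLin_neg_one, if_neg (by omega), zero_add]

theorem lamCoeff_gL_zero {a₁ a₂ : ℝ} {p : Mat n ℝ} (hp : IsoProj p) :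
    lamCoeff (gL a₁ a₂ p) 0 = 1 := by
  rw [gL_eq hp, lamCoeff_add, lamCoeff_one, degLE_gLin _ _ _ _ (by omega), if_pos rfl, add_zero]

theorem degLE_gL {a₁ a₂ : ℝ} {p : Mat n ℝ} (hp : IsoProj p) : DegLE 0 (gL a₁ a₂ p) := by
  rw [gL_eq hp]
  refine DegLE.add ?_ ((degLE_gLin _ _ _).mono (by omega))
  rw [← cst_one]; exact degLE_cst _

theorem gL_mul_sharp {a₁ a₂ : ℝ} {p : Mat n ℝ} (hp : IsoProj p) :
    gL a₁ a₂ p * gL a₁ a₂ (sharp p) = 1 := by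
  have := gElt_mul_sharp (hp.map (algebraMap ℝ (LaurentSeries ℝ))) (lam_ne a₁) (lam_ne a₂)
  rwa [sharp_map] at this

theorem sharp_gL {a₁ a₂ : ℝ} {p : Mat n ℝ} (hp : IsoProj p) :
    sharp (gL a₁ a₂ p) = gL a₁ a₂ (sharp p) := by
  have := sharp_gElt (hp.map (algebraMap ℝ (LaurentSeries ℝ))) (lam_ne a₁) (lam_ne a₂)
  rwa [sharp_map] at this

/-! #### Differentiation of series with respect to a parameter -/

/-- The series `L y`, of bounded degree near `y₀`, can be differentiated termwise at `y₀`. -/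
structure HasLamDeriv (L : ℝ → Mat n (LaurentSeries ℝ)) (L' : Mat n (LaurentSeries ℝ))
    (y₀ : ℝ) : Prop where
  bound : ∃ d : ℤ, (∀ᶠ y in nhds y₀, DegLE d (L y))
  deriv : ∀ i a b, HasDerivAt (fun y => lamCoeff (L y) i a b) (lamCoeff L' i a b) y₀

theorem degLE_of_hasLamDeriv {L : ℝ → Mat n (LaurentSeries ℝ)} {L' : Mat n (LaurentSeries ℝ)}
    {y₀ : ℝ} (h : HasLamDeriv L L' y₀) {d : ℤ} (hd : ∀ᶠ y in nhds y₀, DegLE d (L y)) :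
    DegLE d L' := by
  intro i hi
  ext a b
  refine (h.deriv i a b).unique ?_
  refine (hasDerivAt_const y₀ (0 : ℝ)).congr_of_eventuallyEq ?_
  filter_upwards [hd] with y hy
  rw [hy i hi]; rfl

theorem HasLamDeriv.mul {L M : ℝ → Mat n (LaurentSeries ℝ)} {L' M' : Mat n (LaurentSeries ℝ)}
    {y₀ : ℝ} (hL : HasLamDeriv L L' y₀) (hM : HasLamDeriv M M' y₀) :
    HasLamDeriv (fun y => L y * M y) (L' * M y₀ + L y₀ * M') y₀ := by
  obtain ⟨d, hd⟩ := hL.bound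
  obtain ⟨e, he⟩ := hM.bound
  refine ⟨⟨d + e, ?_⟩, fun i a b => ?_⟩
  · filter_upwards [hd, he] with y h1 h2 using h1.mul h2
  · have h1 : (fun y => lamCoeff (L y * M y) i a b) =ᶠ[nhds y₀] fun y =>
        ∑ m ∈ Finset.Icc (i - e) d, ∑ c, lamCoeff (L y) m a c * lamCoeff (M y) (i - m) c b := by
      filter_upwards [hd, he] with y h1 h2
      rw [lamCoeff_mul h1 h2, Matrix.sum_apply]
      simp only [Matrix.mul_apply]
    refine HasDerivAt.congr_of_eventuallyEq ?_ h1
    rw [lamCoeff_add, lamCoeff_mul (degLE_of_hasLamDeriv hL hd) he.self_of_nhds,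
      lamCoeff_mul hd.self_of_nhds (degLE_of_hasLamDeriv hM he), ← Finset.sum_add_distrib,
      Matrix.sum_apply]
    refine HasDerivAt.fun_sum fun m _ => ?_
    rw [Matrix.add_apply, Matrix.mul_apply, Matrix.mul_apply, ← Finset.sum_add_distrib]
    exact HasDerivAt.fun_sum fun c _ => (hL.deriv m a c).mul (hM.deriv (i - m) c b)

theorem HasLamDeriv.unique {L : ℝ → Mat n (LaurentSeries ℝ)} {L' L'' : Mat n (LaurentSeries ℝ)}
    {y₀ : ℝ} (h : HasLamDeriv L L' y₀) (h' : HasLamDeriv L L'' y₀) : L' = L'' :=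
  lamCoeff_ext fun i => by ext a b; exact (h.deriv i a b).unique (h'.deriv i a b)

theorem hasLamDeriv_const (A : Mat n (LaurentSeries ℝ)) {d : ℤ} (hA : DegLE d A) (y₀ : ℝ) :
    HasLamDeriv (fun _ => A) 0 y₀ :=
  ⟨⟨d, Filter.Eventually.of_forall fun _ => hA⟩, fun i a b => by
    rw [lamCoeff_zero]; exact hasDerivAt_const _ _⟩

theorem HasLamDeriv.congr {L M : ℝ → Mat n (LaurentSeries ℝ)} {L' : Mat n (LaurentSeries ℝ)}
    {y₀ : ℝ} (h : HasLamDeriv L L' y₀) (hLM : ∀ᶠ y in nhds y₀, M y = L y) :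
    HasLamDeriv M L' y₀ := by
  refine ⟨?_, fun i a b => (h.deriv i a b).congr_of_eventuallyEq ?_⟩
  · obtain ⟨d, hd⟩ := h.bound
    exact ⟨d, by filter_upwards [hd, hLM] with y h1 h2; rwa [h2]⟩
  · filter_upwards [hLM] with y hy
    rw [hy]

end Laurent

/-! ### Entrywise derivatives of matrices -/

section EntryDeriv

variable {n : ℕ} {K : Type} [RCLike K]

/-- Entrywise differentiability of a matrix-valued function of a real variable. -/
def HasEntryDeriv (M : ℝ → Mat n K) (M' : Mat n K) (y₀ : ℝ) : Prop :=
  ∀ a b, HasDerivAt (fun y => M y a b) (M' a b) y₀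

theorem HasEntryDeriv.mul {M N : ℝ → Mat n K} {M' N' : Mat n K} {y₀ : ℝ}
    (hM : HasEntryDeriv M M' y₀) (hN : HasEntryDeriv N N' y₀) :
    HasEntryDeriv (fun y => M y * N y) (M' * N y₀ + M y₀ * N') y₀ := by
  intro a b
  simp only [Matrix.mul_apply, Matrix.add_apply, ← Finset.sum_add_distrib]
  exact HasDerivAt.fun_sum fun c _ => (hM a c).mul (hN c b)

theorem HasEntryDeriv.unique {M : ℝ → Mat n K} {M' M'' : Mat n K} {y₀ : ℝ}
    (h : HasEntryDeriv M M' y₀) (h' : HasEntryDeriv M M'' y₀) : M' = M'' := by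
  ext a b; exact (h a b).unique (h' a b)

theorem hasEntryDeriv_const (A : Mat n K) (y₀ : ℝ) : HasEntryDeriv (fun _ => A) 0 y₀ :=
  fun _ _ => hasDerivAt_const _ _

theorem HasEntryDeriv.congr {M N : ℝ → Mat n K} {M' : Mat n K} {y₀ : ℝ}
    (h : HasEntryDeriv M M' y₀) (hMN : ∀ᶠ y in nhds y₀, N y = M y) : HasEntryDeriv N M' y₀ :=
  fun a b => (h a b).congr_of_eventuallyEq (by filter_upwards [hMN] with y hy; rw [hy])

theorem HasEntryDeriv.sharp {M : ℝ → Mat n K} {M' : Mat n K} {y₀ : ℝ}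
    (h : HasEntryDeriv M M' y₀) : HasEntryDeriv (fun y => sharp (M y)) (sharp M') y₀ := by
  intro a b
  simp only [sharp_apply]
  exact (h _ _).const_mul _

theorem HasEntryDeriv.gLin {M : ℝ → Mat n K} {M' : Mat n K} {y₀ : ℝ}
    (h : HasEntryDeriv M M' y₀) (r : K) :
    HasEntryDeriv (fun y => gLin r (M y)) (gLin r M') y₀ := by
  intro a b
  simp only [BKdV.gLin, Matrix.add_apply, Matrix.sub_apply, Matrix.smul_apply, smul_eq_mul]
  exact (((h a b).const_mul _).sub ((h a b).add (h.sharp a b))).add ((h.sharp a b).const_mul _)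

theorem HasEntryDeriv.const_add {M : ℝ → Mat n K} {M' : Mat n K} {y₀ : ℝ}
    (h : HasEntryDeriv M M' y₀) (A : Mat n K) : HasEntryDeriv (fun y => A + M y) M' y₀ :=
  fun a b => (h a b).const_add _

theorem HasEntryDeriv.toC {M : ℝ → Mat n ℝ} {M' : Mat n ℝ} {y₀ : ℝ}
    (h : HasEntryDeriv M M' y₀) : HasEntryDeriv (fun y => toC (M y)) (toC M') y₀ :=
  fun a b => (h a b).ofReal_comp

theorem HasEntryDeriv.hasLamDeriv_gL {p : ℝ → Mat n ℝ} {p' : Mat n ℝ} {y₀ : ℝ} (a₁ a₂ : ℝ)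
    (h : HasEntryDeriv p p' y₀) (hp : ∀ᶠ y in nhds y₀, IsoProj (p y)) :
    HasLamDeriv (fun y => gL a₁ a₂ (p y)) (BKdV.gLin (ratL a₁ a₂) (cst p')) y₀ := by
  refine ⟨⟨0, by filter_upwards [hp] with y hy using degLE_gL hy⟩, fun i a b => ?_⟩
  have h1 : (fun y => lamCoeff (gL a₁ a₂ (p y)) i a b) =ᶠ[nhds y₀] fun y =>
      lamCoeff (1 : Mat n (LaurentSeries ℝ)) i a b +
        ((ratL a₂ a₁).coeff (-i) * p y a b - (if i = 0 then 1 else 0) * (p y a b + BKdV.sharp (p y) a b)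
          + (ratL a₁ a₂).coeff (-i) * BKdV.sharp (p y) a b) := by
    filter_upwards [hp] with y hy
    rw [gL_eq hy, lamCoeff_add, lamCoeff_gLin]
    split_ifs <;> simp
  refine HasDerivAt.congr_of_eventuallyEq ?_ h1
  have h2 : lamCoeff (BKdV.gLin (ratL a₁ a₂) (cst p')) i a b
      = (ratL a₂ a₁).coeff (-i) * p' a b - (if i = 0 then 1 else 0) * (p' a b + BKdV.sharp p' a b)
          + (ratL a₁ a₂).coeff (-i) * BKdV.sharp p' a b := by
    rw [lamCoeff_gLin]
    split_ifs <;> simp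
  rw [h2]
  exact ((((h a b).const_mul _).sub (((h a b).add (h.sharp a b)).const_mul _)).add
    ((h.sharp a b).const_mul _)).const_add _

end EntryDeriv

/-! ### Matrices of rank at most one -/

section RankOne

variable {n : ℕ} {K L : Type} [Field K] [Field L]

/-- `p` is the product of a column and a row. -/
def RankLEOne (p : Mat n K) : Prop := ∃ v c, p = Matrix.vecMulVec v c

theorem rankLEOne_of_rank_le_one {p : Mat n K} (h : p.rank ≤ 1) : RankLEOne p := by
  rw [Matrix.rank, finrank_le_one_iff] at h
  obtain ⟨⟨v, _⟩, hv⟩ := h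
  choose c hc using fun j => hv ⟨p.mulVec (Pi.single j 1), ⟨_, rfl⟩⟩
  refine ⟨v, c, ?_⟩
  ext i j
  have := congrFun (congrArg Subtype.val (hc j)) i
  simp only [SetLike.mk_smul_mk, Pi.smul_apply, smul_eq_mul, Matrix.mulVec_single_one] at this
  rw [Matrix.vecMulVec_apply, mul_comm, this]
  rfl

theorem RankLEOne.mul_left {p : Mat n K} (h : RankLEOne p) (A : Mat n K) : RankLEOne (A * p) := by
  obtain ⟨v, c, rfl⟩ := h
  exact ⟨A.mulVec v, c, Matrix.mul_vecMulVec _ _ _⟩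

theorem RankLEOne.mul_right {p : Mat n K} (h : RankLEOne p) (A : Mat n K) : RankLEOne (p * A) := by
  obtain ⟨v, c, rfl⟩ := h
  exact ⟨v, Matrix.vecMul c A, Matrix.vecMulVec_mul _ _ _⟩

theorem RankLEOne.sharp {p : Mat n K} (h : RankLEOne p) : RankLEOne (sharp p) := by
  obtain ⟨v, c, rfl⟩ := h
  have : RankLEOne (Matrix.vecMulVec v c).transpose := ⟨c, v, Matrix.transpose_vecMulVec v c⟩
  exact (this.mul_left _).mul_right _

theorem RankLEOne.map {p : Mat n K} (h : RankLEOne p) (f : K →+* L) : RankLEOne (p.map f) := by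
  obtain ⟨v, c, rfl⟩ := h
  refine ⟨f ∘ v, f ∘ c, ?_⟩
  ext i j
  simp [Matrix.vecMulVec_apply]

/-- A skew form vanishes on a line. -/
theorem RankLEOne.sharp_mul_mul_eq_zero [CharZero K] {p W : Mat n K} (h : RankLEOne p)
    (hW : BKdV.sharp W = -W) : BKdV.sharp p * W * p = 0 := by
  obtain ⟨v, c, rfl⟩ := h
  -- Skewness of `W` for the form means that `C W` is antisymmetric, so `v ⬝ᵥ C W v` equals its own
  -- negative.
  have hS : (formC n K * W).transpose = -(formC n K * W) := by
    rw [Matrix.transpose_mul, formC_transpose, ← formC_mul_sharp, hW, mul_neg]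
  have hv : v ⬝ᵥ (formC n K * W).mulVec v = 0 := by
    have h1 : v ⬝ᵥ (formC n K * W).mulVec v = v ⬝ᵥ (formC n K * W).transpose.mulVec v := by
      rw [Matrix.mulVec_transpose, Matrix.dotProduct_mulVec, dotProduct_comm]
    rw [hS, Matrix.neg_mulVec, dotProduct_neg] at h1
    exact self_eq_neg.1 h1
  have e : BKdV.sharp (Matrix.vecMulVec v c) * W * Matrix.vecMulVec v c
      = formC n K * (Matrix.vecMulVec c v * (formC n K * W) * Matrix.vecMulVec v c) := by
    simp only [BKdV.sharp, Matrix.transpose_vecMulVec, mul_assoc]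
  rw [e, mul_assoc, Matrix.mul_vecMulVec, Matrix.vecMulVec_mul_vecMulVec, hv]
  simp

end RankOne

/-! ### Entire matrix functions and removable singularities -/

section Entire

variable {n : ℕ}

/-- Entrywise entire matrix functions. -/
def EntireM (M : ℂ → Mat n ℂ) : Prop := ∀ a b, Differentiable ℂ fun z => M z a b

theorem entireM_const (A : Mat n ℂ) : EntireM fun _ => A := fun _ _ => differentiable_const _

theorem EntireM.mul {M N : ℂ → Mat n ℂ} (hM : EntireM M) (hN : EntireM N) :
    EntireM fun z => M z * N z := by
  intro a b
  simp only [Matrix.mul_apply]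
  exact Differentiable.fun_sum fun c _ => (hM a c).mul (hN c b)

theorem EntireM.add {M N : ℂ → Mat n ℂ} (hM : EntireM M) (hN : EntireM N) :
    EntireM fun z => M z + N z := fun a b => (hM a b).add (hN a b)

theorem EntireM.smul {f : ℂ → ℂ} {M : ℂ → Mat n ℂ} (hf : Differentiable ℂ f) (hM : EntireM M) :
    EntireM fun z => f z • M z := fun a b => hf.mul (hM a b)

theorem EntireM.sharp {M : ℂ → Mat n ℂ} (hM : EntireM M) : EntireM fun z => sharp (M z) := by
  intro a b
  simp only [sharp_apply]
  exact (hM _ _).const_mul _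

theorem EntireM.continuous {M : ℂ → Mat n ℂ} (hM : EntireM M) : Continuous M :=
  continuous_matrix fun a b => (hM a b).continuous

theorem differentiable_dslope {f : ℂ → ℂ} (hf : Differentiable ℂ f) (a : ℂ) :
    Differentiable ℂ (dslope f a) := by
  rw [← differentiableOn_univ]
  exact (Complex.differentiableOn_dslope Filter.univ_mem).2 hf.differentiableOn

theorem EntireM.exists_eq_smul {M : ℂ → Mat n ℂ} (hM : EntireM M) {a : ℂ} (h : M a = 0) :
    ∃ G, EntireM G ∧ ∀ z, M z = (z - a) • G z := by
  refine ⟨fun z => Matrix.of fun i j => dslope (fun z => M z i j) a z,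
    fun i j => differentiable_dslope (hM i j) a, fun z => ?_⟩
  ext i j
  have := sub_smul_dslope (fun z => M z i j) a z
  rw [h] at this
  simpa using this.symm

theorem EntireM.exists_eq_sq_smul {M : ℂ → Mat n ℂ} (hM : EntireM M) {a : ℂ} (h : M a = 0)
    (h' : ∀ i j, deriv (fun z => M z i j) a = 0) :
    ∃ G, EntireM G ∧ ∀ z, M z = ((z - a) * (z - a)) • G z := by
  have hG : EntireM (n := n) fun z => Matrix.of fun i j => dslope (fun z => M z i j) a z :=
    fun i j => differentiable_dslope (hM i j) a
  obtain ⟨G, hG1, hG2⟩ := hG.exists_eq_smul (a := a) (by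
    ext i j
    simp [h' i j])
  refine ⟨G, hG1, fun z => ?_⟩
  rw [mul_smul, ← hG2]
  ext i j
  have := sub_smul_dslope (fun z => M z i j) a z
  rw [h] at this
  simpa using this.symm

theorem EntireM.eq_of_eqOn {M N : ℂ → Mat n ℂ} (hM : EntireM M) (hN : EntireM N) {S : Set ℂ}
    (hS : S.Finite) (h : ∀ z, z ∉ S → M z = N z) (z : ℂ) : M z = N z := by
  have := Continuous.ext_on (hS.countable.dense_compl ℝ) hM.continuous hN.continuous h
  exact congrFun this z

/-- Near the pole `a₁` the dressed frame is holomorphic when the projection has rank one. -/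
theorem EntireM.exists_cancel {H : ℂ → Mat n ℂ} (hH : EntireM H)
    (horth : ∀ z, BKdV.sharp (H z) * H z = 1) {a₁ a₂ : ℂ} {π p : Mat n ℂ}
    (hT : TildeRel (H a₁) (H a₂) π p) (hr : RankLEOne π) :
    ∃ G₁ G₂, EntireM G₁ ∧ EntireM G₂ ∧
      (∀ z, (1 - π - BKdV.sharp π) * H z * p
        + BKdV.sharp π * H z * (1 - p - BKdV.sharp p) = (z - a₁) • G₁ z) ∧
      ∀ z, BKdV.sharp π * H z * p = ((z - a₁) * (z - a₁)) • G₂ z := by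
  have o₁ : H a₁ * BKdV.sharp (H a₁) = 1 := mul_eq_one_comm.1 hT.orth₁
  have hzero : BKdV.sharp π * H a₁ * p = 0 := by
    rw [mul_assoc, ← hT.img]
    simp only [← mul_assoc, hT.iso.sharp_mul, zero_mul]
  have h₁ : EntireM fun z => (1 - π - BKdV.sharp π) * H z * p
        + BKdV.sharp π * H z * (1 - p - BKdV.sharp p) :=
    (((entireM_const _).mul hH).mul (entireM_const _)).add
      (((entireM_const _).mul hH).mul (entireM_const _))
  have h₂ : EntireM fun z => BKdV.sharp π * H z * p :=
    ((entireM_const _).mul hH).mul (entireM_const _)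
  -- Both summands vanish at `a₁`: `H p = π H p` kills the first, and in the second `sharp π * H * p
  -- = 0` while `sharp π * H * sharp p = sharp π * H`.
  obtain ⟨G₁, hG₁, e₁⟩ := h₁.exists_eq_smul (a := a₁) (by
    have e : (1 - π - BKdV.sharp π) * H a₁ * p = 0 := by
      rw [mul_assoc, ← hT.img]
      simp only [← mul_assoc, sub_mul, one_mul, hT.iso.idem, hT.iso.sharp_mul]
      simp
    rw [e, mul_sub, mul_sub, mul_one, hzero, hT.sharp.kern]
    simp)
  -- For the double zero the derivative is written as `sharp π * H * (sharp p * (sharp H * D) * p)`,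
  -- where `D` is the derivative of `H`. Differentiating `sharp H * H = 1` shows that `sharp H * D`
  -- is skew, and a skew form vanishes on the line `Im p`. Only here is the rank used.
  obtain ⟨G₂, hG₂, e₂⟩ := h₂.exists_eq_sq_smul (a := a₁) hzero (by
    set D : Mat n ℂ := Matrix.of fun i j => deriv (fun z => H z i j) a₁ with hD
    have hHd : ∀ i j, HasDerivAt (fun z => H z i j) (D i j) a₁ :=
      fun i j => (hH i j a₁).hasDerivAt
    have hsd : ∀ i j, HasDerivAt (fun z => BKdV.sharp (H z) i j) (BKdV.sharp D i j) a₁ := by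
      intro i j
      simp only [sharp_apply]
      exact (hHd _ _).const_mul _
    have hskew : BKdV.sharp D * H a₁ + BKdV.sharp (H a₁) * D = 0 := by
      ext i j
      have h1 : HasDerivAt (fun z => (BKdV.sharp (H z) * H z) i j)
          ((BKdV.sharp D * H a₁ + BKdV.sharp (H a₁) * D) i j) a₁ := by
        simp only [Matrix.mul_apply, Matrix.add_apply, ← Finset.sum_add_distrib]
        exact HasDerivAt.fun_sum fun c _ => (hsd i c).mul (hHd c j)
      simp only [horth] at h1
      exact h1.unique (hasDerivAt_const _ _)
    have hW : BKdV.sharp (BKdV.sharp (H a₁) * D) = -(BKdV.sharp (H a₁) * D) := by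
      rw [sharp_mul, sharp_sharp]
      exact eq_neg_of_add_eq_zero_left hskew
    have hp : RankLEOne p := by
      have : p = BKdV.sharp (H a₁) * (π * (H a₁ * p)) := by
        rw [← mul_assoc π, hT.img, ← mul_assoc, hT.orth₁, one_mul]
      rw [this]
      exact (hr.mul_right _).mul_left _
    have hz : BKdV.sharp π * D * p = 0 := by
      calc BKdV.sharp π * D * p
          = BKdV.sharp π * H a₁ * (BKdV.sharp (H a₁) * D) * p := by
            simp only [mul_assoc]; rw [← mul_assoc (H a₁), o₁, one_mul]
        _ = BKdV.sharp π * H a₁ * (BKdV.sharp p * (BKdV.sharp (H a₁) * D) * p) := by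
            conv_lhs => rw [← hT.sharp.kern]
            simp only [mul_assoc]
        _ = 0 := by rw [hp.sharp_mul_mul_eq_zero hW, mul_zero]
    intro i j
    have h1 : HasDerivAt (fun z => (BKdV.sharp π * H z * p) i j)
        ((BKdV.sharp π * D * p) i j) a₁ := by
      simp only [Matrix.mul_apply]
      exact HasDerivAt.fun_sum fun c _ =>
        (HasDerivAt.fun_sum fun d _ => (hHd d c).const_mul _).mul_const _
    rw [h1.deriv, hz]; rfl)
  exact ⟨G₁, G₂, hG₁, hG₂, e₁, e₂⟩

/-- Dressing with a projection of rank one preserves entire orthogonal maps. -/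
theorem EntireM.exists_dress {H : ℂ → Mat n ℂ} (hH : EntireM H)
    (horth : ∀ z, BKdV.sharp (H z) * H z = 1) {a₁ a₂ : ℂ} {π p : Mat n ℂ}
    (hT : TildeRel (H a₁) (H a₂) π p) (hr : RankLEOne π) :
    ∃ E, EntireM E ∧ ∀ z, z ≠ a₁ → z ≠ a₂ →
      E z = gElt a₁ a₂ π z * H z * gElt a₁ a₂ (BKdV.sharp p) z := by
  obtain ⟨G₁, G₂, hG₁, hG₂, e₁, e₂⟩ := hH.exists_cancel horth hT hr
  obtain ⟨K₁, K₂, hK₁, hK₂, f₁, f₂⟩ := hH.exists_cancel horth hT.sharp hr.sharp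
  simp only [sharp_sharp] at f₁ f₂
  have hl : ∀ a : ℂ, Differentiable ℂ fun z => z - a := fun a =>
    differentiable_id.sub_const a
  have hm : EntireM fun z => π * H z * p
      + (1 - π - BKdV.sharp π) * H z * (1 - p - BKdV.sharp p)
      + BKdV.sharp π * H z * BKdV.sharp p :=
    ((((entireM_const _).mul hH).mul (entireM_const _)).add
      (((entireM_const _).mul hH).mul (entireM_const _))).add
      (((entireM_const _).mul hH).mul (entireM_const _))
  -- The nine terms of the product are grouped by the powers `r²`, `r`, `1`, `r⁻¹`, `r⁻²`. The zeros
  -- at `a₁` cancel the poles of `r²` and `r`, those at `a₂` the poles of `r⁻¹` and `r⁻²`.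
  refine ⟨_, ((((EntireM.smul ((hl a₂).mul (hl a₂)) hG₂).add (EntireM.smul (hl a₂) hG₁)).add
    hm).add (EntireM.smul (hl a₁) hK₁)).add (EntireM.smul ((hl a₁).mul (hl a₁)) hK₂), ?_⟩
  intro z h₁ h₂
  have h₁' := sub_ne_zero.2 h₁
  have h₂' := sub_ne_zero.2 h₂
  rw [gElt_eq hT.iso h₁ h₂, gElt_sharp hT.isoProj h₁ h₂]
  set r := rat a₁ a₂ z with hr
  have hr0 : r ≠ 0 := rat_ne_zero h₁ h₂
  have c₁ : (z - a₂) = r * (z - a₁) := by rw [hr, rat]; field_simp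
  have c₂ : (z - a₁) = r⁻¹ * (z - a₂) := by rw [c₁]; field_simp
  have g₁ : (z - a₂) • G₁ z = r • ((1 - π - BKdV.sharp π) * H z * p
        + BKdV.sharp π * H z * (1 - p - BKdV.sharp p)) := by
    rw [e₁, smul_smul, ← c₁]
  have g₂ : ((z - a₂) * (z - a₂)) • G₂ z = (r * r) • (BKdV.sharp π * H z * p) := by
    rw [e₂, smul_smul]; congr 1; rw [c₁]; ring
  have k₁ : (z - a₁) • K₁ z = r⁻¹ • ((1 - BKdV.sharp π - π) * H z * BKdV.sharp p
        + π * H z * (1 - BKdV.sharp p - p)) := by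
    rw [f₁, smul_smul, ← c₂]
  have k₂ : ((z - a₁) * (z - a₁)) • K₂ z = (r⁻¹ * r⁻¹) • (π * H z * BKdV.sharp p) := by
    rw [f₂, smul_smul]; congr 1; rw [c₂]; ring
  simp only [Pi.mul_apply]
  rw [g₁, g₂, k₁, k₂, sub_right_comm 1 (BKdV.sharp π) π, sub_right_comm 1 (BKdV.sharp p) p]
  generalize 1 - π - BKdV.sharp π = π₀
  generalize 1 - p - BKdV.sharp p = p₀
  simp only [mul_add, add_mul, Matrix.smul_mul, Matrix.mul_smul, smul_add, smul_smul,
    mul_inv_cancel₀ hr0, inv_mul_cancel₀ hr0, one_smul]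
  abel

end Entire

/-! ### Parameter derivatives of families of entire functions -/

section ParameterDerivative

open Metric

/-- Let `f y` extend to entire functions. The derivative in the parameter is bounded
near an isolated singularity. -/
theorem exists_bound_deriv_of_entire {f : ℝ → ℂ → ℂ} {I : Set ℝ} (hI : IsOpen I) {U : Set ℂ}
    (hU : IsOpen U) (hf : ContDiffOn ℝ ∞ (fun w : ℝ × ℂ => f w.1 w.2) (I ×ˢ U)) {y₀ : ℝ}
    (hy₀ : y₀ ∈ I) {a : ℂ} {ρ : ℝ} (hρ : 0 < ρ) (hsub : closedBall a ρ \ {a} ⊆ U)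
    (hext : ∀ y ∈ I, ∃ H : ℂ → ℂ, Differentiable ℂ H ∧ ∀ z ∈ U, H z = f y z)
    {f' : ℂ → ℂ} (hf' : ∀ z ∈ U, HasDerivAt (fun y => f y z) (f' z) y₀) :
    ∃ C, ∀ z ∈ ball a ρ, z ≠ a → ‖f' z‖ ≤ C := by
  obtain ⟨δ, hδ, hδI⟩ := nhds_basis_closedBall.mem_iff.1 (hI.mem_nhds hy₀)
  have hO : IsOpen (I ×ˢ U) := hI.prod hU
  have hsph : sphere a ρ ⊆ U := fun z hz => hsub
    ⟨sphere_subset_closedBall hz, ne_of_mem_sphere hz hρ.ne'⟩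
  have hK : closedBall y₀ δ ×ˢ sphere a ρ ⊆ I ×ˢ U := Set.prod_mono hδI hsph
  have hcont := (hf.continuousOn_fderiv_of_isOpen hO (by simp)).mono hK
  obtain ⟨C, hC⟩ := ((isCompact_closedBall y₀ δ).prod (isCompact_sphere a ρ)).exists_bound_of_continuousOn
    hcont
  -- Joint smoothness is available only away from `a`. On the sphere around `a` it gives a Lipschitz
  -- estimate in the parameter that is uniform in `z`.
  have hlip : ∀ z ∈ sphere a ρ, ∀ y ∈ closedBall y₀ δ, ‖f y z - f y₀ z‖ ≤ C * ‖y - y₀‖ := by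
    intro z hz y hy
    have hd : ∀ x ∈ closedBall y₀ δ, HasDerivAt (fun y => f y z)
        (fderiv ℝ (fun w : ℝ × ℂ => f w.1 w.2) (x, z) (1, 0)) x := by
      intro x hx
      have h1 : HasFDerivAt (fun w : ℝ × ℂ => f w.1 w.2)
          (fderiv ℝ (fun w : ℝ × ℂ => f w.1 w.2) (x, z)) (x, z) :=
        ((hf.contDiffAt (hO.mem_nhds (hK ⟨hx, hz⟩))).differentiableAt (by simp)).hasFDerivAt
      exact h1.comp_hasDerivAt x ((hasDerivAt_id x).prodMk (hasDerivAt_const x z))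
    refine Convex.norm_image_sub_le_of_norm_hasDerivWithin_le
      (fun x hx => (hd x hx).hasDerivWithinAt) (fun x hx => ?_) (convex_closedBall y₀ δ)
      (mem_closedBall_self hδ.le) hy
    refine (ContinuousLinearMap.le_opNorm _ _).trans ?_
    have : ‖((1 : ℝ), (0 : ℂ))‖ = 1 := by simp [Prod.norm_def]
    rw [this, mul_one]
    exact hC (x, z) ⟨hx, hz⟩
  refine ⟨C, fun z hz hza => ?_⟩
  have hzU : z ∈ U := hsub ⟨ball_subset_closedBall hz, hza⟩
  obtain ⟨H₀, hH₀, e₀⟩ := hext y₀ hy₀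
  have hC0 : 0 ≤ C := by
    obtain ⟨w, hw⟩ := (NormedSpace.sphere_nonempty (E := ℂ) (x := a)).2 hρ.le
    exact (norm_nonneg _).trans (hC (y₀, w) ⟨mem_closedBall_self hδ.le, hw⟩)
  refine (hf' z hzU).le_of_lip' hC0 ?_
  filter_upwards [closedBall_mem_nhds y₀ hδ] with y hy
  obtain ⟨H, hH, e⟩ := hext y (hδI hy)
  rw [← e z hzU, ← e₀ z hzU]
  -- The extensions at `y` and `y₀` are entire, so the maximum principle carries the estimate for
  -- their difference from the sphere into the ball, uniformly up to `a`.
  refine Complex.norm_le_of_forall_mem_frontier_norm_le (f := fun z => H z - H₀ z)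
    (U := ball a ρ) isBounded_ball (hH.sub hH₀).diffContOnCl (fun w hw => ?_)
    (subset_closure hz)
  rw [frontier_ball a hρ.ne'] at hw
  simp only [e w (hsph hw), e₀ w (hsph hw)]
  exact hlip w hw y hy

end ParameterDerivative

/-! ### Divisibility of polynomials from bounds -/

section Divisibility

open Polynomial Filter Topology Asymptotics

/-- The bound forces a root at `a`, and dividing by `z - a` lowers the exponent in the bound by one.
-/
theorem X_sub_C_pow_dvd_of_isBigO {a : ℝ} {k : ℕ} {f : ℝ[X]}
    (h : (fun z : ℂ => aeval z f) =O[𝓝[≠] (a : ℂ)] fun z => (z - a) ^ k) :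
    (X - C a) ^ k ∣ f := by
  induction k generalizing f with
  | zero => simp
  | succ k ih =>
    have hc : Tendsto (fun z : ℂ => aeval z f) (𝓝[≠] (a : ℂ)) (𝓝 (aeval (a : ℂ) f)) :=
      (f.continuous_aeval.tendsto _).mono_left nhdsWithin_le_nhds
    have h0 : Tendsto (fun z : ℂ => (z - a) ^ (k + 1)) (𝓝[≠] (a : ℂ)) (𝓝 0) := by
      have : Continuous fun z : ℂ => (z - a) ^ (k + 1) := by fun_prop
      have := (this.tendsto (a : ℂ)).mono_left (nhdsWithin_le_nhds (s := {(a : ℂ)}ᶜ))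
      simpa using this
    have hz : aeval (a : ℂ) f = 0 := tendsto_nhds_unique hc (h.trans_tendsto h0)
    have hroot : f.IsRoot a := by
      have : aeval (a : ℂ) f = ((f.eval a : ℝ) : ℂ) := by
        rw [show (a : ℂ) = algebraMap ℝ ℂ a from rfl, aeval_algebraMap_apply]; rfl
      rw [this] at hz
      exact_mod_cast hz
    obtain ⟨g, rfl⟩ := dvd_iff_isRoot.2 hroot
    rw [pow_succ']
    refine mul_dvd_mul_left _ (ih ?_)
    obtain ⟨c, hc⟩ := h.bound
    refine IsBigO.of_bound c ?_
    filter_upwards [hc, self_mem_nhdsWithin] with z hz hza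
    have hpos : 0 < ‖z - (a : ℂ)‖ := norm_pos_iff.2 (sub_ne_zero.2 hza)
    have e : aeval z (X - C a) = z - (a : ℂ) := by simp
    rw [map_mul, e, norm_mul, pow_succ', norm_mul, mul_left_comm] at hz
    exact le_of_mul_le_mul_left hz hpos

end Divisibility

/-! ### Gauge transformations by simple elements -/

section Gauge

open Polynomial Filter Topology Asymptotics

variable {n : ℕ}

theorem gNum_map {R R' : Type} [CommRing R] [CommRing R'] (f : R →+* R') (u v : R)
    (p p' : Mat n R) :
    (gNum u v p p').map f = gNum (f u) (f v) (p.map f) (p'.map f) := by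
  ext i j
  simp [gNum, Matrix.one_apply, apply_ite f]

/-- The numerator of `gLin`. -/
def gLinNum {R : Type} [CommRing R] (u v : R) (p p' : Mat n R) : Mat n R :=
  (u * u) • p - (u * v) • (p + p') + (v * v) • p'

theorem gLinNum_map {R R' : Type} [CommRing R] [CommRing R'] (f : R →+* R') (u v : R)
    (p p' : Mat n R) :
    (gLinNum u v p p').map f = gLinNum (f u) (f v) (p.map f) (p'.map f) := by
  ext i j
  simp [gLinNum]

theorem smul_gLin {K : Type} [Field K] {a₁ a₂ z : K} (p : Mat n K) (h₁ : z ≠ a₁) (h₂ : z ≠ a₂) :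
    ((z - a₁) * (z - a₂)) • gLin (rat a₁ a₂ z) p = gLinNum (z - a₁) (z - a₂) p (sharp p) := by
  have h₁' := sub_ne_zero.2 h₁
  have h₂' := sub_ne_zero.2 h₂
  have e₁ : (z - a₁) * (z - a₂) * (rat a₁ a₂ z)⁻¹ = (z - a₁) * (z - a₁) := by
    rw [rat]; field_simp
  have e₂ : (z - a₁) * (z - a₂) * rat a₁ a₂ z = (z - a₂) * (z - a₂) := by
    rw [rat]; field_simp
  rw [gLin, gLinNum, smul_add, smul_sub, smul_smul, smul_smul, e₁, e₂]

/-- The numerator of the gauge transform `g Q g⁻¹ - g' g⁻¹` as a polynomial matrix. -/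
def gaugeNum (a₁ a₂ : ℝ) (p p' : Mat n ℝ) (Q : Mat n ℝ[X]) : Mat n ℝ[X] :=
  gNum (X - C a₁) (X - C a₂) (p.map C) ((sharp p).map C) * Q
      * gNum (X - C a₁) (X - C a₂) ((sharp p).map C) (p.map C)
    - gLinNum (X - C a₁) (X - C a₂) (p'.map C) ((sharp p').map C)
      * gNum (X - C a₁) (X - C a₂) ((sharp p).map C) (p.map C)

/-- The gauge transform `g Q g⁻¹ - g' g⁻¹` over a field extension of `ℝ`. -/
def gauge {K : Type} [Field K] [Algebra ℝ K] (a₁ a₂ : ℝ) (p p' : Mat n ℝ) (Q : Mat n ℝ[X])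
    (z : K) : Mat n K :=
  gElt (algebraMap ℝ K a₁) (algebraMap ℝ K a₂) (p.map (algebraMap ℝ K)) z * Q.map (aeval z)
      * gElt (algebraMap ℝ K a₁) (algebraMap ℝ K a₂) ((sharp p).map (algebraMap ℝ K)) z
    - gLin (rat (algebraMap ℝ K a₁) (algebraMap ℝ K a₂) z) (p'.map (algebraMap ℝ K))
      * gElt (algebraMap ℝ K a₁) (algebraMap ℝ K a₂) ((sharp p).map (algebraMap ℝ K)) z

/-- Each of `g`, `g'`, `g⁻¹` has at most simple poles at the two parameters, so the square of `(z -
a₁)(z - a₂)` clears the denominators. The field is arbitrary because the identity is needed both at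
complex numbers, for frames, and at the formal `lam`, for the expansion at infinity. -/
theorem smul_gauge {K : Type} [Field K] [Algebra ℝ K] {a₁ a₂ : ℝ} {p : Mat n ℝ} (hp : IsoProj p)
    (p' : Mat n ℝ) (Q : Mat n ℝ[X]) {z : K} (h₁ : z ≠ algebraMap ℝ K a₁)
    (h₂ : z ≠ algebraMap ℝ K a₂) :
    (((z - algebraMap ℝ K a₁) * (z - algebraMap ℝ K a₂))
      * ((z - algebraMap ℝ K a₁) * (z - algebraMap ℝ K a₂))) • gauge a₁ a₂ p p' Q z
      = (gaugeNum a₁ a₂ p p' Q).map (aeval z) := by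
  have hc : ∀ A : Mat n ℝ, (A.map C).map (aeval z : ℝ[X] →ₐ[ℝ] K).toRingHom
      = A.map (algebraMap ℝ K) := fun A => by ext; simp
  have hx : ∀ a : ℝ, (aeval z : ℝ[X] →ₐ[ℝ] K).toRingHom (X - C a) = z - algebraMap ℝ K a :=
    fun a => by simp
  have e₁ := smul_gElt (hp.map (algebraMap ℝ K)) h₁ h₂
  have e₂ := smul_gElt (hp.sharp.map (algebraMap ℝ K)) h₁ h₂
  have e₃ := smul_gLin (p'.map (algebraMap ℝ K)) h₁ h₂
  simp only [sharp_map, sharp_sharp] at e₁ e₂ e₃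
  have e : (gaugeNum a₁ a₂ p p' Q).map (aeval z)
      = (gaugeNum a₁ a₂ p p' Q).map (aeval z : ℝ[X] →ₐ[ℝ] K).toRingHom := rfl
  have hs : ∀ (c : K) (A B D G G' : Mat n K), (c * c) • (A * B * D - G * D)
      = (c • A) * B * (c • D) - (c • G) * (c • D) := by
    intro c A B D G G'
    simp only [Matrix.smul_mul, Matrix.mul_smul, smul_sub, smul_smul]
  rw [e, gaugeNum, gauge, hs _ _ _ _ _ 0, e₁, e₂, e₃,
    Matrix.map_sub _ (map_sub (aeval z : ℝ[X] →ₐ[ℝ] K).toRingHom)]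
  simp only [Matrix.map_mul, gNum_map, gLinNum_map, hc, hx]
  rfl

/-- A gauge transform without poles is a polynomial. -/
theorem exists_poly_of_gauge_isBigO {a₁ a₂ : ℝ} (ha : a₁ ≠ a₂) {p : Mat n ℝ} (hp : IsoProj p)
    (p' : Mat n ℝ) (Q : Mat n ℝ[X])
    (h₁ : ∀ i j, (fun z : ℂ => gauge a₁ a₂ p p' Q z i j) =O[𝓝[≠] (a₁ : ℂ)] fun _ => (1 : ℂ))
    (h₂ : ∀ i j, (fun z : ℂ => gauge a₁ a₂ p p' Q z i j) =O[𝓝[≠] (a₂ : ℂ)] fun _ => (1 : ℂ)) :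
    ∃ B : Mat n ℝ[X], ∀ (K : Type) [Field K] [Algebra ℝ K] (z : K), z ≠ algebraMap ℝ K a₁ →
      z ≠ algebraMap ℝ K a₂ → gauge a₁ a₂ p p' Q z = B.map (aeval z) := by
  have ha' : (a₁ : ℂ) ≠ a₂ := by exact_mod_cast ha
  have hO : ∀ (c d : ℝ), (fun z : ℂ => (z - d) * (z - d)) =O[𝓝[≠] (c : ℂ)] fun _ => (1 : ℂ) := by
    intro c d
    have : Continuous fun z : ℂ => (z - d) * (z - d) := by fun_prop
    exact ((this.tendsto (c : ℂ)).mono_left nhdsWithin_le_nhds).isBigO_one ℂ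
  have hev : ∀ z : ℂ, z ≠ a₁ → z ≠ a₂ → ∀ i j, aeval z (gaugeNum a₁ a₂ p p' Q i j)
      = ((z - a₁) * (z - a₁)) * (((z - a₂) * (z - a₂)) * gauge a₁ a₂ p p' Q z i j) := by
    intro z hz₁ hz₂ i j
    have := congrFun (congrFun (smul_gauge hp p' Q hz₁ hz₂) i) j
    rw [Matrix.map_apply] at this
    rw [← this, Matrix.smul_apply, smul_eq_mul]
    simp only [Complex.coe_algebraMap]
    ring
  -- Boundedness of the quotient near a parameter forces the numerator to contain the squared linear
  -- factor. The two squares are coprime, so their product divides as well.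
  have hd : ∀ i j, ∃ f, gaugeNum a₁ a₂ p p' Q i j = (X - C a₁) ^ 2 * (X - C a₂) ^ 2 * f := by
    intro i j
    refine IsCoprime.mul_dvd (IsCoprime.pow ?_) (X_sub_C_pow_dvd_of_isBigO ?_)
      (X_sub_C_pow_dvd_of_isBigO ?_)
    · exact isCoprime_X_sub_C_of_isUnit_sub (sub_ne_zero.2 ha).isUnit
    · have h := (isBigO_refl (fun z : ℂ => (z - a₁) * (z - a₁)) (𝓝[≠] (a₁ : ℂ))).mul
        ((hO a₁ a₂).mul (h₁ i j))
      refine h.congr' ?_ (Eventually.of_forall fun z => ?_)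
      · filter_upwards [self_mem_nhdsWithin,
          nhdsWithin_le_nhds (isOpen_ne.mem_nhds ha')] with z hz hz'
        exact (hev z hz hz' i j).symm
      · simp [sq]
    · have h := (isBigO_refl (fun z : ℂ => (z - a₂) * (z - a₂)) (𝓝[≠] (a₂ : ℂ))).mul
        ((hO a₂ a₁).mul (h₂ i j))
      refine h.congr' ?_ (Eventually.of_forall fun z => ?_)
      · filter_upwards [self_mem_nhdsWithin,
          nhdsWithin_le_nhds (isOpen_ne.mem_nhds ha'.symm)] with z hz hz'
        rw [hev z hz' hz i j]; ring
      · simp [sq]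
  choose f hf using hd
  refine ⟨Matrix.of f, fun K _ _ z hz₁ hz₂ => ?_⟩
  have h := smul_gauge hp p' Q hz₁ hz₂
  ext i j
  have hij := congrFun (congrFun h i) j
  rw [Matrix.map_apply, hf, Matrix.smul_apply, smul_eq_mul] at hij
  simp only [map_mul, map_pow, map_sub, aeval_X, aeval_C] at hij
  have hz₁' := sub_ne_zero.2 hz₁
  have hz₂' := sub_ne_zero.2 hz₂
  refine mul_left_cancel₀ (mul_ne_zero (mul_ne_zero hz₁' hz₂') (mul_ne_zero hz₁' hz₂')) ?_
  rw [hij, Matrix.map_apply, Matrix.of_apply]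
  ring

/-- By the product rule, with `g⁻¹ = g_{sharp p}`. The derivative of this inverse is eliminated by
differentiating `g g⁻¹ = 1` (`hz`), and this produces the term `- g' g⁻¹` of `gauge`. -/
theorem hasEntryDeriv_dressed {F : ℝ → ℂ → Mat n ℂ} {p : ℝ → Mat n ℝ} {p' : Mat n ℝ} {y₀ : ℝ}
    {a₁ a₂ : ℝ} (A : Mat n ℂ) {Q : Mat n ℝ[X]} {z : ℂ} (h₁ : z ≠ a₁) (h₂ : z ≠ a₂)
    (hF : HasEntryDeriv (fun y => F y z) (F y₀ z * polyC z Q) y₀)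
    (hp : HasEntryDeriv p p' y₀) (hiso : ∀ᶠ y in 𝓝 y₀, IsoProj (p y)) :
    HasEntryDeriv (fun y => A * F y z * gC a₁ a₂ (sharp (p y)) z)
      (A * F y₀ z * gC a₁ a₂ (sharp (p y₀)) z * gauge a₁ a₂ (p y₀) p' Q z) y₀ := by
  have key : ∀ {s : ℝ → Mat n ℝ} {s' : Mat n ℝ}, HasEntryDeriv s s' y₀ →
      (∀ᶠ y in 𝓝 y₀, IsoProj (s y)) → HasEntryDeriv (fun y => gC a₁ a₂ (s y) z)
        (BKdV.gLin (rat (a₁ : ℂ) a₂ z) (BKdV.toC s')) y₀ := by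
    intro s s' hs hi
    refine ((hs.toC.gLin (rat (a₁ : ℂ) a₂ z)).const_add 1).congr ?_
    filter_upwards [hi] with y hy
    exact gElt_eq_gLin (hy.map Complex.ofRealHom) h₁ h₂
  have hiso' : ∀ᶠ y in 𝓝 y₀, IsoProj (sharp (p y)) := hiso.mono fun y hy => hy.sharp
  have hg := key hp hiso
  have hg' := key hp.sharp hiso'
  have i₁ : ∀ᶠ y in 𝓝 y₀, gC a₁ a₂ (p y) z * gC a₁ a₂ (sharp (p y)) z = 1 := by
    filter_upwards [hiso] with y hy
    have := gElt_mul_sharp (hy.map Complex.ofRealHom) h₁ h₂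
    rwa [sharp_map] at this
  have i₂ := mul_eq_one_comm.1 i₁.self_of_nhds
  have hz := ((hg.mul hg').congr (i₁.mono fun y hy => hy.symm)).unique (hasEntryDeriv_const 1 y₀)
  have hfin := ((hasEntryDeriv_const A y₀).mul hF).mul hg'
  have e : gauge a₁ a₂ (p y₀) p' Q z
      = gC a₁ a₂ (p y₀) z * polyC z Q * gC a₁ a₂ (sharp (p y₀)) z
        - BKdV.gLin (rat (a₁ : ℂ) a₂ z) (BKdV.toC p') * gC a₁ a₂ (sharp (p y₀)) z := rfl
  rw [e, eq_neg_of_add_eq_zero_left hz]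
  convert hfin using 1
  generalize gC a₁ a₂ (p y₀) z = g at *
  generalize gC a₁ a₂ (sharp (p y₀)) z = g' at *
  generalize BKdV.gLin (rat (a₁ : ℂ) a₂ z) (BKdV.toC (sharp p')) = D
  have c : ∀ M, g' * (g * M) = M := fun M => by rw [← mul_assoc, i₂, one_mul]
  simp only [sub_neg_eq_add, mul_assoc, c, zero_mul, zero_add, mul_add]

/-- The logarithmic derivative of a dressed frame that stays entire is a polynomial. -/
theorem exists_poly_gauge {S : Set ℂ} (hS : S.Finite) {a₁ a₂ : ℝ} (ha : a₁ ≠ a₂)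
    {I : Set ℝ} (hI : IsOpen I) {y₀ : ℝ}
    (hy₀ : y₀ ∈ I) {F : ℝ → ℂ → Mat n ℂ} {p : ℝ → Mat n ℝ} {π p' : Mat n ℝ} (hπ : IsoProj π)
    (horth : ∀ y ∈ I, ∀ z ∉ S, sharp (F y z) * F y z = 1)
    (hiso : ∀ y ∈ I, IsoProj (p y)) (hp : HasEntryDeriv p p' y₀)
    (hdress : ∀ a b, ContDiffOn ℝ ∞
      (fun w : ℝ × ℂ => (gC a₁ a₂ π w.2 * F w.1 w.2 * gC a₁ a₂ (sharp (p w.1)) w.2) a b)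
      (I ×ˢ (S ∪ {(a₁ : ℂ), (a₂ : ℂ)})ᶜ))
    {Q : Mat n ℝ[X]} (hQ : ∀ z ∉ S, HasEntryDeriv (fun y => F y z) (F y₀ z * polyC z Q) y₀)
    (hent : ∀ y ∈ I, ∃ H : ℂ → Mat n ℂ, EntireM H ∧ ∀ z, z ∉ S ∪ {(a₁ : ℂ), (a₂ : ℂ)} →
      H z = gC a₁ a₂ π z * F y z * gC a₁ a₂ (sharp (p y)) z) :
    ∃ B : Mat n ℝ[X], (∀ z, z ∉ S ∪ {(a₁ : ℂ), (a₂ : ℂ)} →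
        HasEntryDeriv (fun y => gC a₁ a₂ π z * F y z * gC a₁ a₂ (sharp (p y)) z)
          (gC a₁ a₂ π z * F y₀ z * gC a₁ a₂ (sharp (p y₀)) z * polyC z B) y₀) ∧
      polyL B = gL a₁ a₂ (p y₀) * polyL Q * gL a₁ a₂ (sharp (p y₀))
        - gLin (ratL a₁ a₂) (cst p') * gL a₁ a₂ (sharp (p y₀)) := by
  set T : Set ℂ := S ∪ {(a₁ : ℂ), (a₂ : ℂ)} with hT
  have hTfin : T.Finite := hS.union (by simp)
  have hT1 : ∀ z, z ∉ T → z ∉ S := fun z hz h => hz (Or.inl h)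
  have hT2 : ∀ z, z ∉ T → z ≠ a₁ := fun z hz h => hz (Or.inr (Or.inl h))
  have hT3 : ∀ z, z ∉ T → z ≠ a₂ := fun z hz h => hz (Or.inr (Or.inr h))
  have hiso0 : ∀ᶠ y in 𝓝 y₀, IsoProj (p y) := by
    filter_upwards [hI.mem_nhds hy₀] with y hy using hiso y hy
  have hder : ∀ z, z ∉ T → HasEntryDeriv (fun y => gC a₁ a₂ π z * F y z * gC a₁ a₂ (sharp (p y)) z)
      (gC a₁ a₂ π z * F y₀ z * gC a₁ a₂ (sharp (p y₀)) z * gauge a₁ a₂ (p y₀) p' Q z) y₀ :=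
    fun z hz => hasEntryDeriv_dressed _ (hT2 z hz) (hT3 z hz) (hQ z (hT1 z hz)) hp hiso0
  set Φ : ℝ → ℂ → Mat n ℂ := fun y z => gC a₁ a₂ π z * F y z * gC a₁ a₂ (sharp (p y)) z with hΦ
  have hortho : ∀ z, z ∉ T → sharp (Φ y₀ z) * Φ y₀ z = 1 := by
    intro z hz
    have s₁ : sharp (gC a₁ a₂ π z) = gC a₁ a₂ (sharp π) z := by
      have := sharp_gElt (hπ.map Complex.ofRealHom) (hT2 z hz) (hT3 z hz)
      rwa [sharp_map] at this
    have s₂ : sharp (gC a₁ a₂ (sharp (p y₀)) z) = gC a₁ a₂ (p y₀) z := by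
      have := sharp_gElt ((hiso y₀ hy₀).sharp.map Complex.ofRealHom) (hT2 z hz) (hT3 z hz)
      rwa [sharp_map, sharp_sharp] at this
    have m₁ : gC a₁ a₂ (sharp π) z * gC a₁ a₂ π z = 1 := by
      have := gElt_sharp_mul (hπ.map Complex.ofRealHom) (hT2 z hz) (hT3 z hz)
      rwa [sharp_map] at this
    have m₂ : gC a₁ a₂ (p y₀) z * gC a₁ a₂ (sharp (p y₀)) z = 1 := by
      have := gElt_mul_sharp ((hiso y₀ hy₀).map Complex.ofRealHom) (hT2 z hz) (hT3 z hz)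
      rwa [sharp_map] at this
    simp only [hΦ, sharp_mul, s₁, s₂]
    calc _ = gC a₁ a₂ (p y₀) z * (sharp (F y₀ z) * (gC a₁ a₂ (sharp π) z * gC a₁ a₂ π z)
          * F y₀ z) * gC a₁ a₂ (sharp (p y₀)) z := by simp only [mul_assoc]
      _ = 1 := by rw [m₁, mul_one, horth y₀ hy₀ z (hT1 z hz), mul_one, m₂]
  obtain ⟨H, hH, eH⟩ := hent y₀ hy₀
  -- The gauge transform is `sharp Φ * (Φ * gauge)`. The second factor is the parameter derivative
  -- of `Φ`, bounded by the maximum principle; the first agrees off `T` with the adjoint of an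
  -- entire map.
  have hbig : ∀ a : ℂ, a ∈ T → ∀ i j,
      (fun z : ℂ => gauge a₁ a₂ (p y₀) p' Q z i j) =O[𝓝[≠] a] fun _ => (1 : ℂ) := by
    intro a haT
    have hnear : (T \ {a})ᶜ ∈ 𝓝 a :=
      (hTfin.subset Set.sdiff_subset).isClosed.isOpen_compl.mem_nhds (by simp)
    obtain ⟨ρ, hρ, hρT⟩ := Metric.nhds_basis_closedBall.mem_iff.1 hnear
    have hsub : Metric.closedBall a ρ \ {a} ⊆ Tᶜ := by
      rintro z ⟨hz, hza⟩ hzT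
      exact hρT hz ⟨hzT, hza⟩
    have hevT : ∀ᶠ z in 𝓝[≠] a, z ∉ T := by
      filter_upwards [self_mem_nhdsWithin,
        nhdsWithin_le_nhds (Metric.closedBall_mem_nhds a hρ)] with z hz hz'
      exact hsub ⟨hz', hz⟩
    have hb : ∀ i j, (fun z => (Φ y₀ z * gauge a₁ a₂ (p y₀) p' Q z) i j)
        =O[𝓝[≠] a] fun _ => (1 : ℂ) := by
      intro i j
      obtain ⟨c, hc⟩ := exists_bound_deriv_of_entire (f := fun y z => Φ y z i j) hI
        hTfin.isClosed.isOpen_compl (hdress i j) hy₀ hρ hsub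
        (fun y hy => by
          obtain ⟨H, hH, e⟩ := hent y hy
          exact ⟨fun z => H z i j, hH i j, fun z hz => congrFun (congrFun (e z hz) i) j⟩)
        (fun z hz => hder z hz i j)
      refine IsBigO.of_bound c ?_
      filter_upwards [self_mem_nhdsWithin,
        nhdsWithin_le_nhds (Metric.ball_mem_nhds a hρ)] with z hz hz'
      simpa using hc z hz' hz
    have hbs : ∀ i j, (fun z => sharp (Φ y₀ z) i j) =O[𝓝[≠] a] fun _ => (1 : ℂ) := by
      intro i j
      have h1 : (fun z => sharp (H z) i j) =O[𝓝[≠] a] fun _ => (1 : ℂ) :=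
        (((hH.sharp i j).continuous.tendsto a).mono_left nhdsWithin_le_nhds).isBigO_one ℂ
      refine h1.congr' ?_ EventuallyEq.rfl
      filter_upwards [hevT] with z hz
      rw [eH z hz]
    intro i j
    have h1 : (fun z => ∑ c, sharp (Φ y₀ z) i c * (Φ y₀ z * gauge a₁ a₂ (p y₀) p' Q z) c j)
        =O[𝓝[≠] a] fun _ => (1 : ℂ) := by
      refine IsBigO.fun_sum fun c _ => ?_
      simpa using (hbs i c).mul (hb c j)
    refine h1.congr' ?_ EventuallyEq.rfl
    filter_upwards [hevT] with z hz
    rw [← Matrix.mul_apply, ← mul_assoc, hortho z hz, one_mul]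
  obtain ⟨B, hB⟩ := exists_poly_of_gauge_isBigO ha (hiso y₀ hy₀) p' Q
    (hbig a₁ (by simp [hT])) (hbig a₂ (by simp [hT]))
  refine ⟨B, fun z hz => ?_, ?_⟩
  · have := hder z hz
    rwa [hB ℂ z (hT2 z hz) (hT3 z hz)] at this
  -- The same polynomial identity at the formal spectral parameter is the expansion at infinity.
  · exact (hB (LaurentSeries ℝ) lam (lam_ne a₁) (lam_ne a₂)).symm

end Gauge

/-! ### Smooth matrix functions -/

section SmoothM

variable {n : ℕ} {E : Type} [NormedAddCommGroup E] [NormedSpace ℝ E] {K : Type} [RCLike K]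

/-- Entrywise smooth matrix functions. -/
def SmoothM (f : E → Mat n K) (s : Set E) : Prop :=
  ∀ a b, ContDiffOn ℝ ∞ (fun w => f w a b) s

variable {f g : E → Mat n K} {s : Set E}

theorem smoothM_const (A : Mat n K) : SmoothM (fun _ : E => A) s := fun _ _ => contDiffOn_const

theorem SmoothM.mul (hf : SmoothM f s) (hg : SmoothM g s) : SmoothM (fun w => f w * g w) s := by
  intro a b
  simp only [Matrix.mul_apply]
  exact ContDiffOn.sum fun c _ => (hf a c).mul (hg c b)

theorem SmoothM.add (hf : SmoothM f s) (hg : SmoothM g s) : SmoothM (fun w => f w + g w) s :=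
  fun a b => (hf a b).add (hg a b)

theorem SmoothM.sub (hf : SmoothM f s) (hg : SmoothM g s) : SmoothM (fun w => f w - g w) s :=
  fun a b => (hf a b).sub (hg a b)

theorem SmoothM.smul {c : E → K} (hc : ContDiffOn ℝ ∞ c s) (hf : SmoothM f s) :
    SmoothM (fun w => c w • f w) s := fun a b => hc.mul (hf a b)

theorem SmoothM.sharp (hf : SmoothM f s) : SmoothM (fun w => sharp (f w)) s := by
  intro a b
  simp only [sharp_apply]
  exact contDiffOn_const.mul (hf _ _)

theorem SmoothM.sum {ι : Type} {u : Finset ι} {F : ι → E → Mat n K}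
    (h : ∀ i ∈ u, SmoothM (F i) s) : SmoothM (fun w => ∑ i ∈ u, F i w) s := by
  intro a b
  simp only [Matrix.sum_apply]
  exact ContDiffOn.sum fun i hi => h i hi a b

theorem SmoothM.congr (hf : SmoothM f s) (h : ∀ w ∈ s, g w = f w) : SmoothM g s :=
  fun a b => (hf a b).congr fun w hw => by rw [h w hw]

theorem SmoothM.comp {E' : Type} [NormedAddCommGroup E'] [NormedSpace ℝ E'] {φ : E' → E}
    {s' : Set E'} (hf : SmoothM f s) (hφ : ContDiff ℝ ∞ φ) (h : Set.MapsTo φ s' s) :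
    SmoothM (fun w => f (φ w)) s' :=
  fun a b => (hf a b).comp hφ.contDiffOn h

theorem SmoothM.toC {f : E → Mat n ℝ} (hf : SmoothM f s) : SmoothM (fun w => toC (f w)) s :=
  fun a b => Complex.ofRealCLM.contDiff.comp_contDiffOn (hf a b)

theorem SmoothM.det (hf : SmoothM f s) : ContDiffOn ℝ ∞ (fun w => (f w).det) s := by
  simp only [Matrix.det_apply']
  exact ContDiffOn.sum fun σ _ => contDiffOn_const.mul (contDiffOn_prod fun i _ => hf _ _)

theorem SmoothM.inv (hf : SmoothM f s) (h : ∀ w ∈ s, (f w).det ≠ 0) :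
    SmoothM (fun w => (f w)⁻¹) s := by
  intro a b
  simp only [Matrix.inv_def, Ring.inverse_eq_inv', Matrix.smul_apply, smul_eq_mul,
    Matrix.adjugate_apply]
  refine (hf.det.inv h).mul (SmoothM.det (f := fun w => (f w).updateRow b (Pi.single a 1)) ?_)
  intro c d
  by_cases hc : c = b
  · subst hc
    simp only [Matrix.updateRow_self]
    exact contDiffOn_const
  · simp only [Matrix.updateRow_ne hc]
    exact hf c d

theorem SmoothM.gC {p : E → Mat n ℝ} {ζ : E → ℂ} {a₁ a₂ : ℝ} (hp : SmoothM p s)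
    (hiso : ∀ w ∈ s, IsoProj (p w)) (hζ : ContDiffOn ℝ ∞ ζ s) (h₁ : ∀ w ∈ s, ζ w ≠ a₁)
    (h₂ : ∀ w ∈ s, ζ w ≠ a₂) : SmoothM (fun w => gC a₁ a₂ (p w) (ζ w)) s := by
  have hr : ∀ c d : ℝ, (∀ w ∈ s, ζ w ≠ c) → ContDiffOn ℝ ∞ (fun w => rat (c : ℂ) d (ζ w)) s :=
    fun c d h => ((hζ.sub contDiffOn_const).mul ((hζ.sub contDiffOn_const).inv
      fun w hw => sub_ne_zero.2 (h w hw))).congr fun w _ => div_eq_mul_inv _ _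
  have h : SmoothM (fun w => rat (a₂ : ℂ) a₁ (ζ w) • BKdV.toC (p w)
      + (1 - BKdV.toC (p w) - BKdV.sharp (BKdV.toC (p w)))
      + rat (a₁ : ℂ) a₂ (ζ w) • BKdV.sharp (BKdV.toC (p w))) s :=
    ((SmoothM.smul (hr _ _ h₂) hp.toC).add (((smoothM_const 1).sub hp.toC).sub hp.toC.sharp)).add
      (SmoothM.smul (hr _ _ h₁) hp.toC.sharp)
  refine h.congr fun w hw => ?_
  have e : (rat (a₁ : ℂ) a₂ (ζ w))⁻¹ = rat (a₂ : ℂ) a₁ (ζ w) := by simp [rat]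
  rw [← e]
  exact gElt_eq ((hiso w hw).map Complex.ofRealHom) (h₁ w hw) (h₂ w hw)

/-- Smooth families of series of bounded degree. -/
def SmoothLam (f : E → Mat n (LaurentSeries ℝ)) (s : Set E) : Prop :=
  (∃ d : ℤ, ∀ w ∈ s, DegLE d (f w)) ∧ ∀ i, SmoothM (fun w => lamCoeff (f w) i) s

theorem SmoothLam.mul {f g : E → Mat n (LaurentSeries ℝ)} (hf : SmoothLam f s)
    (hg : SmoothLam g s) : SmoothLam (fun w => f w * g w) s := by
  obtain ⟨⟨d, hd⟩, hf⟩ := hf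
  obtain ⟨⟨e, he⟩, hg⟩ := hg
  refine ⟨⟨d + e, fun w hw => (hd w hw).mul (he w hw)⟩, fun i => ?_⟩
  refine (SmoothM.sum (u := Finset.Icc (i - e) d) fun m _ => (hf m).mul (hg (i - m))).congr ?_
  intro w hw
  exact lamCoeff_mul (hd w hw) (he w hw) i

theorem SmoothLam.pow {f : E → Mat n (LaurentSeries ℝ)} (hf : SmoothLam f s) (k : ℕ) :
    SmoothLam (fun w => f w ^ k) s := by
  induction k with
  | zero =>
    refine ⟨⟨0, fun w _ => ?_⟩, fun i => ?_⟩
    · simp only [pow_zero]; rw [← cst_one]; exact degLE_cst _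
    · simp only [pow_zero]; exact smoothM_const _
  | succ k ih =>
    simp only [pow_succ]
    exact ih.mul hf

theorem SmoothM.smoothLam_gL {p : E → Mat n ℝ} (a₁ a₂ : ℝ) (hp : SmoothM p s)
    (hiso : ∀ w ∈ s, IsoProj (p w)) : SmoothLam (fun w => gL a₁ a₂ (p w)) s := by
  refine ⟨⟨0, fun w hw => degLE_gL (hiso w hw)⟩, fun i => ?_⟩
  have h : SmoothM (fun w => lamCoeff (1 : Mat n (LaurentSeries ℝ)) i
      + ((ratL a₂ a₁).coeff (-i) • p w - (if i = 0 then p w + BKdV.sharp (p w) else 0)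
      + (ratL a₁ a₂).coeff (-i) • BKdV.sharp (p w))) s := by
    refine (smoothM_const _).add (((SmoothM.smul contDiffOn_const hp).sub ?_).add
      (SmoothM.smul contDiffOn_const hp.sharp))
    split_ifs
    · exact hp.add hp.sharp
    · exact smoothM_const 0
  refine h.congr fun w hw => ?_
  beta_reduce
  rw [gL_eq (hiso w hw), lamCoeff_add, lamCoeff_gLin]

end SmoothM

/-! ### Equality of mixed partial derivatives and zero curvature -/

section ZeroCurvature

variable {n : ℕ}

theorem mixed_deriv_eq {Ω : Set (ℝ × ℝ)} (hΩ : IsOpen Ω) {f fx ft : ℝ → ℝ → ℂ}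
    (hf : ContDiffOn ℝ ∞ (fun w : ℝ × ℝ => f w.1 w.2) Ω)
    (hx : ∀ x t, (x, t) ∈ Ω → HasDerivAt (fun y => f y t) (fx x t) x)
    (ht : ∀ x t, (x, t) ∈ Ω → HasDerivAt (fun s => f x s) (ft x t) t)
    {x t : ℝ} (hxt : (x, t) ∈ Ω) {A B : ℂ} (hA : HasDerivAt (fun s => fx x s) A t)
    (hB : HasDerivAt (fun y => ft y t) B x) : A = B := by
  set f' := fderiv ℝ (fun w : ℝ × ℝ => f w.1 w.2) with hf'
  have hfd : ∀ w ∈ Ω, HasFDerivAt (fun w : ℝ × ℝ => f w.1 w.2) (f' w) w := fun w hw =>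
    ((hf.contDiffAt (hΩ.mem_nhds hw)).differentiableAt (by simp)).hasFDerivAt
  have ex : ∀ x t, (x, t) ∈ Ω → fx x t = f' (x, t) (1, 0) := fun x t h =>
    (hx x t h).unique (HasFDerivAt.comp_hasDerivAt (f := fun y => (y, t)) x (hfd (x, t) h)
      ((hasDerivAt_id' x).prodMk (hasDerivAt_const x t)))
  have et : ∀ x t, (x, t) ∈ Ω → ft x t = f' (x, t) (0, 1) := fun x t h =>
    (ht x t h).unique (HasFDerivAt.comp_hasDerivAt (f := fun s => (x, s)) t (hfd (x, t) h)
      ((hasDerivAt_const t x).prodMk (hasDerivAt_id' t)))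
  have hcd : ContDiffAt ℝ ∞ (fun w : ℝ × ℝ => f w.1 w.2) (x, t) :=
    hf.contDiffAt (hΩ.mem_nhds hxt)
  have h2 : (2 : WithTop ℕ∞) ≤ ∞ :=
    WithTop.coe_le_coe.2 (le_top : (2 : ℕ∞) ≤ ⊤)
  have hsym : IsSymmSndFDerivAt ℝ (fun w : ℝ × ℝ => f w.1 w.2) (x, t) :=
    hcd.isSymmSndFDerivAt (by simpa using h2)
  have hdd : HasFDerivAt f' (fderiv ℝ f' (x, t)) (x, t) :=
    ((hcd.fderiv_right (m := 1) (by rwa [one_add_one_eq_two])).differentiableAt (by simp)).hasFDerivAt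
  have h1 : HasDerivAt (fun s => f' (x, s) (1, 0)) (fderiv ℝ f' (x, t) (0, 1) (1, 0)) t := by
    have := HasFDerivAt.comp_hasDerivAt (f := fun s => (x, s)) t hdd
      ((hasDerivAt_const t x).prodMk (hasDerivAt_id' t))
    simpa using this.clm_apply (hasDerivAt_const t ((1 : ℝ), (0 : ℝ)))
  have h2 : HasDerivAt (fun y => f' (y, t) (0, 1)) (fderiv ℝ f' (x, t) (1, 0) (0, 1)) x := by
    have := HasFDerivAt.comp_hasDerivAt (f := fun y => (y, t)) x hdd
      ((hasDerivAt_id' x).prodMk (hasDerivAt_const x t))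
    simpa using this.clm_apply (hasDerivAt_const x ((0 : ℝ), (1 : ℝ)))
  have n1 : ∀ᶠ s in nhds t, (x, s) ∈ Ω :=
    (Continuous.prodMk_right x).continuousAt.eventually (hΩ.mem_nhds hxt)
  have n2 : ∀ᶠ y in nhds x, (y, t) ∈ Ω :=
    (Continuous.prodMk_left t).continuousAt.eventually (hΩ.mem_nhds hxt)
  have g1 := hA.unique (h1.congr_of_eventuallyEq (n1.mono fun s hs => ex x s hs))
  have g2 := hB.unique (h2.congr_of_eventuallyEq (n2.mono fun y hy => et y t hy))
  rw [g1, g2]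
  exact hsym _ _

theorem SmoothM.hasEntryDeriv_fst {K : Type} [RCLike K] {Ω : Set (ℝ × ℝ)} (hΩ : IsOpen Ω)
    {f : ℝ → ℝ → Mat n K} (hf : SmoothM (fun w : ℝ × ℝ => f w.1 w.2) Ω) {x t : ℝ}
    (h : (x, t) ∈ Ω) :
    HasEntryDeriv (fun y => f y t) (Matrix.of fun a b => deriv (fun y => f y t a b) x) x := by
  intro a b
  have h1 := ((hf a b).contDiffAt (hΩ.mem_nhds h)).differentiableAt (by simp)
  exact (h1.comp (f := fun y => (y, t)) x
    (differentiableAt_id.prodMk (differentiableAt_const t))).hasDerivAt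

theorem SmoothM.hasEntryDeriv_snd {K : Type} [RCLike K] {Ω : Set (ℝ × ℝ)} (hΩ : IsOpen Ω)
    {f : ℝ → ℝ → Mat n K} (hf : SmoothM (fun w : ℝ × ℝ => f w.1 w.2) Ω) {x t : ℝ}
    (h : (x, t) ∈ Ω) :
    HasEntryDeriv (fun s => f x s) (Matrix.of fun a b => deriv (fun s => f x s a b) t) t := by
  intro a b
  have h1 := ((hf a b).contDiffAt (hΩ.mem_nhds h)).differentiableAt (by simp)
  exact (h1.comp (f := fun s => (x, s)) t
    ((differentiableAt_const x).prodMk differentiableAt_id)).hasDerivAt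

/-- The zero curvature equation for the logarithmic derivatives of `E`. -/
theorem zero_curvature {Ω : Set (ℝ × ℝ)} (hΩ : IsOpen Ω) {E : ℝ → ℝ → Mat n ℂ}
    {X T : ℝ → ℝ → Mat n ℝ} (hE : SmoothM (fun w : ℝ × ℝ => E w.1 w.2) Ω)
    (hX : SmoothM (fun w : ℝ × ℝ => X w.1 w.2) Ω) (hT : SmoothM (fun w : ℝ × ℝ => T w.1 w.2) Ω)
    (hinv : ∀ x t, (x, t) ∈ Ω → sharp (E x t) * E x t = 1)
    (hx : ∀ x t, (x, t) ∈ Ω → HasEntryDeriv (fun y => E y t) (E x t * toC (X x t)) x)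
    (ht : ∀ x t, (x, t) ∈ Ω → HasEntryDeriv (fun s => E x s) (E x t * toC (T x t)) t)
    {x t : ℝ} (hxt : (x, t) ∈ Ω) (a b : Fin (2 * n + 1)) :
    deriv (fun s => X x s a b) t = deriv (fun y => T y t a b) x + ⁅X x t, T x t⁆ a b := by
  set Xt : Mat n ℝ := Matrix.of fun a b => deriv (fun s => X x s a b) t with hXt
  set Tx : Mat n ℝ := Matrix.of fun a b => deriv (fun y => T y t a b) x with hTx
  have h1 := (ht x t hxt).mul (hX.hasEntryDeriv_snd hΩ hxt).toC
  have h2 := (hx x t hxt).mul (hT.hasEntryDeriv_fst hΩ hxt).toC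
  -- The mixed derivative of `E` computed in both orders; the invertible factor `E` is then
  -- cancelled on the left.
  have e : E x t * toC (T x t) * toC (X x t) + E x t * toC Xt
      = E x t * toC (X x t) * toC (T x t) + E x t * toC Tx := by
    ext a b
    exact mixed_deriv_eq hΩ (hE a b) (fun x t h => hx x t h a b) (fun x t h => ht x t h a b) hxt
      (h1 a b) (h2 a b)
  have e2 := congrArg (sharp (E x t) * ·) e
  simp only [mul_add, ← mul_assoc, hinv x t hxt, one_mul] at e2
  have e3 : T x t * X x t + Xt = X x t * T x t + Tx := by
    have hm : ∀ A B D : Mat n ℝ, toC A * toC B + toC D = toC (A * B + D) := fun A B D => by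
      ext i j
      simp [toC, Matrix.mul_apply]
    rw [hm, hm] at e2
    ext i j
    exact Complex.ofReal_injective (congrFun (congrFun e2 i) j)
  have e4 : Xt = Tx + ⁅X x t, T x t⁆ := by
    rw [Ring.lie_def, eq_sub_of_add_eq' e3]; abel
  exact congrFun (congrFun e4 a) b

end ZeroCurvature

/-! ### The transformed potential -/

section Potential

variable {n : ℕ}

theorem IsSkew.lie {A B : Mat n ℝ} (hA : IsSkew A) (hB : IsSkew B) : IsSkew ⁅A, B⁆ := by
  rw [isSkew_iff] at *
  rw [Ring.lie_def, sharp_sub, sharp_mul, sharp_mul, hA, hB]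
  simp

theorem IsSkew.corner {A : Mat n ℝ} (hA : IsSkew A) : A (Fin.last (2 * n)) 0 = 0 := by
  rw [isSkew_iff] at hA
  have := congrFun (congrFun hA (Fin.last (2 * n))) 0
  rw [sharp_apply] at this
  simp only [Fin.rev_last, Fin.rev_zero, Matrix.neg_apply] at this
  have h : ((-1 : ℝ)) ^ ((Fin.last (2 * n)).val + (0 : Fin (2 * n + 1)).val) = 1 := by simp
  rw [h, one_mul] at this
  linarith

/-- Strictly below the diagonal, `β A` and `A β` involve no entry of `A` other than the lower left
corner. That corner lies on the antidiagonal, where `sharp` fixes it with sign `1`, so skewness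
makes it zero. -/
theorem lie_beta_upper {A : Mat n ℝ} (hA : IsSkew A) {i j : Fin (2 * n + 1)} (hij : j < i) :
    ⁅betaMat n, A⁆ i j = 0 := by
  have hlt : j.val < i.val := hij
  have hc : ∀ k l : Fin (2 * n + 1), k.val = 2 * n → l.val = 0 → A k l = 0 := by
    intro k l hk hl
    have h1 : k = Fin.last (2 * n) := Fin.ext hk
    have h2 : l = 0 := Fin.ext hl
    rw [h1, h2, hA.corner]
  rw [Ring.lie_def, Matrix.sub_apply, Matrix.mul_apply, Matrix.mul_apply,
    Finset.sum_eq_zero, Finset.sum_eq_zero, sub_zero]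
  · intro k _
    simp only [betaMat, Matrix.of_apply]
    split_ifs with h
    · rw [hc i k (by omega) (by omega), zero_mul]
    · rw [mul_zero]
  · intro k _
    simp only [betaMat, Matrix.of_apply]
    split_ifs with h
    · rw [hc k j (by omega) (by omega), mul_zero]
    · rw [zero_mul]

theorem isSkew_sub_sharp (p : Mat n ℝ) : IsSkew (p - sharp p) := by
  rw [isSkew_iff, sharp_sub, sharp_sharp]; abel

theorem IsBorel.backlund {q p : Mat n ℝ} (hq : IsBorel q) (hβ : IsSkew (betaMat n)) (c : ℝ) :
    IsBorel (q + c • ⁅betaMat n, p - sharp p⁆) := by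
  constructor
  · have h := hβ.lie (isSkew_sub_sharp p)
    have hq1 := hq.1
    rw [isSkew_iff] at *
    rw [sharp_add, sharp_smul, h, hq1]
    module
  · intro i j hij
    rw [Matrix.add_apply, Matrix.smul_apply, hq.2 i j hij, lie_beta_upper (isSkew_sub_sharp p) hij]
    simp

end Potential

/-! ### Transforming the resolvent -/

section Resolvent

open Polynomial

variable {n : ℕ}

theorem polyL_injective {A B : Mat n ℝ[X]} (h : polyL A = polyL B) : A = B := by
  ext i j k
  have := congrFun (congrFun (congrArg (lamCoeff · (k : ℤ)) h) i) j
  simpa only [lamCoeff_polyL, Matrix.map_apply] using this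

/-- `J_B + q` as a polynomial matrix. -/
def laxPoly (q : Mat n ℝ) : Mat n ℝ[X] :=
  (bMat n + q).map C + (X : ℝ[X]) • (betaMat n).map C

theorem polyC_laxPoly (q : Mat n ℝ) (z : ℂ) : polyC z (laxPoly q) = laxX q z := by
  ext i j
  simp only [polyC, laxPoly, laxX, toC, Matrix.map_apply, Matrix.add_apply, Matrix.smul_apply,
    smul_eq_mul, map_add, map_mul, aeval_C, aeval_X]
  rw [← map_add]; rfl

theorem lamCoeff_formalJ_add (q : Mat n ℝ) (i : ℤ) : lamCoeff (formalJ n + cst q) i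
    = (if i = 0 then bMat n + q else 0) + if i = 1 then betaMat n else 0 := by
  rw [formalJ_eq, lamCoeff_add, lamCoeff_add, lamCoeff_lam_smul, lamCoeff_cst, lamCoeff_cst,
    lamCoeff_cst]
  by_cases h0 : i = 0
  · subst h0; simp
  by_cases h1 : i = 1
  · subst h1; simp
  rw [if_neg h0, if_neg (by omega), if_neg h0, if_neg h0, if_neg h1]
  simp

theorem polyL_laxPoly (q : Mat n ℝ) : polyL (laxPoly q) = formalJ n + cst q := by
  refine lamCoeff_ext fun i => ?_
  rw [lamCoeff_formalJ_add]
  rcases lt_or_ge i 0 with hi | hi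
  · rw [lamCoeff_polyL_neg _ hi, if_neg (by omega), if_neg (by omega), add_zero]
  obtain ⟨k, rfl⟩ := Int.eq_ofNat_of_zero_le hi
  rw [lamCoeff_polyL]
  ext a b
  match k with
  | 0 => simp [laxPoly]
  | 1 => simp [laxPoly, coeff_C]
  | k + 2 =>
    rw [if_neg (by omega), if_neg (by omega)]
    simp [laxPoly]

theorem degLE_formalJ_add (q : Mat n ℝ) : DegLE 1 (formalJ n + cst q) := fun i hi => by
  rw [lamCoeff_formalJ_add, if_neg (by omega), if_neg (by omega), add_zero]

theorem lamCoeff_lie_formalJ (q : Mat n ℝ) (P : Mat n (LaurentSeries ℝ)) (i : ℤ) :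
    lamCoeff ((formalJ n + cst q) * P - P * (formalJ n + cst q)) i
      = ⁅bMat n + q, lamCoeff P i⁆ + ⁅betaMat n, lamCoeff P (i - 1)⁆ := by
  have e₁ : (lam • cst (betaMat n)) * P = lam • (cst (betaMat n) * P) := by
    ext a b : 2
    simp only [Matrix.mul_apply, Matrix.smul_apply, smul_eq_mul, Finset.mul_sum, mul_assoc]
  have e₂ : P * (lam • cst (betaMat n)) = lam • (P * cst (betaMat n)) := by
    ext a b : 2
    simp only [Matrix.mul_apply, Matrix.smul_apply, smul_eq_mul, Finset.mul_sum, mul_left_comm]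
  simp only [formalJ_eq, add_mul, mul_add, e₁, e₂, lamCoeff_sub,
    lamCoeff_add, lamCoeff_lam_smul, lamCoeff_cst_mul, lamCoeff_mul_cst, Ring.lie_def]
  abel

section Conj

variable {g h M : Mat n (LaurentSeries ℝ)} {d : ℤ} (hg : DegLE 0 g) (hg0 : lamCoeff g 0 = 1)
  (hh : DegLE 0 h) (hh0 : lamCoeff h 0 = 1) (hM : DegLE d M)

include hg hh hM in
theorem DegLE.conj : DegLE d (g * M * h) := by
  have := (hg.mul hM).mul hh
  rwa [zero_add, add_zero] at this

include hg hg0 hh hh0 hM in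
theorem lamCoeff_conj_top : lamCoeff (g * M * h) d = lamCoeff M d := by
  have h1 := lamCoeff_mul_top hg hM
  have hgM := hg.mul hM
  rw [zero_add] at h1 hgM
  have h2 := lamCoeff_mul_top hgM hh
  rwa [add_zero, h1, hg0, hh0, one_mul, mul_one] at h2

include hg hg0 hh hh0 hM in
-- For `h = g⁻¹` one has `h₋₁ = -g₋₁`, so the second coefficient changes by the commutator of `g₋₁`
-- with the leading one. This is where the bracket with `β` in the transformed potential comes from.
theorem lamCoeff_conj_top_sub_one : lamCoeff (g * M * h) (d - 1)
    = lamCoeff g (-1) * lamCoeff M d + lamCoeff M (d - 1) + lamCoeff M d * lamCoeff h (-1) := by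
  have h1 := lamCoeff_mul_top hg hM
  have h1' := lamCoeff_mul_top_sub_one hg hM
  have hgM := hg.mul hM
  rw [zero_add] at h1 h1' hgM
  have h2 := lamCoeff_mul_top_sub_one hgM hh
  rwa [add_zero, h1, h1', hg0, hh0, one_mul, mul_one, one_mul, zero_sub] at h2

end Conj

/-- The transformed potential, from the polynomiality of the gauge transform. -/
theorem gauge_eq_formalJ_add {a₁ a₂ : ℝ} {p p' q : Mat n ℝ} (hp : IsoProj p) {B : Mat n ℝ[X]}
    (hB : polyL B = gL a₁ a₂ p * (formalJ n + cst q) * gL a₁ a₂ (sharp p)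
      - gLin (ratL a₁ a₂) (cst p') * gL a₁ a₂ (sharp p)) :
    polyL B = formalJ n + cst (q + (a₁ - a₂) • ⁅betaMat n, p - sharp p⁆) := by
  have hlin : DegLE (-1) (gLin (ratL a₁ a₂) (cst p') * gL a₁ a₂ (sharp p)) := by
    have := (degLE_gLin a₁ a₂ p').mul (degLE_gL (a₁ := a₁) (a₂ := a₂) hp.sharp)
    rwa [add_zero] at this
  refine lamCoeff_ext fun i => ?_
  rw [lamCoeff_formalJ_add]
  -- Negative powers are absent because `B` is a polynomial. Nonnegative powers do not see `g' g⁻¹`,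
  -- which is `O(λ⁻¹)`; so the derivative `p'` drops out.
  rcases lt_or_ge i 0 with hi | hi
  · rw [lamCoeff_polyL_neg B hi, if_neg (by omega), if_neg (by omega), add_zero]
  rw [hB, lamCoeff_sub, hlin i (by omega), sub_zero]
  have g1 := degLE_gL (a₁ := a₁) (a₂ := a₂) hp
  have g2 := degLE_gL (a₁ := a₁) (a₂ := a₂) hp.sharp
  have c1 := lamCoeff_gL_zero (a₁ := a₁) (a₂ := a₂) hp
  have c2 := lamCoeff_gL_zero (a₁ := a₁) (a₂ := a₂) hp.sharp
  by_cases h1 : i = 1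
  · subst h1
    rw [lamCoeff_conj_top g1 c1 g2 c2 (degLE_formalJ_add q), lamCoeff_formalJ_add]
    simp
  by_cases h0 : i = 0
  · subst h0
    have := lamCoeff_conj_top_sub_one g1 c1 g2 c2 (degLE_formalJ_add q)
    rw [sub_self] at this
    rw [this, lamCoeff_formalJ_add, lamCoeff_formalJ_add, lamCoeff_gL_neg_one hp,
      lamCoeff_gL_neg_one hp.sharp, sharp_sharp, Ring.lie_def]
    simp only [if_true, one_ne_zero, zero_ne_one, if_false, zero_add, add_zero,
      Matrix.smul_mul, Matrix.mul_smul, sub_mul, mul_sub]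
    module
  · rw [DegLE.conj g1 g2 (degLE_formalJ_add q) i (by omega), if_neg h0, if_neg h1, add_zero]

theorem DegLE.pow {P : Mat n (LaurentSeries ℝ)} (hP : DegLE 1 P) (k : ℕ) : DegLE k (P ^ k) := by
  induction k with
  | zero => rw [pow_zero, ← cst_one]; exact degLE_cst _
  | succ k ih => rw [pow_succ]; push_cast; exact ih.mul hP

theorem conj_pow_of_inv {R : Type} [Ring R] {g h : R} (hhg : h * g = 1) (hgh : g * h = 1) (P : R)
    (k : ℕ) : (g * P * h) ^ k = g * P ^ k * h := by
  induction k with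
  | zero => simp [hgh]
  | succ k ih =>
    rw [pow_succ, ih, pow_succ]
    calc g * P ^ k * h * (g * P * h) = g * P ^ k * (h * g) * P * h := by simp only [mul_assoc]
      _ = _ := by rw [hhg, mul_one]; simp only [mul_assoc]

theorem mul_neg_mul_assoc {R : Type} [Ring R] (a b c : R) : a * (-b * c) = -(a * b * c) := by
  noncomm_ring

/-- Gauge covariance of the Lax equation `P' = -[J, P]`. With `k = g⁻¹`, the hypothesis `h` is the
derivative of `g k = 1`, which gives `k' = -k g' k`; then `g P k` obeys the Lax equation for `g J k
- g' k`. -/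
theorem gauge_lie {R : Type} [Ring R] {g k g' k' : R} (hgk : k * g = 1)
    (h : g' * k + g * k' = 0) {J P : R} :
    (g' * P + g * -(J * P - P * J)) * k + g * P * k'
      = -((g * J * k - g' * k) * (g * P * k) - g * P * k * (g * J * k - g' * k)) := by
  have c : ∀ M, k * (g * M) = M := fun M => by rw [← mul_assoc, hgk, one_mul]
  have hk : k' = -(k * (g' * k)) := by
    have := congrArg (k * ·) (eq_neg_of_add_eq_zero_right h)
    simpa only [c, mul_neg] using this
  rw [hk]
  simp only [mul_sub, sub_mul, add_mul, mul_neg, neg_mul, mul_assoc, c]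
  abel

theorem IsResolvent.hasLamDeriv {Ω : Set (ℝ × ℝ)} (hΩ : IsOpen Ω) {q : ℝ → ℝ → Mat n ℝ}
    {P : ℝ → ℝ → Mat n (LaurentSeries ℝ)} (hP : IsResolvent Ω q P) {x t : ℝ} (h : (x, t) ∈ Ω) :
    HasLamDeriv (fun y => P y t)
      (-((formalJ n + cst (q x t)) * P x t - P x t * (formalJ n + cst (q x t)))) x := by
  refine ⟨⟨1, ?_⟩, fun i a b => ?_⟩
  · have n2 : ∀ᶠ y in nhds x, (y, t) ∈ Ω :=
      (Continuous.prodMk_left t).continuousAt.eventually (hΩ.mem_nhds h)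
    exact n2.mono fun y hy i hi => hP.degree_le y t hy i hi
  · have h1 := SmoothM.hasEntryDeriv_fst hΩ (f := fun x t => lamCoeff (P x t) i)
      (fun a b => hP.smooth i a b) h a b
    have h2 := hP.commute x t h i a b
    rw [lamCoeff_neg, lamCoeff_lie_formalJ]
    rw [Matrix.of_apply, eq_neg_of_add_eq_zero_left h2] at h1
    exact h1

/-- Conjugation by a simple element carries the resolvent of `q` to that of the transform. -/
theorem IsResolvent.conj {Ω : Set (ℝ × ℝ)} (hΩ : IsOpen Ω) {q q' : ℝ → ℝ → Mat n ℝ}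
    {P : ℝ → ℝ → Mat n (LaurentSeries ℝ)} (hP : IsResolvent Ω q P) {a₁ a₂ : ℝ}
    {p : ℝ → ℝ → Mat n ℝ} (hp : SmoothM (fun w : ℝ × ℝ => p w.1 w.2) Ω)
    (hiso : ∀ x t, (x, t) ∈ Ω → IsoProj (p x t))
    (hq : ∀ x t, (x, t) ∈ Ω → ∀ p' : Mat n ℝ, HasEntryDeriv (fun y => p y t) p' x →
      formalJ n + cst (q' x t) = gL a₁ a₂ (p x t) * (formalJ n + cst (q x t))
        * gL a₁ a₂ (sharp (p x t)) - gLin (ratL a₁ a₂) (cst p') * gL a₁ a₂ (sharp (p x t))) :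
    IsResolvent Ω q' fun x t => gL a₁ a₂ (p x t) * P x t * gL a₁ a₂ (sharp (p x t)) := by
  have hdeg : ∀ x t, (x, t) ∈ Ω → DegLE 1 (P x t) := fun x t h i hi => hP.degree_le x t h i hi
  have hPs : SmoothLam (fun w : ℝ × ℝ => P w.1 w.2) Ω :=
    ⟨⟨1, fun w hw => hdeg w.1 w.2 hw⟩, fun i a b => hP.smooth i a b⟩
  have hs : SmoothLam (fun w : ℝ × ℝ => gL a₁ a₂ (p w.1 w.2) * P w.1 w.2
      * gL a₁ a₂ (sharp (p w.1 w.2))) Ω :=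
    ((hp.smoothLam_gL a₁ a₂ fun w hw => hiso w.1 w.2 hw).mul hPs).mul
      (hp.sharp.smoothLam_gL a₁ a₂ fun w hw => (hiso w.1 w.2 hw).sharp)
  have gh : ∀ x t, (x, t) ∈ Ω → gL a₁ a₂ (p x t) * gL a₁ a₂ (sharp (p x t)) = 1 :=
    fun x t h => gL_mul_sharp (hiso x t h)
  have hg : ∀ x t, (x, t) ∈ Ω → gL a₁ a₂ (sharp (p x t)) * gL a₁ a₂ (p x t) = 1 :=
    fun x t h => mul_eq_one_comm.1 (gh x t h)
  refine ⟨fun i a b => hs.2 i a b, fun x t h i => ?_, fun x t h i hi => ?_, fun x t h => ?_,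
    fun x t h => ?_, fun x t h i a b => ?_⟩
  · have e : sharp (P x t) = -P x t := lamCoeff_ext fun i => by
      rw [lamCoeff_sharp, lamCoeff_neg]; exact (isSkew_iff _).1 (hP.skew x t h i)
    rw [isSkew_iff, ← lamCoeff_sharp, ← lamCoeff_neg, sharp_mul, sharp_mul, e,
      sharp_gL (hiso x t h), sharp_gL (hiso x t h).sharp, sharp_sharp]
    exact congrArg (lamCoeff · i) (mul_neg_mul_assoc _ _ _)
  · exact DegLE.conj (degLE_gL (hiso x t h)) (degLE_gL (hiso x t h).sharp) (hdeg x t h) i hi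
  · rw [lamCoeff_conj_top (degLE_gL (hiso x t h)) (lamCoeff_gL_zero (hiso x t h))
      (degLE_gL (hiso x t h).sharp) (lamCoeff_gL_zero (hiso x t h).sharp) (hdeg x t h)]
    exact hP.leading x t h
  · obtain ⟨Φ, hΦ⟩ := hP.conjugate x t h
    let G : (Mat n (LaurentSeries ℝ))ˣ :=
      ⟨gL a₁ a₂ (p x t), gL a₁ a₂ (sharp (p x t)), gh x t h, hg x t h⟩
    refine ⟨G * Φ, ?_⟩
    rw [mul_inv_rev, Units.val_mul, Units.val_mul]
    change gL a₁ a₂ (p x t) * P x t * gL a₁ a₂ (sharp (p x t))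
      = gL a₁ a₂ (p x t) * Φ * formalJ n * (((Φ⁻¹ : (Mat n (LaurentSeries ℝ))ˣ) :
        Mat n (LaurentSeries ℝ)) * gL a₁ a₂ (sharp (p x t)))
    rw [hΦ]
    simp only [mul_assoc]
  · have n2 : ∀ᶠ y in nhds x, (y, t) ∈ Ω :=
      (Continuous.prodMk_left t).continuousAt.eventually (hΩ.mem_nhds h)
    have hpx := hp.hasEntryDeriv_fst hΩ (f := p) h
    set p' : Mat n ℝ := Matrix.of fun a b => deriv (fun y => p y t a b) x
    have d1 := hpx.hasLamDeriv_gL a₁ a₂ (n2.mono fun y hy => hiso y t hy)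
    have d2 := hpx.sharp.hasLamDeriv_gL a₁ a₂ (n2.mono fun y hy => (hiso y t hy).sharp)
    have d0 := ((d1.mul d2).congr (n2.mono fun y hy => (gh y t hy).symm)).unique
      (hasLamDeriv_const 1 (d := 0) (by rw [← cst_one]; exact degLE_cst _) x)
    have d3 := (d1.mul (hP.hasLamDeriv hΩ h)).mul d2
    have hA := hq x t h p' hpx
    have key := (d3.deriv i a b).deriv
    rw [key]
    have e : (gLin (ratL a₁ a₂) (cst p') * P x t + gL a₁ a₂ (p x t) *
          -((formalJ n + cst (q x t)) * P x t - P x t * (formalJ n + cst (q x t))))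
          * gL a₁ a₂ (sharp (p x t))
        + gL a₁ a₂ (p x t) * P x t * gLin (ratL a₁ a₂) (cst (sharp p'))
        = -((formalJ n + cst (q' x t)) * (gL a₁ a₂ (p x t) * P x t * gL a₁ a₂ (sharp (p x t)))
          - gL a₁ a₂ (p x t) * P x t * gL a₁ a₂ (sharp (p x t)) * (formalJ n + cst (q' x t))) := by
      rw [hA]
      exact gauge_lie (hg x t h) d0
    rw [e, lamCoeff_neg, lamCoeff_lie_formalJ, Matrix.neg_apply, neg_add_cancel]

end Resolvent

/-! ### Bäcklund transformations of frames with removable singularities -/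

section Frame

open Polynomial

variable {n : ℕ}

theorem toC_mul (A B : Mat n ℝ) : toC (A * B) = toC A * toC B :=
  Matrix.map_mul (f := Complex.ofRealHom)

theorem toC_sharp (A : Mat n ℝ) : toC (sharp A) = sharp (toC A) :=
  (sharp_map Complex.ofRealHom A).symm

theorem toC_one : toC (1 : Mat n ℝ) = 1 :=
  Matrix.map_one Complex.ofRealHom (map_zero _) (map_one _)

theorem toC_injective : Function.Injective (toC (n := n)) := fun A B h => by
  ext i j
  exact Complex.ofReal_injective (congrFun (congrFun h i) j)

theorem gC_ofReal (a₁ a₂ : ℝ) (p : Mat n ℝ) (z : ℝ) : gC a₁ a₂ p z = toC (gElt a₁ a₂ p z) :=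
  (gElt_map Complex.ofRealHom a₁ a₂ z p).symm

theorem IsoProj.toC {p : Mat n ℝ} (hp : IsoProj p) : IsoProj (toC p) := hp.map Complex.ofRealHom

section gC

variable {a₁ a₂ : ℝ} {p : Mat n ℝ} {z : ℂ} (hp : IsoProj p) (h₁ : z ≠ a₁) (h₂ : z ≠ a₂)

include hp h₁ h₂

theorem gC_mul_sharp : gC a₁ a₂ p z * gC a₁ a₂ (sharp p) z = 1 := by
  have := gElt_mul_sharp hp.toC h₁ h₂
  rwa [← toC_sharp] at this

theorem gC_sharp_mul : gC a₁ a₂ (sharp p) z * gC a₁ a₂ p z = 1 :=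
  mul_eq_one_comm.1 (gC_mul_sharp hp h₁ h₂)

theorem sharp_gC : sharp (gC a₁ a₂ p z) = gC a₁ a₂ (sharp p) z := by
  have := sharp_gElt hp.toC h₁ h₂
  rwa [← toC_sharp] at this

theorem gC_inv : (gC a₁ a₂ p z)⁻¹ = gC a₁ a₂ (sharp p) z :=
  Matrix.inv_eq_right_inv (gC_mul_sharp hp h₁ h₂)

end gC

/-- For fixed `(x, t)`: orthogonality, reality, and removable singularities in `S`. -/
structure IsOrthEntireOff (S : Set ℂ) (Φ : ℂ → Mat n ℂ) : Prop where
  entire : ∃ H : ℂ → Mat n ℂ, EntireM H ∧ ∀ z, z ∉ S → H z = Φ z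
  orth : ∀ z, z ∉ S → sharp (Φ z) * Φ z = 1
  real : ∀ a : ℝ, (a : ℂ) ∉ S → ∃ R : Mat n ℝ, Φ a = toC R

theorem toC_realAt {F : ℝ → ℝ → ℂ → Mat n ℂ} {x t a : ℝ} {R : Mat n ℝ} (h : F x t a = toC R) :
    toC (realAt F x t a) = F x t a := by
  rw [realAt, h]; ext; simp [toC]

theorem IsOrthEntireOff.realAt_orth {S : Set ℂ} {F : ℝ → ℝ → ℂ → Mat n ℂ} {x t : ℝ}
    (h : IsOrthEntireOff S (F x t)) {a : ℝ} (ha : (a : ℂ) ∉ S) :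
    sharp (realAt F x t a) * realAt F x t a = 1 := by
  obtain ⟨R, hR⟩ := h.real a ha
  apply toC_injective
  rw [toC_mul, toC_sharp, toC_realAt hR, h.orth _ ha, toC_one]

theorem IsOrthEntireOff.tildeRel {S : Set ℂ} {F : ℝ → ℝ → ℂ → Mat n ℂ} {x t : ℝ}
    (h : IsOrthEntireOff S (F x t)) {a₁ a₂ : ℝ} (h₁ : (a₁ : ℂ) ∉ S) (h₂ : (a₂ : ℂ) ∉ S)
    {π : Mat n ℝ} (hπ : IsoProj π) {Ω : Set (ℝ × ℝ)} {p : ℝ → ℝ → Mat n ℝ}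
    (hp : IsTildeProj Ω a₁ a₂ π F p) (hxt : (x, t) ∈ Ω) :
    TildeRel (realAt F x t a₁) (realAt F x t a₂) π (p x t) :=
  .of_isProjOnto (h.realAt_orth h₁) (h.realAt_orth h₂) hπ (hp x t hxt)

theorem IsOrthEntireOff.dress {S : Set ℂ} {F : ℝ → ℝ → ℂ → Mat n ℂ} {x t : ℝ}
    (h : IsOrthEntireOff S (F x t)) {a₁ a₂ : ℝ} {π : Mat n ℝ} (hπ : IsoProj π)
    {p : ℝ → ℝ → Mat n ℝ} (hp : IsoProj (p x t))
    (hent : ∃ H : ℂ → Mat n ℂ, EntireM H ∧ ∀ z, z ∉ S ∪ {(a₁ : ℂ), (a₂ : ℂ)} →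
      H z = dress a₁ a₂ π p F x t z) :
    IsOrthEntireOff (S ∪ {(a₁ : ℂ), (a₂ : ℂ)}) (dress a₁ a₂ π p F x t) where
  entire := hent
  orth := by
    intro z hz
    simp only [Set.mem_union, Set.mem_insert_iff, Set.mem_singleton_iff, not_or] at hz
    obtain ⟨hS, h₁, h₂⟩ := hz
    rw [BKdV.dress, gC_inv hp h₁ h₂, sharp_mul, sharp_mul, sharp_gC hp.sharp h₁ h₂,
      sharp_gC hπ h₁ h₂, sharp_sharp]
    calc _ = gC a₁ a₂ (p x t) z * (sharp (F x t z) * (gC a₁ a₂ (sharp π) z * gC a₁ a₂ π z)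
          * F x t z) * gC a₁ a₂ (sharp (p x t)) z := by simp only [mul_assoc]
      _ = 1 := by
        rw [gC_sharp_mul hπ h₁ h₂, mul_one, h.orth z hS, mul_one, gC_mul_sharp hp h₁ h₂]
  real := by
    intro a ha
    simp only [Set.mem_union, Set.mem_insert_iff, Set.mem_singleton_iff, not_or] at ha
    obtain ⟨hS, h₁, h₂⟩ := ha
    obtain ⟨R, hR⟩ := h.real a hS
    refine ⟨gElt a₁ a₂ π a * R * gElt a₁ a₂ (sharp (p x t)) a, ?_⟩
    rw [BKdV.dress, gC_inv hp h₁ h₂, hR, gC_ofReal, gC_ofReal, toC_mul, toC_mul]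

theorem IsOrthEntireOff.exists_dress {S : Set ℂ} (hS : S.Finite) {F : ℝ → ℝ → ℂ → Mat n ℂ}
    {x t : ℝ} (h : IsOrthEntireOff S (F x t)) {a₁ a₂ : ℝ} (h₁ : (a₁ : ℂ) ∉ S) (h₂ : (a₂ : ℂ) ∉ S)
    {π : Mat n ℝ} (hr : RankLEOne π) {p : ℝ → ℝ → Mat n ℝ}
    (hT : TildeRel (realAt F x t a₁) (realAt F x t a₂) π (p x t)) :
    ∃ H : ℂ → Mat n ℂ, EntireM H ∧ ∀ z, z ∉ S ∪ {(a₁ : ℂ), (a₂ : ℂ)} →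
      H z = BKdV.dress a₁ a₂ π p F x t z := by
  obtain ⟨H, hH, e⟩ := h.entire
  -- Orthogonality passes from the complement of the finite set `S` to all of `ℂ` by continuity of
  -- the extension.
  have horth : ∀ z, sharp (H z) * H z = 1 := by
    refine EntireM.eq_of_eqOn (hH.sharp.mul hH) (entireM_const 1) hS fun z hz => ?_
    simp only [e z hz, h.orth z hz]
  have hre : ∀ a : ℝ, (a : ℂ) ∉ S → (realAt F x t a).map Complex.ofRealHom = H a := by
    intro a ha
    obtain ⟨R, hR⟩ := h.real a ha
    rw [e _ ha]; exact toC_realAt hR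
  have hT' := hT.map Complex.ofRealHom
  rw [hre a₁ h₁, hre a₂ h₂] at hT'
  obtain ⟨E, hE, e'⟩ := hH.exists_dress horth hT' (hr.map _)
  refine ⟨E, hE, fun z hz => ?_⟩
  simp only [Set.mem_union, Set.mem_insert_iff, Set.mem_singleton_iff, not_or] at hz
  obtain ⟨hzS, hz₁, hz₂⟩ := hz
  rw [e' z hz₁ hz₂, BKdV.dress, gC_inv hT.isoProj hz₁ hz₂, e z hzS, sharp_map]
  rfl

/-- A frame whose singularities in `S` are removable for each `(x, t)`. -/
structure IsFrameOff (Ω : Set (ℝ × ℝ)) (j : ℕ) (q : ℝ → ℝ → Mat n ℝ) (S : Set ℂ)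
    (F : ℝ → ℝ → ℂ → Mat n ℂ) : Prop where
  smooth : SmoothM (fun w : (ℝ × ℝ) × ℂ => F w.1.1 w.1.2 w.2) (Ω ×ˢ Sᶜ)
  pointwise : ∀ x t, (x, t) ∈ Ω → IsOrthEntireOff S (F x t)
  evolution : ∃ P : ℝ → ℝ → Mat n (LaurentSeries ℝ), IsResolvent Ω q P ∧
    ∀ x t, (x, t) ∈ Ω → ∀ z, z ∉ S →
      HasEntryDeriv (fun y => F y t z) (F x t z * laxX (q x t) z) x ∧
      HasEntryDeriv (fun s => F x s z)
        (F x t z * plusPart (P x t ^ (2 * j - 1)) (2 * j - 1) z) t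

/-- The start of the iteration, with no exceptional points. Each dressing adds its two parameters to
`S`; at these points the formula for the dressed frame carries no information. -/
theorem IsFrame.isFrameOff {Ω : Set (ℝ × ℝ)} (hΩ : IsOpen Ω) {j : ℕ} {q : ℝ → ℝ → Mat n ℝ}
    {F : ℝ → ℝ → ℂ → Mat n ℂ} (hF : IsFrame Ω j q F) : IsFrameOff Ω j q ∅ F where
  smooth := by
    intro a b
    have := hF.smooth a b
    rwa [Set.compl_empty]
  pointwise := fun x t h =>
    { entire := ⟨F x t, fun a b => hF.holomorphic x t h a b, fun _ _ => rfl⟩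
      orth := fun z _ => (sharp_mul_self_eq_one_iff _).2 (hF.orthogonal x t h z)
      real := fun a _ => by
        refine ⟨realAt F x t a, ?_⟩
        have hr := hF.reality x t h a
        rw [Complex.conj_ofReal] at hr
        ext i j
        have := congrFun (congrFun hr i) j
        rw [Matrix.map_apply] at this
        exact (Complex.conj_eq_iff_re.1 this).symm }
  evolution := by
    obtain ⟨P, hP, h⟩ := hF.evolution
    refine ⟨P, hP, fun x t hxt z _ => ?_⟩
    have hs : SmoothM (fun w : ℝ × ℝ => F w.1 w.2 z) Ω := fun a b =>
      (hF.smooth a b).comp (contDiff_id.prodMk contDiff_const).contDiffOn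
        fun w hw => ⟨hw, Set.mem_univ _⟩
    refine ⟨fun a b => ?_, fun a b => ?_⟩
    · rw [← (h x t hxt z a b).1]
      exact hs.hasEntryDeriv_fst hΩ (f := fun x t => F x t z) hxt a b
    · rw [← (h x t hxt z a b).2]
      exact hs.hasEntryDeriv_snd hΩ (f := fun x t => F x t z) hxt a b

section Step

variable {Ω : Set (ℝ × ℝ)} {j : ℕ} {q : ℝ → ℝ → Mat n ℝ} {S : Set ℂ} {F : ℝ → ℝ → ℂ → Mat n ℂ}
  {a₁ a₂ : ℝ} {π : Mat n ℝ} {p : ℝ → ℝ → Mat n ℝ}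

theorem IsFrameOff.smooth_realAt (hF : IsFrameOff Ω j q S F) {a : ℝ} (ha : (a : ℂ) ∉ S) :
    SmoothM (fun w : ℝ × ℝ => realAt F w.1 w.2 a) Ω := by
  intro i k
  have h := (hF.smooth i k).comp (contDiff_id.prodMk contDiff_const).contDiffOn
    (fun w hw => ⟨hw, ha⟩ : Set.MapsTo (fun w : ℝ × ℝ => (w, (a : ℂ))) Ω (Ω ×ˢ Sᶜ))
  exact Complex.reCLM.contDiff.comp_contDiffOn h

theorem IsFrameOff.smooth_proj (hF : IsFrameOff Ω j q S F) (h₁ : (a₁ : ℂ) ∉ S) (h₂ : (a₂ : ℂ) ∉ S)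
    (hT : ∀ x t, (x, t) ∈ Ω → TildeRel (realAt F x t a₁) (realAt F x t a₂) π (p x t)) :
    SmoothM (fun w : ℝ × ℝ => p w.1 w.2) Ω := by
  have s₁ := hF.smooth_realAt h₁
  have s₂ := hF.smooth_realAt h₂
  have hM := ((smoothM_const π).mul s₂).add ((smoothM_const (1 - π)).mul s₁)
  refine ((hM.inv fun w hw => (hT w.1 w.2 hw).det_ne_zero).mul
    ((smoothM_const π).mul s₂)).congr fun w hw => ?_
  exact (hT w.1 w.2 hw).eq_inv_mul

theorem smooth_dressed {E : Type} [NormedAddCommGroup E] [NormedSpace ℝ E] {s : Set E}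
    {Φ : E → Mat n ℂ} {ρ : E → Mat n ℝ} {ζ : E → ℂ} (hΦ : SmoothM Φ s) (hρ : SmoothM ρ s)
    (hπ : IsoProj π) (hiso : ∀ w ∈ s, IsoProj (ρ w)) (hζ : ContDiffOn ℝ ∞ ζ s)
    (h₁ : ∀ w ∈ s, ζ w ≠ a₁) (h₂ : ∀ w ∈ s, ζ w ≠ a₂) :
    SmoothM (fun w => gC a₁ a₂ π (ζ w) * Φ w * gC a₁ a₂ (sharp (ρ w)) (ζ w)) s :=
  (((smoothM_const π).gC (fun _ _ => hπ) hζ h₁ h₂).mul hΦ).mul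
    (hρ.sharp.gC (fun w hw => (hiso w hw).sharp) hζ h₁ h₂)

/-- The polynomial logarithmic derivative of the dressed frame along a smooth path. -/
theorem IsFrameOff.exists_poly (hΩ : IsOpen Ω) (hF : IsFrameOff Ω j q S F) (hS : S.Finite)
    (ha : a₁ ≠ a₂) (hπ : IsoProj π) (hp : SmoothM (fun w : ℝ × ℝ => p w.1 w.2) Ω)
    (hiso : ∀ x t, (x, t) ∈ Ω → IsoProj (p x t))
    (hent : IsEntireOff Ω (S ∪ {(a₁ : ℂ), (a₂ : ℂ)}) (dress a₁ a₂ π p F))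
    {γ : ℝ → ℝ × ℝ} (hγ : ContDiff ℝ ∞ γ) {y₀ : ℝ} (hy₀ : γ y₀ ∈ Ω) {Q : Mat n ℝ[X]}
    (hQ : ∀ z ∉ S, HasEntryDeriv (fun y => F (γ y).1 (γ y).2 z)
      (F (γ y₀).1 (γ y₀).2 z * polyC z Q) y₀)
    {p' : Mat n ℝ} (hp' : HasEntryDeriv (fun y => p (γ y).1 (γ y).2) p' y₀) :
    ∃ B : Mat n ℝ[X], (∀ z, z ∉ S ∪ {(a₁ : ℂ), (a₂ : ℂ)} →
        HasEntryDeriv (fun y => dress a₁ a₂ π p F (γ y).1 (γ y).2 z)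
          (dress a₁ a₂ π p F (γ y₀).1 (γ y₀).2 z * polyC z B) y₀) ∧
      polyL B = gL a₁ a₂ (p (γ y₀).1 (γ y₀).2) * polyL Q
          * gL a₁ a₂ (sharp (p (γ y₀).1 (γ y₀).2))
        - gLin (ratL a₁ a₂) (cst p') * gL a₁ a₂ (sharp (p (γ y₀).1 (γ y₀).2)) := by
  have hI : IsOpen (γ ⁻¹' Ω) := hΩ.preimage hγ.continuous
  have hd : ∀ x t, (x, t) ∈ Ω → ∀ z, z ∉ S ∪ {(a₁ : ℂ), (a₂ : ℂ)} →
      dress a₁ a₂ π p F x t z = gC a₁ a₂ π z * F x t z * gC a₁ a₂ (sharp (p x t)) z := by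
    intro x t h z hz
    simp only [Set.mem_union, Set.mem_insert_iff, Set.mem_singleton_iff, not_or] at hz
    rw [dress, gC_inv (hiso x t h) hz.2.1 hz.2.2]
  have hne₁ : ∀ z, z ∉ S ∪ {(a₁ : ℂ), (a₂ : ℂ)} → z ≠ a₁ := fun z hz h => hz (by simp [h])
  have hne₂ : ∀ z, z ∉ S ∪ {(a₁ : ℂ), (a₂ : ℂ)} → z ≠ a₂ := fun z hz h => hz (by simp [h])
  have hφ : ContDiff ℝ ∞ fun w : ℝ × ℂ => (γ w.1, w.2) := (hγ.comp contDiff_fst).prodMk contDiff_snd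
  have hFs : SmoothM (fun w : ℝ × ℂ => F (γ w.1).1 (γ w.1).2 w.2)
      ((γ ⁻¹' Ω) ×ˢ (S ∪ {(a₁ : ℂ), (a₂ : ℂ)})ᶜ) :=
    hF.smooth.comp hφ fun w hw => ⟨hw.1, fun h => hw.2 (Or.inl h)⟩
  have hps : SmoothM (fun w : ℝ × ℂ => p (γ w.1).1 (γ w.1).2)
      ((γ ⁻¹' Ω) ×ˢ (S ∪ {(a₁ : ℂ), (a₂ : ℂ)})ᶜ) :=
    hp.comp (φ := fun w : ℝ × ℂ => γ w.1) (hγ.comp contDiff_fst) fun w hw => hw.1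
  obtain ⟨B, hB, hL⟩ := exists_poly_gauge hS ha hI (F := fun y => F (γ y).1 (γ y).2)
    (p := fun y => p (γ y).1 (γ y).2) hy₀ hπ
    (fun y hy z hz => (hF.pointwise _ _ hy).orth z hz) (fun y hy => hiso _ _ hy) hp'
    (smooth_dressed hFs hps hπ (fun w hw => hiso _ _ hw.1) contDiff_snd.contDiffOn
      (fun w hw => hne₁ _ hw.2) (fun w hw => hne₂ _ hw.2)) hQ
    (fun y hy => by
      obtain ⟨H, hH, e⟩ := hent _ _ hy
      exact ⟨H, hH, fun z hz => by rw [e z hz, hd _ _ hy z hz]⟩)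
  refine ⟨B, fun z hz => ?_, hL⟩
  rw [hd _ _ hy₀ z hz]
  refine (hB z hz).congr ?_
  filter_upwards [hI.mem_nhds hy₀] with y hy
  exact hd _ _ hy z hz

/-- A dressing transformation whose result is entire carries solutions and frames to solutions
and frames. -/
theorem IsFrameOff.backlund (hΩ : IsOpen Ω) (hF : IsFrameOff Ω j q S F) (hS : S.Finite)
    (hq : SmoothM (fun w : ℝ × ℝ => q w.1 w.2) Ω) (hqB : ∀ x t, (x, t) ∈ Ω → IsBorel (q x t))
    (ha : a₁ ≠ a₂) (h₁ : (a₁ : ℂ) ∉ S) (h₂ : (a₂ : ℂ) ∉ S)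
    (h0 : (0 : ℂ) ∉ S ∪ {(a₁ : ℂ), (a₂ : ℂ)}) (hπ : IsoProj π)
    (hT : IsTildeProj Ω a₁ a₂ π F p)
    (hent : IsEntireOff Ω (S ∪ {(a₁ : ℂ), (a₂ : ℂ)}) (dress a₁ a₂ π p F)) :
    IsSolution Ω j (backlund a₁ a₂ p q) ∧
      IsFrameOff Ω j (backlund a₁ a₂ p q) (S ∪ {(a₁ : ℂ), (a₂ : ℂ)}) (dress a₁ a₂ π p F) := by
  have hrel : ∀ x t, (x, t) ∈ Ω → TildeRel (realAt F x t a₁) (realAt F x t a₂) π (p x t) :=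
    fun x t h => (hF.pointwise x t h).tildeRel h₁ h₂ hπ hT h
  have hiso : ∀ x t, (x, t) ∈ Ω → IsoProj (p x t) := fun x t h => (hrel x t h).isoProj
  have hp := hF.smooth_proj h₁ h₂ hrel
  obtain ⟨P, hP, hev⟩ := hF.evolution
  have hβ : ∀ x t, (x, t) ∈ Ω → IsSkew (betaMat n) := fun x t h => by
    have := hP.skew x t h 1
    rwa [hP.leading x t h] at this
  have hpt : ∀ x t, (x, t) ∈ Ω → IsOrthEntireOff (S ∪ {(a₁ : ℂ), (a₂ : ℂ)})
      (dress a₁ a₂ π p F x t) := fun x t h =>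
    (hF.pointwise x t h).dress hπ (hiso x t h) (hent x t h)
  have hγx : ∀ t : ℝ, ContDiff ℝ ∞ fun y : ℝ => (y, t) := fun t =>
    contDiff_id.prodMk contDiff_const
  have hγt : ∀ x : ℝ, ContDiff ℝ ∞ fun s : ℝ => (x, s) := fun x =>
    contDiff_const.prodMk contDiff_id
  -- The direction of `x` comes first: its second conclusion makes the conjugated series a resolvent
  -- of the new potential, and that resolvent is needed to name the evolution in `t`.
  have hx : ∀ x t, (x, t) ∈ Ω → ∀ p' : Mat n ℝ, HasEntryDeriv (fun y => p y t) p' x →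
      (∀ z, z ∉ S ∪ {(a₁ : ℂ), (a₂ : ℂ)} → HasEntryDeriv (fun y => dress a₁ a₂ π p F y t z)
        (dress a₁ a₂ π p F x t z * laxX (BKdV.backlund a₁ a₂ p q x t) z) x) ∧
      formalJ n + cst (BKdV.backlund a₁ a₂ p q x t)
        = gL a₁ a₂ (p x t) * (formalJ n + cst (q x t)) * gL a₁ a₂ (sharp (p x t))
          - gLin (ratL a₁ a₂) (cst p') * gL a₁ a₂ (sharp (p x t)) := by
    intro x t h p' hp'
    obtain ⟨B, hB, hL⟩ := hF.exists_poly hΩ hS ha hπ hp hiso hent (hγx t) (y₀ := x) h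
      (Q := laxPoly (q x t)) (fun z hz => by rw [polyC_laxPoly]; exact (hev x t h z hz).1) hp'
    rw [polyL_laxPoly] at hL
    have hB' := gauge_eq_formalJ_add (hiso x t h) hL
    have hBq : B = laxPoly (BKdV.backlund a₁ a₂ p q x t) :=
      polyL_injective (by rw [polyL_laxPoly]; exact hB')
    refine ⟨fun z hz => ?_, hB'.symm.trans hL⟩
    rw [← polyC_laxPoly, ← hBq]
    exact hB z hz
  set P' : ℝ → ℝ → Mat n (LaurentSeries ℝ) :=
    fun x t => gL a₁ a₂ (p x t) * P x t * gL a₁ a₂ (sharp (p x t)) with hP'def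
  have hP' : IsResolvent Ω (BKdV.backlund a₁ a₂ p q) P' :=
    hP.conj hΩ hp hiso fun x t h p' hp' => (hx x t h p' hp').2
  have hdeg : ∀ x t, (x, t) ∈ Ω → DegLE ((2 * j - 1 : ℕ) : ℤ) (P x t ^ (2 * j - 1)) :=
    fun x t h => DegLE.pow (fun i hi => hP.degree_le x t h i hi) _
  have hdeg' : ∀ x t, (x, t) ∈ Ω → DegLE ((2 * j - 1 : ℕ) : ℤ) (P' x t ^ (2 * j - 1)) :=
    fun x t h => DegLE.pow (fun i hi => hP'.degree_le x t h i hi) _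
  have ht : ∀ x t, (x, t) ∈ Ω → ∀ z, z ∉ S ∪ {(a₁ : ℂ), (a₂ : ℂ)} →
      HasEntryDeriv (fun s => dress a₁ a₂ π p F x s z)
        (dress a₁ a₂ π p F x t z * plusPart (P' x t ^ (2 * j - 1)) (2 * j - 1) z) t := by
    intro x t h z hz
    set m := 2 * j - 1 with hm
    have hQc := plusPoly_coeff (hdeg x t h)
    set Q := plusPoly (P x t ^ m) m with hQ
    have hp' := hp.hasEntryDeriv_snd hΩ (f := p) h
    set p' : Mat n ℝ := Matrix.of fun a b => deriv (fun s => p x s a b) t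
    obtain ⟨B, hB, hL⟩ := hF.exists_poly hΩ hS ha hπ hp hiso hent (hγt x) (y₀ := t) h
      (Q := Q) (fun z hz => by
        rw [← plusPart_eq_polyC (hdeg x t h) hQc]
        exact (hev x t h z hz).2) hp'
    have hR : DegLE (-1) (P x t ^ m - polyL Q) := by
      intro i hi
      obtain ⟨k, rfl⟩ := Int.eq_ofNat_of_zero_le (show 0 ≤ i by omega)
      rw [lamCoeff_sub, lamCoeff_polyL, hQc k, sub_self]
    have g1 := degLE_gL (a₁ := a₁) (a₂ := a₂) (hiso x t h)
    have g2 := degLE_gL (a₁ := a₁) (a₂ := a₂) (hiso x t h).sharp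
    have hlin : DegLE (-1) (gLin (ratL a₁ a₂) (cst p') * gL a₁ a₂ (sharp (p x t))) := by
      have := (degLE_gLin a₁ a₂ p').mul g2
      rwa [add_zero] at this
    have hgh := gL_mul_sharp (a₁ := a₁) (a₂ := a₂) (hiso x t h)
    -- `(g P g⁻¹)^m = g P^m g⁻¹`, and replacing `P^m` by the gauge transform `B` of its polynomial
    -- part costs only terms of order `λ⁻¹`. Hence `B` is the polynomial part of `P'^m`.
    have hpow : P' x t ^ m = polyL B + (gL a₁ a₂ (p x t) * (P x t ^ m - polyL Q)
        * gL a₁ a₂ (sharp (p x t)) + gLin (ratL a₁ a₂) (cst p') * gL a₁ a₂ (sharp (p x t))) := by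
      rw [hP'def, conj_pow_of_inv (mul_eq_one_comm.1 hgh) hgh, hL, mul_sub, sub_mul]
      abel
    have hBc : ∀ i : ℕ, lamCoeff (P' x t ^ m) i = B.map (coeff · i) := by
      intro i
      rw [hpow, lamCoeff_add, lamCoeff_polyL,
        (DegLE.conj g1 g2 hR).add hlin i (by omega), add_zero]
    rw [plusPart_eq_polyC (hdeg' x t h) hBc]
    exact hB z hz
  have hx' : ∀ x t, (x, t) ∈ Ω → ∀ z, z ∉ S ∪ {(a₁ : ℂ), (a₂ : ℂ)} →
      HasEntryDeriv (fun y => dress a₁ a₂ π p F y t z)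
        (dress a₁ a₂ π p F x t z * laxX (BKdV.backlund a₁ a₂ p q x t) z) x := fun x t h =>
    (hx x t h _ (hp.hasEntryDeriv_fst hΩ (f := p) h)).1
  have hsm : SmoothM (fun w : (ℝ × ℝ) × ℂ => dress a₁ a₂ π p F w.1.1 w.1.2 w.2)
      (Ω ×ˢ (S ∪ {(a₁ : ℂ), (a₂ : ℂ)})ᶜ) := by
    have hFs : SmoothM (fun w : (ℝ × ℝ) × ℂ => F w.1.1 w.1.2 w.2)
        (Ω ×ˢ (S ∪ {(a₁ : ℂ), (a₂ : ℂ)})ᶜ) := fun a b =>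
      (hF.smooth a b).mono fun w hw => ⟨hw.1, fun h => hw.2 (Or.inl h)⟩
    have hps : SmoothM (fun w : (ℝ × ℝ) × ℂ => p w.1.1 w.1.2)
        (Ω ×ˢ (S ∪ {(a₁ : ℂ), (a₂ : ℂ)})ᶜ) := hp.comp contDiff_fst fun w hw => hw.1
    refine (smooth_dressed hFs hps hπ (fun w hw => hiso _ _ hw.1) contDiff_snd.contDiffOn
      (a₁ := a₁) (a₂ := a₂) (fun w hw h => hw.2 (by simp [h]))
      (fun w hw h => hw.2 (by simp [h]))).congr fun w hw => ?_
    exact congrArg _ (gC_inv (hiso _ _ hw.1) (fun h => hw.2 (by simp [h]))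
      (fun h => hw.2 (by simp [h])))
  have hqs : SmoothM (fun w : ℝ × ℝ => BKdV.backlund a₁ a₂ p q w.1 w.2) Ω := by
    have hd := hp.sub hp.sharp
    have := hq.add (SmoothM.smul (contDiffOn_const (c := a₁ - a₂))
      (((smoothM_const (betaMat n)).mul hd).sub (hd.mul (smoothM_const (betaMat n)))))
    exact this.congr fun w _ => rfl
  refine ⟨⟨hqs, fun x t h => (hqB x t h).backlund (hβ x t h) _, P', hP', ?_⟩,
    ⟨hsm, hpt, P', hP', fun x t h z hz => ⟨hx' x t h z hz, ht x t h z hz⟩⟩⟩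
  have hPs : SmoothLam (fun w : ℝ × ℝ => P' w.1 w.2) Ω :=
    ⟨⟨1, fun w hw i hi => hP'.degree_le w.1 w.2 hw i hi⟩, fun i a b => hP'.smooth i a b⟩
  have hE : SmoothM (fun w : ℝ × ℝ => dress a₁ a₂ π p F w.1 w.2 0) Ω :=
    hsm.comp (φ := fun w : ℝ × ℝ => (w, (0 : ℂ))) (contDiff_id.prodMk contDiff_const)
      fun w hw => ⟨hw, h0⟩
  intro x t h a b
  -- At `λ = 0` the two logarithmic derivatives reduce to `b + q` and to the coefficient of `λ⁰`, so
  -- zero curvature is the flow itself. The point `0` is admissible because it is outside the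
  -- exceptional set (`h0`).
  have hz := zero_curvature hΩ (E := fun x t => dress a₁ a₂ π p F x t 0)
    (X := fun x t => bMat n + BKdV.backlund a₁ a₂ p q x t)
    (T := fun x t => lamCoeff (P' x t ^ (2 * j - 1)) 0) hE
    ((smoothM_const _).add hqs) ((hPs.pow _).2 0)
    (fun x t h => (hpt x t h).orth 0 h0)
    (fun x t h => by
      have := hx' x t h 0 h0
      rwa [laxX, zero_smul, add_zero] at this)
    (fun x t h => by
      have h1 := ht x t h 0 h0
      have h2 : plusPart (P' x t ^ (2 * j - 1)) (2 * j - 1) 0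
          = toC (lamCoeff (P' x t ^ (2 * j - 1)) 0) := by
        rw [plusPart, Finset.sum_range_succ', Finset.sum_eq_zero fun i _ => by
          rw [zero_pow (Nat.succ_ne_zero i), zero_smul]]
        simp
      rwa [h2] at h1) h a b
  have hd : deriv (fun s => BKdV.backlund a₁ a₂ p q x s a b) t
      = deriv (fun s => (bMat n + BKdV.backlund a₁ a₂ p q x s) a b) t :=
    (deriv_const_add (f := fun s => BKdV.backlund a₁ a₂ p q x s a b) (bMat n a b)).symm
  rw [hd, hz]

end Step

end Frame

/-! ### Permutability relations between simple elements -/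

section Permutability

open Filter Topology

variable {n : ℕ}

theorem continuousAt_gElt {a₁ a₂ x : ℝ} (p : Mat n ℝ) (h₁ : x ≠ a₁) (h₂ : x ≠ a₂) :
    ContinuousAt (fun y : ℝ => gElt a₁ a₂ p y) x := by
  have h : ∀ {c d : ℝ} (s : Mat n ℝ), x ≠ c → ContinuousAt (fun y : ℝ => hElt c d s y) x := by
    intro c d s hc
    have : ContinuousAt (fun y : ℝ => (c - d) / (y - c)) x :=
      continuousAt_const.div (by fun_prop) (sub_ne_zero.2 hc)
    exact continuousAt_const.add (this.smul continuousAt_const)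
  exact (h _ h₂).mul (h _ h₁)

variable {α₁ α₂ β₁ β₂ : ℝ} {s p s' p' : Mat n ℝ}

/-- The relation `g_{β₁,β₂,s} g_{α₁,α₂,p} = g_{α₁,α₂,s'} g_{β₁,β₂,p'}`. -/
def Permutes (α₁ α₂ β₁ β₂ : ℝ) (s p s' p' : Mat n ℝ) : Prop :=
  ∀ z : ℂ, z ≠ α₁ → z ≠ α₂ → z ≠ β₁ → z ≠ β₂ →
    gC β₁ β₂ s z * gC α₁ α₂ p z = gC α₁ α₂ s' z * gC β₁ β₂ p' z

theorem Permutes.symm (h : Permutes α₁ α₂ β₁ β₂ s p s' p') :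
    Permutes β₁ β₂ α₁ α₂ s' p' s p := fun z h₁ h₂ h₃ h₄ => (h z h₃ h₄ h₁ h₂).symm

/-- After the denominators at `α₁`, `α₂` are cleared both sides are continuous away from `β₁`, `β₂`.
The relation therefore persists at the parameters `α₁`, `α₂` themselves, which the definition of
`Permutes` excludes. -/
theorem Permutes.mul_gNum (h : Permutes α₁ α₂ β₁ β₂ s p s' p') (hp : IsoProj p)
    (hs' : IsoProj s') {x : ℝ} (h₁ : x ≠ β₁) (h₂ : x ≠ β₂) :
    gElt β₁ β₂ s x * gNum (x - α₁) (x - α₂) p (sharp p)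
      = gNum (x - α₁) (x - α₂) s' (sharp s') * gElt β₁ β₂ p' x := by
  have hc : ∀ r : Mat n ℝ, ContinuousAt (fun y : ℝ => gNum (y - α₁) (y - α₂) r (sharp r)) x := by
    intro r
    have : Continuous (fun y : ℝ => gNum (y - α₁) (y - α₂) r (sharp r)) := by
      unfold gNum; fun_prop
    exact this.continuousAt
  have c₁ := ((continuousAt_gElt s h₁ h₂).mul (hc p)).tendsto.mono_left
    (nhdsWithin_le_nhds (s := {x}ᶜ))
  have c₂ := ((hc s').mul (continuousAt_gElt p' h₁ h₂)).tendsto.mono_left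
    (nhdsWithin_le_nhds (s := {x}ᶜ))
  refine tendsto_nhds_unique_of_eventuallyEq c₁ c₂ ?_
  have hfin : ({α₁, α₂, β₁, β₂} \ {x} : Set ℝ).Finite := Set.Finite.subset (by simp) Set.sdiff_subset
  filter_upwards [self_mem_nhdsWithin,
    nhdsWithin_le_nhds (hfin.isClosed.isOpen_compl.mem_nhds (by simp))] with y hy hy'
  have hn : ∀ a : ℝ, a ∈ ({α₁, α₂, β₁, β₂} : Set ℝ) → y ≠ a := by
    rintro a ha rfl
    exact hy' ⟨ha, hy⟩
  have e := h y (by exact_mod_cast hn α₁ (by simp)) (by exact_mod_cast hn α₂ (by simp))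
    (by exact_mod_cast hn β₁ (by simp)) (by exact_mod_cast hn β₂ (by simp))
  simp only [gC_ofReal, ← toC_mul] at e
  simp only [Pi.mul_apply]
  rw [← smul_gElt hp (hn α₁ (by simp)) (hn α₂ (by simp)),
    ← smul_gElt hs' (hn α₁ (by simp)) (hn α₂ (by simp)), Matrix.mul_smul, Matrix.smul_mul,
    toC_injective e]

variable (hp : IsoProj p) (hs' : IsoProj s') (hα : α₁ ≠ α₂)

include hp hs' hα

/-- At `x = α₁` only the term with `sharp p` survives in the numerator; at `x = α₂`, in the next
lemma, only the term with `p`. -/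
theorem Permutes.residue_fst (h : Permutes α₁ α₂ β₁ β₂ s p s' p')
    (h₁ : α₁ ≠ β₁) (h₂ : α₁ ≠ β₂) :
    gElt β₁ β₂ s α₁ * sharp p = sharp s' * gElt β₁ β₂ p' α₁ := by
  have e := h.mul_gNum hp hs' h₁ h₂
  have hne : (α₁ - α₂) * (α₁ - α₂) ≠ 0 :=
    mul_ne_zero (sub_ne_zero.2 hα) (sub_ne_zero.2 hα)
  simp only [gNum, sub_self, zero_mul, zero_smul, zero_add, Matrix.mul_smul,
    Matrix.smul_mul] at e
  exact smul_right_injective _ hne e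

theorem Permutes.residue_snd (h : Permutes α₁ α₂ β₁ β₂ s p s' p')
    (h₁ : α₂ ≠ β₁) (h₂ : α₂ ≠ β₂) :
    gElt β₁ β₂ s α₂ * p = s' * gElt β₁ β₂ p' α₂ := by
  have e := h.mul_gNum hp hs' h₁ h₂
  have hne : (α₂ - α₁) * (α₂ - α₁) ≠ 0 :=
    mul_ne_zero (sub_ne_zero.2 hα.symm) (sub_ne_zero.2 hα.symm)
  simp only [gNum, sub_self, mul_zero, zero_smul, add_zero, Matrix.mul_smul,
    Matrix.smul_mul] at e
  exact smul_right_injective _ hne e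

/-- Taking adjoints in `residue_fst` and using that the adjoint of a simple element is its inverse
trades `sharp p` for `p`. Both parameters then give relations that intertwine `p` with `s'`. -/
theorem Permutes.residue_fst' (h : Permutes α₁ α₂ β₁ β₂ s p s' p') (hs : IsoProj s)
    (hp' : IsoProj p') (h₁ : α₁ ≠ β₁) (h₂ : α₁ ≠ β₂) :
    gElt β₁ β₂ p' α₁ * p = s' * gElt β₁ β₂ s α₁ := by
  have e := congrArg sharp (h.residue_fst hp hs' hα h₁ h₂)
  rw [sharp_mul, sharp_mul, sharp_sharp, sharp_sharp, sharp_gElt hs h₁ h₂,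
    sharp_gElt hp' h₁ h₂] at e
  calc gElt β₁ β₂ p' α₁ * p
      = gElt β₁ β₂ p' α₁ * (p * gElt β₁ β₂ (sharp s) α₁) * gElt β₁ β₂ s α₁ := by
        rw [mul_assoc, mul_assoc, gElt_sharp_mul hs h₁ h₂, mul_one]
    _ = _ := by rw [e, ← mul_assoc, gElt_mul_sharp hp' h₁ h₂, one_mul]

omit hp hs' hα in
theorem im_eq_map {A B : Mat n ℝ} (h : A * p = s' * B) (hB : IsUnit B.det) :
    im s' = Submodule.map A.mulVecLin (im p) := by
  ext v
  simp only [im, Submodule.mem_map, LinearMap.mem_range, Matrix.mulVecLin_apply]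
  constructor
  · rintro ⟨w, rfl⟩
    refine ⟨p.mulVec (B⁻¹.mulVec w), ⟨_, rfl⟩, ?_⟩
    rw [Matrix.mulVec_mulVec, h, Matrix.mulVec_mulVec, Matrix.mul_nonsing_inv_cancel_right _ _ hB]
  · rintro ⟨_, ⟨w, rfl⟩, rfl⟩
    exact ⟨B.mulVec w, by rw [Matrix.mulVec_mulVec, ← h, Matrix.mulVec_mulVec]⟩

omit hp hs' hα in
theorem ker_eq_map {A B : Mat n ℝ} (h : A * p = s' * B) (hA : IsUnit A.det) (hB : IsUnit B.det) :
    ker s' = Submodule.map B.mulVecLin (ker p) := by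
  ext v
  simp only [ker, Submodule.mem_map, LinearMap.mem_ker, Matrix.mulVecLin_apply]
  constructor
  · intro hv
    refine ⟨B⁻¹.mulVec v, ?_, ?_⟩
    · have e : p = A⁻¹ * (s' * B) := by rw [← h, Matrix.nonsing_inv_mul_cancel_left _ _ hA]
      rw [e, Matrix.mulVec_mulVec, ← mul_assoc, Matrix.mul_nonsing_inv_cancel_right _ _ hB,
        ← Matrix.mulVec_mulVec, hv, Matrix.mulVec_zero]
    · rw [Matrix.mulVec_mulVec, Matrix.mul_nonsing_inv _ hB, Matrix.one_mulVec]
  · rintro ⟨w, hw, rfl⟩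
    rw [Matrix.mulVec_mulVec, ← h, ← Matrix.mulVec_mulVec, hw, Matrix.mulVec_zero]

omit hp hs' hα in
theorem isUnit_det_gElt {a₁ a₂ x : ℝ} {r : Mat n ℝ} (hr : IsoProj r) (h₁ : x ≠ a₁) (h₂ : x ≠ a₂) :
    IsUnit (gElt a₁ a₂ r x).det :=
  Matrix.isUnit_det_of_right_inverse (gElt_mul_sharp hr h₁ h₂)

theorem Permutes.rankLEOne (h : Permutes α₁ α₂ β₁ β₂ s p s' p') (hp' : IsoProj p')
    (h₁ : α₂ ≠ β₁) (h₂ : α₂ ≠ β₂) (hr : RankLEOne p) : RankLEOne s' := by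
  have e := h.residue_snd hp hs' hα h₁ h₂
  have : s' = gElt β₁ β₂ s α₂ * p * gElt β₁ β₂ (sharp p') α₂ := by
    rw [e, mul_assoc, gElt_mul_sharp hp' h₁ h₂, mul_one]
  rw [this]
  exact (hr.mul_left _).mul_right _

theorem Permutes.isProjOnto (h : Permutes α₁ α₂ β₁ β₂ s p s' p') (hs : IsoProj s)
    (hp' : IsoProj p') (h₁ : α₁ ≠ β₁) (h₂ : α₁ ≠ β₂) (h₃ : α₂ ≠ β₁) (h₄ : α₂ ≠ β₂) :
    IsProjOnto s' (Submodule.map (gElt β₁ β₂ p' α₁).mulVecLin (im p))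
      (Submodule.map (gElt β₁ β₂ p' α₂).mulVecLin (ker p)) :=
  ⟨hs'.idem, im_eq_map (h.residue_fst' hp hs' hα hs hp' h₁ h₂) (isUnit_det_gElt hs h₁ h₂),
    ker_eq_map (h.residue_snd hp hs' hα h₃ h₄) (isUnit_det_gElt hs h₃ h₄)
      (isUnit_det_gElt hp' h₃ h₄)⟩

/-- The same two intertwining relations as in `isProjOnto`, with the one that gave the image now
used for the kernel and conversely. This yields the description through the other transformed
projection `s`. -/
theorem Permutes.isProjOnto' (h : Permutes α₁ α₂ β₁ β₂ s p s' p') (hs : IsoProj s)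
    (hp' : IsoProj p') (h₁ : α₁ ≠ β₁) (h₂ : α₁ ≠ β₂) (h₃ : α₂ ≠ β₁) (h₄ : α₂ ≠ β₂) :
    IsProjOnto s' (Submodule.map (gElt β₁ β₂ s α₂).mulVecLin (im p))
      (Submodule.map (gElt β₁ β₂ s α₁).mulVecLin (ker p)) :=
  ⟨hs'.idem, im_eq_map (h.residue_snd hp hs' hα h₃ h₄) (isUnit_det_gElt hp' h₃ h₄),
    ker_eq_map (h.residue_fst' hp hs' hα hs hp' h₁ h₂) (isUnit_det_gElt hp' h₁ h₂)
      (isUnit_det_gElt hs h₁ h₂)⟩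

omit hp hs' hα

/-! #### Behaviour at infinity -/

theorem eventually_ne_cocompact (a : ℂ) : ∀ᶠ z in cocompact ℂ, z ≠ a := by
  have := (isCompact_singleton (x := a)).compl_mem_cocompact
  filter_upwards [this] with z hz using hz

theorem tendsto_smul_gC_sub_one {a₁ a₂ : ℝ} {r : Mat n ℝ} (hr : IsoProj r) :
    Tendsto (fun z : ℂ => z • (gC a₁ a₂ r z - 1)) (cocompact ℂ)
      (𝓝 (toC ((a₁ - a₂) • (sharp r - r)))) := by
  have hinv : ∀ a : ℂ, Tendsto (fun z : ℂ => (z - a)⁻¹) (cocompact ℂ) (𝓝 0) := by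
    intro a
    have h1 : Tendsto (fun z : ℂ => z - a) (cocompact ℂ) (cocompact ℂ) :=
      (Homeomorph.subRight a).isClosedEmbedding.tendsto_cocompact
    have h2 : Tendsto (fun z : ℂ => z⁻¹) (cocompact ℂ) (𝓝 0) := by
      rw [← Metric.cobounded_eq_cocompact]
      exact tendsto_inv₀_cobounded
    exact h2.comp h1
  have hlim : ∀ c d : ℂ, Tendsto (fun z : ℂ => z * (rat c d z - 1)) (cocompact ℂ)
      (𝓝 (c - d)) := by
    intro c d
    have h := ((hinv c).const_mul (c * (c - d))).const_add (c - d)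
    rw [mul_zero, add_zero] at h
    refine h.congr' ?_
    filter_upwards [eventually_ne_cocompact c] with z hz
    have := sub_ne_zero.2 hz
    rw [rat]; field_simp; ring
  have h := ((hlim a₂ a₁).smul_const (toC r)).add ((hlim a₁ a₂).smul_const (sharp (toC r)))
  have e : ((a₂ : ℂ) - a₁) • toC r + ((a₁ : ℂ) - a₂) • sharp (toC r)
      = toC ((a₁ - a₂) • (sharp r - r)) := by
    rw [← toC_sharp]; ext i j; simp [toC]; ring
  rw [e] at h
  refine h.congr' ?_
  filter_upwards [eventually_ne_cocompact a₁, eventually_ne_cocompact a₂] with z h₁ h₂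
  have hi : (rat (a₁ : ℂ) a₂ z)⁻¹ = rat (a₂ : ℂ) a₁ z := by simp [rat]
  rw [gC, gElt_eq hr.toC h₁ h₂, hi]
  module

theorem tendsto_gC {a₁ a₂ : ℝ} {r : Mat n ℝ} (hr : IsoProj r) :
    Tendsto (fun z : ℂ => gC a₁ a₂ r z) (cocompact ℂ) (𝓝 1) := by
  have h2 : Tendsto (fun z : ℂ => z⁻¹) (cocompact ℂ) (𝓝 0) := by
    rw [← Metric.cobounded_eq_cocompact]
    exact tendsto_inv₀_cobounded
  have h := (h2.smul (tendsto_smul_gC_sub_one (a₁ := a₁) (a₂ := a₂) hr)).const_add 1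
  rw [zero_smul, add_zero] at h
  refine h.congr' ?_
  filter_upwards [eventually_ne_cocompact 0] with z hz
  rw [smul_smul, inv_mul_cancel₀ hz, one_smul]
  abel

/-- The coefficient of `λ⁻¹` in the permutability relation. -/
theorem Permutes.coeff_eq (h : Permutes α₁ α₂ β₁ β₂ s p s' p') (hs : IsoProj s) (hp : IsoProj p)
    (hs' : IsoProj s') (hp' : IsoProj p') :
    (β₁ - β₂) • (sharp s - s) + (α₁ - α₂) • (sharp p - p)
      = (α₁ - α₂) • (sharp s' - s') + (β₁ - β₂) • (sharp p' - p') := by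
  have key : ∀ {a₁ a₂ b₁ b₂ : ℝ} {r r' : Mat n ℝ}, IsoProj r → IsoProj r' →
      Tendsto (fun z : ℂ => z • (gC a₁ a₂ r z * gC b₁ b₂ r' z - 1)) (cocompact ℂ)
        (𝓝 (toC ((a₁ - a₂) • (sharp r - r) + (b₁ - b₂) • (sharp r' - r')))) := by
    intro a₁ a₂ b₁ b₂ r r' hr hr'
    have h := ((tendsto_smul_gC_sub_one (a₁ := a₁) (a₂ := a₂) hr).mul
      (tendsto_gC (a₁ := b₁) (a₂ := b₂) hr')).add
      (tendsto_smul_gC_sub_one (a₁ := b₁) (a₂ := b₂) hr')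
    have e : ∀ A B : Mat n ℝ, toC A * 1 + toC B = toC (A + B) := by
      intro A B
      rw [mul_one]; ext i j; simp [toC]
    rw [e] at h
    refine h.congr fun z => ?_
    rw [Matrix.smul_mul, ← smul_add, sub_mul, one_mul, sub_add_sub_cancel]
  refine toC_injective (tendsto_nhds_unique_of_eventuallyEq (key hs hp) (key hs' hp') ?_)
  filter_upwards [eventually_ne_cocompact α₁, eventually_ne_cocompact α₂,
    eventually_ne_cocompact β₁, eventually_ne_cocompact β₂] with z h₁ h₂ h₃ h₄
  rw [h z h₁ h₂ h₃ h₄]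

/-- Permutability of the constant simple elements is inherited by the transformed projections. -/
theorem Permutes.of_dress {F₀ : ℂ → Mat n ℂ} {π₁ π₂ τ₁ τ₂ p₁ p₂ s₁ s₂ : Mat n ℝ}
    (h : Permutes α₁ α₂ β₁ β₂ τ₂ π₁ τ₁ π₂) (hπ₁ : IsoProj π₁) (hτ₂ : IsoProj τ₂)
    (hp₁ : IsoProj p₁) (hp₂ : IsoProj p₂) (hs₁ : IsoProj s₁) (hs₂ : IsoProj s₂)
    (horth : ∀ z, sharp (F₀ z) * F₀ z = 1) {H H' : ℂ → Mat n ℂ} (hH : EntireM H)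
    (hH' : EntireM H')
    (e : ∀ z : ℂ, z ≠ α₁ → z ≠ α₂ → z ≠ β₁ → z ≠ β₂ →
      H z = gC β₁ β₂ τ₂ z * (gC α₁ α₂ π₁ z * F₀ z * (gC α₁ α₂ p₁ z)⁻¹) * (gC β₁ β₂ s₂ z)⁻¹)
    (e' : ∀ z : ℂ, z ≠ α₁ → z ≠ α₂ → z ≠ β₁ → z ≠ β₂ →
      H' z = gC α₁ α₂ τ₁ z * (gC β₁ β₂ π₂ z * F₀ z * (gC β₁ β₂ p₂ z)⁻¹) * (gC α₁ α₂ s₁ z)⁻¹) :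
    Permutes α₁ α₂ β₁ β₂ s₂ p₁ s₁ p₂ := by
  -- The relation between the constant simple elements cancels them, and orthogonality cancels `F₀`.
  -- Only the four transformed factors are left.
  have hD : ∀ z : ℂ, z ≠ α₁ → z ≠ α₂ → z ≠ β₁ → z ≠ β₂ →
      sharp (H z) * H' z = gC β₁ β₂ s₂ z * gC α₁ α₂ p₁ z * gC β₁ β₂ (sharp p₂) z
        * gC α₁ α₂ (sharp s₁) z := by
    intro z h₁ h₂ h₃ h₄
    rw [e z h₁ h₂ h₃ h₄, e' z h₁ h₂ h₃ h₄, gC_inv hp₁ h₁ h₂, gC_inv hs₂ h₃ h₄, gC_inv hp₂ h₃ h₄,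
      gC_inv hs₁ h₁ h₂]
    simp only [sharp_mul, sharp_gC hs₂.sharp h₃ h₄, sharp_gC hp₁.sharp h₁ h₂, sharp_gC hπ₁ h₁ h₂,
      sharp_gC hτ₂ h₃ h₄, sharp_sharp]
    calc _ = gC β₁ β₂ s₂ z * gC α₁ α₂ p₁ z * (sharp (F₀ z) * (gC α₁ α₂ (sharp π₁) z
          * (gC β₁ β₂ (sharp τ₂) z * (gC α₁ α₂ τ₁ z * gC β₁ β₂ π₂ z)) * F₀ z))
          * gC β₁ β₂ (sharp p₂) z * gC α₁ α₂ (sharp s₁) z := by simp only [mul_assoc]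
      _ = _ := by
        rw [← h z h₁ h₂ h₃ h₄, ← mul_assoc (gC β₁ β₂ (sharp τ₂) z), gC_sharp_mul hτ₂ h₃ h₄,
          one_mul, gC_sharp_mul hπ₁ h₁ h₂, one_mul, horth, mul_one]
  have hent := hH.sharp.mul hH'
  have hlim : Tendsto (fun z => sharp (H z) * H' z) (cocompact ℂ) (𝓝 1) := by
    have hl := (((tendsto_gC (a₁ := β₁) (a₂ := β₂) hs₂).mul
      (tendsto_gC (a₁ := α₁) (a₂ := α₂) hp₁)).mul
      (tendsto_gC (a₁ := β₁) (a₂ := β₂) hp₂.sharp)).mul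
      (tendsto_gC (a₁ := α₁) (a₂ := α₂) hs₁.sharp)
    rw [one_mul, one_mul, one_mul] at hl
    refine hl.congr' ?_
    filter_upwards [eventually_ne_cocompact α₁, eventually_ne_cocompact α₂,
      eventually_ne_cocompact β₁, eventually_ne_cocompact β₂] with z h₁ h₂ h₃ h₄
    exact (hD z h₁ h₂ h₃ h₄).symm
  -- Liouville's theorem: an entire function with a limit at infinity is constant.
  have hone : ∀ z, sharp (H z) * H' z = 1 := by
    intro z
    ext i j
    refine (hent i j).apply_eq_of_tendsto_cocompact z ?_
    exact ((continuous_apply_apply i j).tendsto (1 : Mat n ℂ)).comp hlim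
  intro z h₁ h₂ h₃ h₄
  have h1 := hD z h₁ h₂ h₃ h₄
  rw [hone z] at h1
  calc gC β₁ β₂ s₂ z * gC α₁ α₂ p₁ z
      = gC β₁ β₂ s₂ z * gC α₁ α₂ p₁ z * (gC β₁ β₂ (sharp p₂) z
        * (gC α₁ α₂ (sharp s₁) z * gC α₁ α₂ s₁ z) * gC β₁ β₂ p₂ z) := by
        rw [gC_sharp_mul hs₁ h₁ h₂, mul_one, gC_sharp_mul hp₂ h₃ h₄, mul_one]
    _ = (gC β₁ β₂ s₂ z * gC α₁ α₂ p₁ z * gC β₁ β₂ (sharp p₂) z * gC α₁ α₂ (sharp s₁) z)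
        * (gC α₁ α₂ s₁ z * gC β₁ β₂ p₂ z) := by simp only [mul_assoc]
    _ = _ := by rw [← h1, one_mul]

end Permutability

theorem lie_smul_add_smul {n : ℕ} (B X Y : Mat n ℝ) (c d : ℝ) :
    ⁅B, c • X + d • Y⁆ = c • ⁅B, X⁆ + d • ⁅B, Y⁆ := by
  simp only [Ring.lie_def, mul_add, add_mul, mul_smul_comm, smul_mul_assoc]
  module

end BKdV

end

/-! ### The permutability theorem -/

theorem mainTheorem10 (n j : ℕ) (hn : 1 ≤ n) (hj : 1 ≤ j)
    -- the domain, and a solution `q` of the `(2j-1)`-th flow on it with a frame `F`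
    (Ω : Set (ℝ × ℝ)) (hΩ : IsOpen Ω)
    (q : ℝ → ℝ → BKdV.Mat n ℝ) (hq : BKdV.IsSolution Ω j q)
    (F : ℝ → ℝ → ℂ → BKdV.Mat n ℂ) (hF : BKdV.IsFrame Ω j q F)
    -- four distinct nonzero parameters
    (α₁ α₂ β₁ β₂ : ℝ) (hne : α₁ ≠ 0 ∧ α₂ ≠ 0 ∧ β₁ ≠ 0 ∧ β₂ ≠ 0)
    (hdist : α₁ ≠ α₂ ∧ α₁ ≠ β₁ ∧ α₁ ≠ β₂ ∧ α₂ ≠ β₁ ∧ α₂ ≠ β₂ ∧ β₁ ≠ β₂)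
    -- the constant projections, and the relation between the simple elements
    (π₁ π₂ τ₁ τ₂ : BKdV.Mat n ℝ)
    (hπ₁ : BKdV.IsIsotropicProj π₁) (hπ₂ : BKdV.IsIsotropicProj π₂)
    (hτ₁ : BKdV.IsIsotropicProj τ₁) (hτ₂ : BKdV.IsIsotropicProj τ₂)
    (hperm : ∀ z : ℂ, z ∉ ({(α₁ : ℂ), (α₂ : ℂ), (β₁ : ℂ), (β₂ : ℂ)} : Set ℂ) →
      BKdV.gC β₁ β₂ τ₂ z * BKdV.gC α₁ α₂ π₁ z = BKdV.gC α₁ α₂ τ₁ z * BKdV.gC β₁ β₂ π₂ z)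
    -- the transforms `q₁`, `q₂` of `q` and the transformed frames `F₁`, `F₂`
    (p₁ p₂ : ℝ → ℝ → BKdV.Mat n ℝ)
    (hp₁ : BKdV.IsTildeProj Ω α₁ α₂ π₁ F p₁) (hp₂ : BKdV.IsTildeProj Ω β₁ β₂ π₂ F p₂)
    (q₁ q₂ : ℝ → ℝ → BKdV.Mat n ℝ)
    (hq₁ : q₁ = BKdV.backlund α₁ α₂ p₁ q) (hq₂ : q₂ = BKdV.backlund β₁ β₂ p₂ q)
    (F₁ F₂ : ℝ → ℝ → ℂ → BKdV.Mat n ℂ)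
    (hF₁ : F₁ = BKdV.dress α₁ α₂ π₁ p₁ F) (hF₂ : F₂ = BKdV.dress β₁ β₂ π₂ p₂ F)
    -- the transforms `q₁₂` of `q₁` and `q₂₁` of `q₂` and their frames
    (s₁ s₂ : ℝ → ℝ → BKdV.Mat n ℝ)
    (hs₂ : BKdV.IsTildeProj Ω β₁ β₂ τ₂ F₁ s₂) (hs₁ : BKdV.IsTildeProj Ω α₁ α₂ τ₁ F₂ s₁)
    (q₁₂ q₂₁ : ℝ → ℝ → BKdV.Mat n ℝ)
    (hq₁₂ : q₁₂ = BKdV.backlund β₁ β₂ s₂ q₁) (hq₂₁ : q₂₁ = BKdV.backlund α₁ α₂ s₁ q₂)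
    (F₁₂ F₂₁ : ℝ → ℝ → ℂ → BKdV.Mat n ℂ)
    (hF₁₂ : F₁₂ = BKdV.dress β₁ β₂ τ₂ s₂ F₁) (hF₂₁ : F₂₁ = BKdV.dress α₁ α₂ τ₁ s₁ F₂) :
    -- if the projections have rank at most one, then all transformed frames are entire in `λ`
    (π₁.rank ≤ 1 → π₂.rank ≤ 1 →
      BKdV.IsEntireOff Ω {(α₁ : ℂ), (α₂ : ℂ)} F₁ ∧
      BKdV.IsEntireOff Ω {(β₁ : ℂ), (β₂ : ℂ)} F₂ ∧
      BKdV.IsEntireOff Ω {(α₁ : ℂ), (α₂ : ℂ), (β₁ : ℂ), (β₂ : ℂ)} F₁₂ ∧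
      BKdV.IsEntireOff Ω {(α₁ : ℂ), (α₂ : ℂ), (β₁ : ℂ), (β₂ : ℂ)} F₂₁) ∧
    -- whenever the transformed frames are entire in `λ`, permutability holds
    (BKdV.IsEntireOff Ω {(α₁ : ℂ), (α₂ : ℂ)} F₁ →
      BKdV.IsEntireOff Ω {(β₁ : ℂ), (β₂ : ℂ)} F₂ →
      BKdV.IsEntireOff Ω {(α₁ : ℂ), (α₂ : ℂ), (β₁ : ℂ), (β₂ : ℂ)} F₁₂ →
      BKdV.IsEntireOff Ω {(α₁ : ℂ), (α₂ : ℂ), (β₁ : ℂ), (β₂ : ℂ)} F₂₁ →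
      BKdV.IsSolution Ω j q₁ ∧ BKdV.IsSolution Ω j q₂ ∧
      BKdV.IsSolution Ω j q₁₂ ∧ BKdV.IsSolution Ω j q₂₁ ∧
      ∃ σ₁ σ₂ : ℝ → ℝ → BKdV.Mat n ℝ, ∀ x t, (x, t) ∈ Ω →
        BKdV.IsProjOnto (σ₁ x t)
          (Submodule.map (BKdV.gElt β₁ β₂ (p₂ x t) α₁).mulVecLin (BKdV.im (p₁ x t)))
          (Submodule.map (BKdV.gElt β₁ β₂ (p₂ x t) α₂).mulVecLin (BKdV.ker (p₁ x t))) ∧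
        BKdV.IsProjOnto (σ₂ x t)
          (Submodule.map (BKdV.gElt α₁ α₂ (p₁ x t) β₁).mulVecLin (BKdV.im (p₂ x t)))
          (Submodule.map (BKdV.gElt α₁ α₂ (p₁ x t) β₂).mulVecLin (BKdV.ker (p₂ x t))) ∧
        BKdV.IsProjOnto (σ₂ x t)
          (Submodule.map (BKdV.gElt α₁ α₂ (σ₁ x t) β₂).mulVecLin (BKdV.im (p₂ x t)))
          (Submodule.map (BKdV.gElt α₁ α₂ (σ₁ x t) β₁).mulVecLin (BKdV.ker (p₂ x t))) ∧
        q₁₂ x t = q₂₁ x t ∧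
        q₁₂ x t = q₁ x t + (β₁ - β₂) • ⁅BKdV.betaMat n, σ₂ x t - BKdV.sharp (σ₂ x t)⁆ ∧
        q₁₂ x t = q₂ x t + (α₁ - α₂) • ⁅BKdV.betaMat n, σ₁ x t - BKdV.sharp (σ₁ x t)⁆) := by
  obtain ⟨ha₁0, ha₂0, hb₁0, hb₂0⟩ := hne
  obtain ⟨haa, hab₁₁, hab₁₂, hab₂₁, hab₂₂, hbb⟩ := hdist
  have ha₁0' : (0 : ℂ) ≠ α₁ := by exact_mod_cast ha₁0.symm
  have ha₂0' : (0 : ℂ) ≠ α₂ := by exact_mod_cast ha₂0.symm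
  have hb₁0' : (0 : ℂ) ≠ β₁ := by exact_mod_cast hb₁0.symm
  have hb₂0' : (0 : ℂ) ≠ β₂ := by exact_mod_cast hb₂0.symm
  have hS₁₂ : ({(α₁ : ℂ), (α₂ : ℂ)} ∪ {(β₁ : ℂ), (β₂ : ℂ)} : Set ℂ)
      = {(α₁ : ℂ), (α₂ : ℂ), (β₁ : ℂ), (β₂ : ℂ)} := by ext z; simp only [Set.mem_union, Set.mem_insert_iff, Set.mem_singleton_iff]; tauto
  have hS₂₁ : ({(β₁ : ℂ), (β₂ : ℂ)} ∪ {(α₁ : ℂ), (α₂ : ℂ)} : Set ℂ)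
      = {(α₁ : ℂ), (α₂ : ℂ), (β₁ : ℂ), (β₂ : ℂ)} := by ext z; simp only [Set.mem_union, Set.mem_insert_iff, Set.mem_singleton_iff]; tauto
  have hαS : (β₁ : ℂ) ∉ ({(α₁ : ℂ), (α₂ : ℂ)} : Set ℂ) ∧
      (β₂ : ℂ) ∉ ({(α₁ : ℂ), (α₂ : ℂ)} : Set ℂ) := by
    simp [hab₁₁.symm, hab₁₂.symm, hab₂₁.symm, hab₂₂.symm]
  have hβS : (α₁ : ℂ) ∉ ({(β₁ : ℂ), (β₂ : ℂ)} : Set ℂ) ∧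
      (α₂ : ℂ) ∉ ({(β₁ : ℂ), (β₂ : ℂ)} : Set ℂ) := by
    simp [hab₁₁, hab₁₂, hab₂₁, hab₂₂]
  have hP : BKdV.Permutes α₁ α₂ β₁ β₂ τ₂ π₁ τ₁ π₂ := fun z h₁ h₂ h₃ h₄ =>
    hperm z (by simp [h₁, h₂, h₃, h₄])
  have iπ₁ := hπ₁.isoProj
  have iπ₂ := hπ₂.isoProj
  have iτ₁ := hτ₁.isoProj
  have iτ₂ := hτ₂.isoProj
  have hF₀ := hF.isFrameOff hΩ
  have T₁ := fun x t (h : (x, t) ∈ Ω) =>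
    (hF₀.pointwise x t h).tildeRel (a₁ := α₁) (a₂ := α₂) (by simp) (by simp) iπ₁ hp₁ h
  have T₂ := fun x t (h : (x, t) ∈ Ω) =>
    (hF₀.pointwise x t h).tildeRel (a₁ := β₁) (a₂ := β₂) (by simp) (by simp) iπ₂ hp₂ h
  have O₁ : BKdV.IsEntireOff Ω {(α₁ : ℂ), (α₂ : ℂ)} F₁ → ∀ x t, (x, t) ∈ Ω →
      BKdV.IsOrthEntireOff {(α₁ : ℂ), (α₂ : ℂ)} (F₁ x t) := fun hE x t h => by
    have := (hF₀.pointwise x t h).dress (a₁ := α₁) (a₂ := α₂) iπ₁ (T₁ x t h).isoProj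
      (by rw [Set.empty_union, ← hF₁]; exact hE x t h)
    rwa [Set.empty_union, ← hF₁] at this
  have O₂ : BKdV.IsEntireOff Ω {(β₁ : ℂ), (β₂ : ℂ)} F₂ → ∀ x t, (x, t) ∈ Ω →
      BKdV.IsOrthEntireOff {(β₁ : ℂ), (β₂ : ℂ)} (F₂ x t) := fun hE x t h => by
    have := (hF₀.pointwise x t h).dress (a₁ := β₁) (a₂ := β₂) iπ₂ (T₂ x t h).isoProj
      (by rw [Set.empty_union, ← hF₂]; exact hE x t h)
    rwa [Set.empty_union, ← hF₂] at this
  refine ⟨fun r₁ r₂ => ?_, fun E₁ E₂ E₁₂ E₂₁ => ?_⟩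
  · have R₁ := BKdV.rankLEOne_of_rank_le_one r₁
    have R₂ := BKdV.rankLEOne_of_rank_le_one r₂
    -- The rank bounds for `τ₁`, `τ₂` are consequences of the relation: the polar parts at `α₂` and
    -- `β₂` make them products of `π₁`, `π₂` with other matrices.
    have Rτ₁ := hP.rankLEOne iπ₁ iτ₁ haa iπ₂ hab₂₁ hab₂₂ R₁
    have Rτ₂ := hP.symm.rankLEOne iπ₂ iτ₂ hbb iπ₁ hab₁₂.symm hab₂₂.symm R₂
    have E₁ : BKdV.IsEntireOff Ω {(α₁ : ℂ), (α₂ : ℂ)} F₁ := fun x t h => by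
      have := (hF₀.pointwise x t h).exists_dress Set.finite_empty (by simp) (by simp) R₁ (T₁ x t h)
      rwa [Set.empty_union, ← hF₁] at this
    have E₂ : BKdV.IsEntireOff Ω {(β₁ : ℂ), (β₂ : ℂ)} F₂ := fun x t h => by
      have := (hF₀.pointwise x t h).exists_dress Set.finite_empty (by simp) (by simp) R₂ (T₂ x t h)
      rwa [Set.empty_union, ← hF₂] at this
    refine ⟨E₁, E₂, fun x t h => ?_, fun x t h => ?_⟩
    · have := (O₁ E₁ x t h).exists_dress (by simp) hαS.1 hαS.2 Rτ₂
        ((O₁ E₁ x t h).tildeRel hαS.1 hαS.2 iτ₂ hs₂ h)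
      rwa [hS₁₂, ← hF₁₂] at this
    · have := (O₂ E₂ x t h).exists_dress (by simp) hβS.1 hβS.2 Rτ₁
        ((O₂ E₂ x t h).tildeRel hβS.1 hβS.2 iτ₁ hs₁ h)
      rwa [hS₂₁, ← hF₂₁] at this
  · obtain ⟨S₁, W₁⟩ := hF₀.backlund hΩ Set.finite_empty hq.smooth hq.borel haa (by simp) (by simp)
      (by simp [ha₁0', ha₂0']) iπ₁ hp₁ (by rwa [Set.empty_union, ← hF₁])
    obtain ⟨S₂, W₂⟩ := hF₀.backlund hΩ Set.finite_empty hq.smooth hq.borel hbb (by simp) (by simp)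
      (by simp [hb₁0', hb₂0']) iπ₂ hp₂ (by rwa [Set.empty_union, ← hF₂])
    rw [Set.empty_union, ← hF₁, ← hq₁] at W₁
    rw [Set.empty_union, ← hF₂, ← hq₂] at W₂
    rw [← hq₁] at S₁
    rw [← hq₂] at S₂
    obtain ⟨S₁₂, -⟩ := W₁.backlund hΩ (by simp) S₁.smooth S₁.borel hbb hαS.1 hαS.2
      (by simp [ha₁0', ha₂0', hb₁0', hb₂0']) iτ₂ hs₂
      (by rwa [hS₁₂, ← hF₁₂])
    obtain ⟨S₂₁, -⟩ := W₂.backlund hΩ (by simp) S₂.smooth S₂.borel haa hβS.1 hβS.2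
      (by simp [ha₁0', ha₂0', hb₁0', hb₂0']) iτ₁ hs₁
      (by rwa [hS₂₁, ← hF₂₁])
    rw [← hq₁₂] at S₁₂
    rw [← hq₂₁] at S₂₁
    -- The projections sought are those of the second transformations; the transferred permutability
    -- relation identifies their images and kernels.
    refine ⟨S₁, S₂, S₁₂, S₂₁, s₁, s₂, fun x t h => ?_⟩
    have ip₁ := (T₁ x t h).isoProj
    have ip₂ := (T₂ x t h).isoProj
    have is₂ := ((W₁.pointwise x t h).tildeRel hαS.1 hαS.2 iτ₂ hs₂ h).isoProj
    have is₁ := ((W₂.pointwise x t h).tildeRel hβS.1 hβS.2 iτ₁ hs₁ h).isoProj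
    obtain ⟨H, hH, e⟩ := E₁₂ x t h
    obtain ⟨H', hH', e'⟩ := E₂₁ x t h
    have hperm' : BKdV.Permutes α₁ α₂ β₁ β₂ (s₂ x t) (p₁ x t) (s₁ x t) (p₂ x t) := by
      refine hP.of_dress iπ₁ iτ₂ ip₁ ip₂ is₁ is₂
        (fun z => (hF₀.pointwise x t h).orth z (by simp)) hH hH' ?_ ?_
      · intro z h₁ h₂ h₃ h₄
        rw [e z (by simp [h₁, h₂, h₃, h₄]), hF₁₂, BKdV.dress, hF₁, BKdV.dress]
      · intro z h₁ h₂ h₃ h₄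
        rw [e' z (by simp [h₁, h₂, h₃, h₄]), hF₂₁, BKdV.dress, hF₂, BKdV.dress]
    have hcoeff := hperm'.coeff_eq is₂ ip₁ is₁ ip₂
    have hq₁₂' : q₁₂ x t = q₁ x t
        + (β₁ - β₂) • ⁅BKdV.betaMat n, s₂ x t - BKdV.sharp (s₂ x t)⁆ := by rw [hq₁₂]; rfl
    have hq₂₁' : q₂₁ x t = q₂ x t
        + (α₁ - α₂) • ⁅BKdV.betaMat n, s₁ x t - BKdV.sharp (s₁ x t)⁆ := by rw [hq₂₁]; rfl
    have hq₁' : q₁ x t = q x t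
        + (α₁ - α₂) • ⁅BKdV.betaMat n, p₁ x t - BKdV.sharp (p₁ x t)⁆ := by rw [hq₁]; rfl
    have hq₂' : q₂ x t = q x t
        + (β₁ - β₂) • ⁅BKdV.betaMat n, p₂ x t - BKdV.sharp (p₂ x t)⁆ := by rw [hq₂]; rfl
    -- The bracket of `β` with the `λ⁻¹` coefficient of the relation. The sign is reversed first
    -- because that coefficient contains `sharp r - r`, whereas the potential contains `r - sharp
    -- r`.
    have heq : q₁₂ x t = q₂₁ x t := by
      have hneg : (β₁ - β₂) • (s₂ x t - BKdV.sharp (s₂ x t))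
          + (α₁ - α₂) • (p₁ x t - BKdV.sharp (p₁ x t))
          = (α₁ - α₂) • (s₁ x t - BKdV.sharp (s₁ x t))
          + (β₁ - β₂) • (p₂ x t - BKdV.sharp (p₂ x t)) := by
        have h1 := congrArg (fun A => -A) hcoeff
        simp only [neg_add, ← smul_neg, neg_sub] at h1
        exact h1
      have hl := congrArg (fun A => ⁅BKdV.betaMat n, A⁆) hneg
      rw [BKdV.lie_smul_add_smul, BKdV.lie_smul_add_smul] at hl
      rw [hq₁₂', hq₂₁', hq₁', hq₂', add_assoc, add_assoc, add_right_inj, add_comm, hl, add_comm]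
    exact ⟨hperm'.isProjOnto ip₁ is₁ haa is₂ ip₂ hab₁₁ hab₁₂ hab₂₁ hab₂₂,
      hperm'.symm.isProjOnto ip₂ is₂ hbb is₁ ip₁ hab₁₁.symm hab₂₁.symm hab₁₂.symm hab₂₂.symm,
      hperm'.symm.isProjOnto' ip₂ is₂ hbb is₁ ip₁ hab₁₁.symm hab₂₁.symm hab₁₂.symm hab₂₂.symm,
      heq, hq₁₂', heq.trans hq₂₁'⟩
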